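/- Let $d\ge 1$, let $\|\cdot\|$ be the Euclidean norm on $\mathbb R^d$, and let $(W,X,Y(0),Y(1))$ be a random vector with values in $\{0,1\}\times\mathbb R^d\times\mathbb R\times\mathbb R$ with $Y(0),Y(1)$ integrable. Assume: (T1) the support $\mathcal X$ of $X$ is a compact subset of $\mathbb R^d$; (T2) there is $c>0$ such that $|B(x,r)\cap\mathcal X|\ge c\,|B(x,r)|$ for all $x\in\mathcal X$ and $0\le r\le\operatorname{diam}(\mathcal X)$, where $B(x,r)$ is the closed ball and $|\cdot|$ is Lebesgue measure; (T3) $X$ has a density $f$ with respect to Lebesgue measure and there are $\underline f,\bar f>0$ with $\underline f\le f(x)\le\bar f$ for almost all $x\in\mathcal X$; (T4) $W$ is independent of $(Y(0),Y(1))$ conditionally on $X$; (T5) there is $\eta>0$ such that $\eta<\mathbb P(W=1\mid X=x)<1-\eta$ for almost all $x\in\mathcal X$. Let $l\in\mathbb N$ (possibly $0$) and $\beta\in(0,1]$, and suppose that for $w\in\{0,1\}$ the regression function $g_w(x)=\mathbb E[Y(w)\mid X=x]$ is, on $\mathcal X$, the restriction of a function on an open convex neighbourhood of $\mathcal X$ having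 derivatives of order $l$ which are all Hölder continuous of order $\beta$ there. Let $K^*$ be the number of multi-indices $\alpha\in\mathbb N^d$ with $|\alpha|\le l$ and let $D:=\sum_{i=1}^{l} i\binom{d+i-1}{i}$. For $N\ge 1$ let $(W_i,X_i,Y_i(0),Y_i(1))_{1\le i\le N}$ be i.i.d. copies of $(W,X,Y(0),Y(1))$, and let $N_w$ be the number of $i$ with $W_i=w$. For $x\in\mathbb R^d$, $w\in\{0,1\}$ and $1\le k\le N_w$ let $\hat\tau_{k,w}(x)$ be the distance from $x$ to its $k$-th nearest neighbour among the $X_i$ with $W_i=w$, let $\zeta(x,z):=((z-x)^\alpha)_{|\alpha|\le l}\in\mathbb R^{K^*}$, let $e_1$ be the canonical basis vector corresponding to $\alpha=0$, and put $$M_w(x):=\sum_{i:\,W_i=w}\zeta(x,X_i)\zeta(x,X_i)^\top\mathbf 1\{\|X_i-x\|\le\hat\tau_{k,w}(x)\},$$ $$\bar g_w(x):=e_1^\top M_w(x)^{-1}\sum_{i:\,W_i=w}g_w(X_i)\,\zeta(x,X_i)\,\mathbf 1\{\|X_i-x\|\le\hat\tau_{k,w}(x)\}$$ (with $M_w(x)^{-1}:=0$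 if $M_w(x)$ is singular). If $N_w<k$, so that there is no $k$-th nearest neighbour in group $w$, put $\bar g_w(x):=0$. The conditional bias of the local-polynomial estimator (of order $l$, with $k$ neighbours) of the average treatment effect $\mathbb E[Y(1)-Y(0)]$ is $$B:=\frac1N\sum_{i=1}^N(2W_i-1)\bigl(g_{1-W_i}(X_i)-\bar g_{1-W_i}(X_i)\bigr).$$ Then there is a constant $C>0$, not depending on $N$ and $k$, such that for all integers $N\ge 1$ and $k\ge(2D+1)K^*+1$ the random variable $B$ is square integrable and $$\mathbb E[B^2]\le C\left(\frac kN\right)^{2(l+\beta)/d}.$$ -/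

import Mathlib

open MeasureTheory ProbabilityTheory
open scoped NNReal ENNReal

noncomputable section

namespace LocalATE

/-- The value space of one unit `(W, X, (Y(0), Y(1)))`: the treatment indicator (`true` is the
active treatment `W = 1`, `false` is the control `W = 0`), the covariates in `ℝ^d` with its
Euclidean norm, and the two potential outcomes `Y(w)`. -/
abbrev Obs (d : ℕ) : Type := Bool × EuclideanSpace ℝ (Fin d) × (Bool → ℝ)

/-- The treatment indicator `W`. -/
def treat {d : ℕ} (z : Obs d) : Bool := z.1

/-- The covariate vector `X`. -/
def covar {d : ℕ} (z : Obs d) : EuclideanSpace ℝ (Fin d) := z.2.1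

/-- The pair of potential outcomes `(Y(0), Y(1))`. -/
def outcome {d : ℕ} (z : Obs d) : Bool → ℝ := z.2.2

theorem measurable_covar {d : ℕ} : Measurable (covar : Obs d → EuclideanSpace ℝ (Fin d)) :=
  measurable_fst.comp measurable_snd

/-- The σ-algebra `σ(X)` on the value space of one unit. -/
abbrev sigmaX (d : ℕ) : MeasurableSpace (Obs d) :=
  MeasurableSpace.comap covar inferInstance

theorem sigmaX_le (d : ℕ) : sigmaX d ≤ (inferInstance : MeasurableSpace (Obs d)) :=
  measurable_covar.comap_le

/-- The law of the covariates `X` when a unit has law `P`. -/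
def covarLaw {d : ℕ} (P : Measure (Obs d)) : Measure (EuclideanSpace ℝ (Fin d)) :=
  P.map covar

/-- The (topological) support `𝒳` of the covariates. -/
def covarSupport {d : ℕ} (P : Measure (Obs d)) : Set (EuclideanSpace ℝ (Fin d)) :=
  (covarLaw P).support

/-- `|B(x,r) ∩ S| ≥ c |B(x,r)|` for some `c > 0`, all `x ∈ S` and all `0 ≤ r ≤ diam S`. -/
def BallCondition {d : ℕ} (S : Set (EuclideanSpace ℝ (Fin d))) : Prop :=
  ∃ c : ℝ, 0 < c ∧ ∀ x ∈ S, ∀ r : ℝ, 0 ≤ r → r ≤ Metric.diam S →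
    ENNReal.ofReal c * volume (Metric.closedBall x r) ≤ volume (Metric.closedBall x r ∩ S)

/-- `X` has a Lebesgue density `f` which, almost everywhere on the support of `X`, lies between two
positive constants. -/
def DensityCondition {d : ℕ} (P : Measure (Obs d)) : Prop :=
  ∃ f : EuclideanSpace ℝ (Fin d) → ℝ, Measurable f ∧
    covarLaw P = volume.withDensity (fun x => ENNReal.ofReal (f x)) ∧
    ∃ lo hi : ℝ, 0 < lo ∧ 0 < hi ∧
      ∀ᵐ x ∂(volume.restrict (covarSupport P)), lo ≤ f x ∧ f x ≤ hi

/-- Unconfoundedness: `W` is independent of `(Y(0), Y(1))` conditionally on `X`. -/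
def Unconfounded {d : ℕ} (P : Measure (Obs d)) [IsFiniteMeasure P] : Prop :=
  CondIndepFun (sigmaX d) (sigmaX_le d) treat outcome P

/-- Overlap: for some `η > 0`, almost surely `η < ℙ(W = 1 | X) < 1 - η`. -/
def Overlap {d : ℕ} (P : Measure (Obs d)) : Prop :=
  ∃ η : ℝ, 0 < η ∧ ∀ᵐ z ∂P,
    η < (P⟦{z : Obs d | treat z = true}|sigmaX d⟧) z ∧
      (P⟦{z : Obs d | treat z = true}|sigmaX d⟧) z < 1 - η

/-- `g w` is a regression function `x ↦ 𝔼[Y(w) | X = x]` for `w = 0, 1`. -/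
def IsRegression {d : ℕ} (P : Measure (Obs d)) (g : Bool → EuclideanSpace ℝ (Fin d) → ℝ) : Prop :=
  ∀ w, (fun z => g w (covar z)) =ᵐ[P] P[fun z : Obs d => outcome z w|sigmaX d]

/-- `g` is, on `S`, the restriction of a function on an open convex neighbourhood `U` of `S`
whose derivatives of order `l` exist and are Hölder continuous of order `β` on `U`. -/
def HolderExtension {d : ℕ} (l : ℕ) (β : ℝ≥0) (S : Set (EuclideanSpace ℝ (Fin d)))
    (g : EuclideanSpace ℝ (Fin d) → ℝ) : Prop :=
  ∃ (U : Set (EuclideanSpace ℝ (Fin d))) (G : EuclideanSpace ℝ (Fin d) → ℝ),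
    IsOpen U ∧ Convex ℝ U ∧ S ⊆ U ∧ Set.EqOn g G S ∧ ContDiffOn ℝ l G U ∧
      ∃ Λ : ℝ≥0, HolderOnWith Λ β (iteratedFDeriv ℝ l G) U

/-- The multi-indices in `ℕ^d` whose entries sum to at most `L` (so each entry is at most `L`). -/
abbrev MultiIdx (d L : ℕ) : Type := {α : Fin d → Fin (L + 1) // ∑ i, (α i : ℕ) ≤ L}

/-- The multi-index `(0, …, 0)`. -/
def MultiIdx.origin (d L : ℕ) : MultiIdx d L := ⟨fun _ => 0, by simp⟩

/-- `K*`, the number of multi-indices of order at most `L`. -/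
def numMonomials (d L : ℕ) : ℕ := Fintype.card (MultiIdx d L)

/-- `D = ∑_{i=1}^L i (d+i-1 choose i)`, the sum of the degrees of all monomials in `d` variables of
degree at most `L`. -/
def degreeSum (d L : ℕ) : ℕ := ∑ i ∈ Finset.Icc 1 L, i * (d + i - 1).choose i

/-- The vector `ζ(x, z) = ((z - x)^α)_{|α| ≤ L}` of local monomials centred at `x`. -/
def zeta {d : ℕ} (L : ℕ) (x z : EuclideanSpace ℝ (Fin d)) : MultiIdx d L → ℝ :=
  fun α => ∏ i, (z i - x i) ^ (α.1 i : ℕ)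

variable {d N : ℕ}

/-- `N_w`, the number of units with treatment `w`. -/
def groupSize (W : Fin N → Bool) (w : Bool) : ℕ :=
  (Finset.univ.filter fun i => W i = w).card

/-- The distance from `x` to its `k`-th nearest neighbour among the `X i` with `W i = w`: the `k`-th
order statistic of these distances, when there are at least `k ≥ 1` of them. -/
def knnRadius (k : ℕ) (W : Fin N → Bool) (X : Fin N → EuclideanSpace ℝ (Fin d)) (w : Bool)
    (x : EuclideanSpace ℝ (Fin d)) : ℝ :=
  sInf {r : ℝ | k ≤ (Finset.univ.filter fun i => W i = w ∧ ‖X i - x‖ ≤ r).card}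

/-- The indices of the units with treatment `w` within the `k`-nearest-neighbour radius of `x`. -/
def nbrs (k : ℕ) (W : Fin N → Bool) (X : Fin N → EuclideanSpace ℝ (Fin d)) (w : Bool)
    (x : EuclideanSpace ℝ (Fin d)) : Finset (Fin N) :=
  Finset.univ.filter fun i => W i = w ∧ ‖X i - x‖ ≤ knnRadius k W X w x

/-- The matrix `M_w(x) = ∑ ζ(x, X_i) ζ(x, X_i)ᵀ` over the neighbours of `x` with treatment `w`. -/
def gram (L k : ℕ) (W : Fin N → Bool) (X : Fin N → EuclideanSpace ℝ (Fin d)) (w : Bool)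
    (x : EuclideanSpace ℝ (Fin d)) : Matrix (MultiIdx d L) (MultiIdx d L) ℝ :=
  ∑ i ∈ nbrs k W X w x, Matrix.vecMulVec (zeta L x (X i)) (zeta L x (X i))

/-- `e₁ᵀ M_w(x)⁻¹ ∑ g_w(X_i) ζ(x, X_i)`, the sum being over the neighbours of `x` with treatment
`w`. When fewer than `k` units have treatment `w` there is no `k`-th nearest neighbour, and the
value is `0` by convention. -/
def gbar (L k : ℕ) (g : Bool → EuclideanSpace ℝ (Fin d) → ℝ) (W : Fin N → Bool)
    (X : Fin N → EuclideanSpace ℝ (Fin d)) (w : Bool) (x : EuclideanSpace ℝ (Fin d)) : ℝ :=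
  if k ≤ groupSize W w then
    ((gram L k W X w x)⁻¹.mulVec (∑ i ∈ nbrs k W X w x, g w (X i) • zeta L x (X i)))
      (MultiIdx.origin d L)
  else 0

/-- The conditional bias
`B = N⁻¹ ∑ (2 W_i - 1) (g_{1-W_i}(X_i) - gbar_{1-W_i}(X_i))`. -/
def condBias (L k : ℕ) (g : Bool → EuclideanSpace ℝ (Fin d) → ℝ) (W : Fin N → Bool)
    (X : Fin N → EuclideanSpace ℝ (Fin d)) : ℝ :=
  (N : ℝ)⁻¹ * ∑ i, (if W i = true then (1 : ℝ) else -1) *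
    (g (!W i) (X i) - gbar L k g W X (!W i) (X i))

end LocalATE

end

/-! By Cauchy–Schwarz, `B ^ 2` is at most the average over the units `i` of the squared fitting
errors at `X_i`, so it suffices to bound the second moment of one such error by a multiple of
`(k/N)^(2(l+β)/d)`.

Fix a unit at `x`, let `r` be its radius of `k` neighbours in the opposite group, and write `γ = l +
β`. By Taylor's formula `g_w` is, on the support, a polynomial in `z - x` of degree `l` up to `Λ ‖z
- x‖ ^ γ`, with constant term `g_w(x)`. Least squares reproduces polynomials, so the error is linear
in the residuals, and Cauchy–Schwarz bounds its square by `v_o · k Λ² r^(2γ)`, where `v = M⁻¹ e₁`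
and `v_o` is its entry at the zero multi-index. Everything rests on `v_o` being of order `1/k` in
mean.

To see this, split neighbours into disjoint blocks of `K*` points, each giving a square matrix of
rescaled monomials with entries in `[-1, 1]`. Cramer's rule turns the determinants into a lower
bound for the quadratic form of `M`, so `v_o` is at most a constant over the sum of the squared
determinants (`sum_det_sq_mul_leastSquares_error_le`). One determinant has only small negative
moments. Therefore `n = 2D + 1` blocks form a group: the inverse of the group's sum is at most the
product of the powers `|det| ^ (-2/n)`, which are independent. Averaging over `G`, of order `k`,
groups by the harmonic–arithmetic mean inequality gains the factor `1/G`
(`lintegral_inv_sum_det_sq_le`).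

The negative moment of a determinant is reduced, by expanding along one row after another, to that
of one polynomial in one random point. This is bounded by the same power of any coefficient of the
polynomial, one variable at a time; in one variable the polynomial is factored over `ℂ` and its
coefficients are compared with its Mahler measure.

Independence is available because, given the unit and its farthest neighbour, the other `k - 1`
neighbours are i.i.d. with law `P` conditioned on the open ball in the opposite group; the ball,
density and overlap conditions make this law comparable, from above, to the uniform law on the ball.
Finally a Chernoff bound gives `𝔼 r^(2γ)` the order `(k/N)^(2γ/d)`. When the opposite group has
fewer than `k` units, the error is bounded and the radius is replaced by the diameter of the
support, so the same moment bound applies. -/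

/-! ### Negative moments of polynomials on cubes -/

theorem lintegral_Ioo_rpow_neg_le {σ : ℝ} (h1 : σ < 1) :
    ∫⁻ t in Set.Ioo (0 : ℝ) 1, ENNReal.ofReal t ^ (-σ) ≤ ENNReal.ofReal (1 / (1 - σ)) := by
  have hint : IntegrableOn (fun t : ℝ => t ^ (-σ)) (Set.Ioo 0 1) :=
    (intervalIntegral.integrableOn_Ioo_rpow_iff one_pos).2 (by linarith)
  have hcongr : ∫⁻ t in Set.Ioo (0 : ℝ) 1, ENNReal.ofReal t ^ (-σ)
      = ∫⁻ t in Set.Ioo (0 : ℝ) 1, ENNReal.ofReal (t ^ (-σ)) := by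
    refine setLIntegral_congr_fun measurableSet_Ioo fun t ht => ?_
    exact ENNReal.ofReal_rpow_of_pos ht.1
  rw [hcongr, ← ofReal_integral_eq_lintegral_ofReal hint
    ((ae_restrict_iff' measurableSet_Ioo).2 (Filter.Eventually.of_forall
      fun t ht => Real.rpow_nonneg ht.1.le _))]
  refine ENNReal.ofReal_le_ofReal (le_of_eq ?_)
  rw [← integral_Ioc_eq_integral_Ioo, ← intervalIntegral.integral_of_le zero_le_one,
    integral_rpow (Or.inl (by linarith))]
  have : -σ + 1 ≠ 0 := by linarith
  rw [Real.zero_rpow this, Real.one_rpow]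
  congr 1 <;> ring

/-- Uniform in `ρ`: at distance at least 1 from `ρ` the integrand is at most 1, and nearer it is one
of two reflected translates of `t ^ (-σ)` on `(0, 1)`. The leading 2 is the length of the interval.
-/
theorem lintegral_abs_sub_rpow_neg_le {σ : ℝ} (h0 : 0 ≤ σ) (h1 : σ < 1) (ρ : ℝ) :
    ∫⁻ t in Set.Icc (-1 : ℝ) 1, ENNReal.ofReal |t - ρ| ^ (-σ)
      ≤ 2 + 2 * ENNReal.ofReal (1 / (1 - σ)) := by
  set φ : ℝ → ℝ≥0∞ := (Set.Ioo (0 : ℝ) 1).indicator fun t => ENNReal.ofReal t ^ (-σ) with hφ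
  have hφm : Measurable φ := by
    refine Measurable.indicator ?_ measurableSet_Ioo
    exact (ENNReal.measurable_ofReal).pow_const _
  have hφi : ∫⁻ t, φ t ≤ ENNReal.ofReal (1 / (1 - σ)) := by
    rw [hφ, lintegral_indicator measurableSet_Ioo]
    exact lintegral_Ioo_rpow_neg_le h1
  have key : ∀ᵐ t ∂(volume : Measure ℝ),
      ENNReal.ofReal |t - ρ| ^ (-σ) ≤ 1 + (φ (t - ρ) + φ (ρ - t)) := by
    have hne : ∀ᵐ t ∂(volume : Measure ℝ), t ≠ ρ := by
      simp [ae_iff]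
    filter_upwards [hne] with t ht
    rcases lt_or_ge |t - ρ| 1 with h | h
    · rcases lt_or_gt_of_ne ht with h' | h'
      · have hm : ρ - t ∈ Set.Ioo (0 : ℝ) 1 := by
          rw [abs_of_neg (by linarith)] at h; constructor <;> linarith
        rw [abs_of_neg (by linarith), neg_sub]
        refine le_add_left (le_add_left ?_)
        simp [hφ, Set.indicator_of_mem hm]
      · have hm : t - ρ ∈ Set.Ioo (0 : ℝ) 1 := by
          rw [abs_of_pos (by linarith)] at h; constructor <;> linarith
        rw [abs_of_pos (by linarith)]
        refine le_add_left (le_add_right ?_)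
        simp [hφ, Set.indicator_of_mem hm]
    · refine le_add_right ?_
      have : (1 : ℝ≥0∞) ≤ ENNReal.ofReal |t - ρ| := by simpa using h
      rw [ENNReal.rpow_neg]
      refine ENNReal.inv_le_one.2 ?_
      simpa using ENNReal.rpow_le_rpow this h0
  calc ∫⁻ t in Set.Icc (-1 : ℝ) 1, ENNReal.ofReal |t - ρ| ^ (-σ)
      ≤ ∫⁻ t in Set.Icc (-1 : ℝ) 1, (1 + (φ (t - ρ) + φ (ρ - t))) :=
        lintegral_mono_ae (ae_restrict_of_ae key)
    _ = 2 + ∫⁻ t in Set.Icc (-1 : ℝ) 1, (φ (t - ρ) + φ (ρ - t)) := by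
        rw [lintegral_add_left measurable_const]
        norm_num
    _ ≤ 2 + ∫⁻ t, (φ (t - ρ) + φ (ρ - t)) := by
        gcongr; exact Measure.restrict_le_self
    _ = 2 + ((∫⁻ t, φ t) + ∫⁻ t, φ t) := by
        rw [lintegral_add_left (f := fun t => φ (t - ρ)) (hφm.comp (measurable_id.sub_const ρ)),
          lintegral_sub_right_eq_self, lintegral_sub_left_eq_self]
    _ ≤ _ := by
        rw [two_mul]; exact add_le_add le_rfl (add_le_add hφi hφi)

/-- The product is at most a power of its largest factor, which is one of the summands. This
decouples the singularities at the different roots; the 1 covers products with fewer than `n`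
factors and largest factor below 1. -/
theorem ENNReal.multiset_prod_le_one_add_sum_pow {n : ℕ} (m : Multiset ℝ≥0∞)
    (hm : Multiset.card m ≤ n) : m.prod ≤ 1 + (m.map fun y => y ^ n).sum := by
  rcases m.empty_or_exists_mem with rfl | ⟨y₀, hy₀⟩
  · simp
  obtain ⟨y, hy, hmax⟩ := Finset.exists_max_image m.toFinset id ⟨y₀, by simpa using hy₀⟩
  simp only [Multiset.mem_toFinset, id] at hy hmax
  have h1 : m.prod ≤ y ^ Multiset.card m := Multiset.prod_le_pow_card m y hmax
  have h2 : y ^ n ≤ (m.map fun y => y ^ n).sum :=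
    Multiset.single_le_sum (fun _ _ => zero_le) _ (Multiset.mem_map_of_mem _ hy)
  rcases le_total y 1 with h | h
  · exact h1.trans ((pow_le_one' h _).trans le_self_add)
  · exact h1.trans ((pow_le_pow_right' h hm).trans (h2.trans le_add_self))

/-- Trades a complex root for a real one. A root with `2 ≤ ‖z‖` stays at distance at least `‖z‖ / 2`
from `[-1, 1]`, so `r = 0` will do; otherwise `r` is the real part, and the factor `max 1 ‖z‖` is at
most 2. -/
theorem max_one_norm_mul_le (z : ℂ) : ∃ r : ℝ, ∀ t : ℝ, |t| ≤ 1 →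
    max 1 ‖z‖ * |t - r| ≤ 2 * ‖(t : ℂ) - z‖ := by
  rcases le_total 2 ‖z‖ with h | h
  · refine ⟨0, fun t ht => ?_⟩
    have h1 : ‖z‖ - ‖(t : ℂ)‖ ≤ ‖(t : ℂ) - z‖ := by
      rw [norm_sub_rev]; exact norm_sub_norm_le _ _
    rw [Complex.norm_real, Real.norm_eq_abs] at h1
    rw [max_eq_right (by linarith), sub_zero]
    nlinarith [abs_nonneg t]
  · refine ⟨z.re, fun t _ => ?_⟩
    have h1 : |t - z.re| ≤ ‖(t : ℂ) - z‖ := by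
      simpa using Complex.abs_re_le_norm ((t : ℂ) - z)
    exact mul_le_mul (max_le one_le_two h) h1 (abs_nonneg _) zero_le_two

open Polynomial in
-- Each coefficient is at most `2 ^ n` times the Mahler measure, which is the leading coefficient
-- times the product of `max 1 ‖z‖` over the roots. These factors are absorbed root by root at the
-- cost of a further `2 ^ n`.
theorem Polynomial.exists_prod_abs_sub_le (p : ℝ[X]) (i : ℕ) : ∃ ρ : Multiset ℝ,
    Multiset.card ρ ≤ p.natDegree ∧ ∀ t : ℝ, |t| ≤ 1 →
      |p.coeff i| * (ρ.map fun r => |t - r|).prod ≤ 4 ^ p.natDegree * |p.eval t| := by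
  choose f hf using max_one_norm_mul_le
  set q : ℂ[X] := p.map Complex.ofRealHom with hq
  have hdeg : q.natDegree = p.natDegree := natDegree_map _
  have hcard : Multiset.card q.roots = p.natDegree := by
    rw [← hdeg]; exact (IsAlgClosed.splits q).natDegree_eq_card_roots.symm
  refine ⟨q.roots.map f, by simp [hcard], fun t ht => ?_⟩
  have h1 : |p.coeff i| ≤ 2 ^ p.natDegree * q.mahlerMeasure := by
    have := norm_coeff_le_choose_mul_mahlerMeasure i q
    rw [hdeg] at this
    have h2 : ‖q.coeff i‖ = |p.coeff i| := by simp [hq]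
    rw [← h2]
    refine this.trans (mul_le_mul_of_nonneg_right ?_ (mahlerMeasure_nonneg q))
    exact_mod_cast Nat.choose_le_two_pow _ _
  have h3 : ‖q.leadingCoeff‖ * (q.roots.map fun z => ‖(t : ℂ) - z‖).prod = |p.eval t| := by
    have := (IsAlgClosed.splits q).eval_eq_prod_roots (t : ℂ)
    have h4 : q.eval (t : ℂ) = ((p.eval t : ℝ) : ℂ) := by
      rw [hq, eval_map]; exact eval₂_at_apply Complex.ofRealHom t
    rw [h4] at this
    have h5 := congrArg norm this
    rw [Complex.norm_real, Real.norm_eq_abs, norm_mul] at h5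
    rw [h5]
    congr 1
    change _ = (normHom : ℂ →*₀ ℝ) _
    rw [map_multiset_prod, Multiset.map_map]
    rfl
  have h6 : (q.roots.map fun a => max 1 ‖a‖).prod * ((q.roots.map f).map fun r => |t - r|).prod
      ≤ 2 ^ p.natDegree * (q.roots.map fun z => ‖(t : ℂ) - z‖).prod := by
    rw [Multiset.map_map, ← Multiset.prod_map_mul]
    rw [← hcard, ← Multiset.prod_replicate, ← Multiset.map_const', ← Multiset.prod_map_mul]
    refine Multiset.prod_map_le_prod_map₀ _ _ (fun z _ => ?_) fun z _ => ?_
    · exact mul_nonneg (by positivity) (abs_nonneg _)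
    · exact hf z t ht
  have h7 : 0 ≤ ((q.roots.map f).map fun r => |t - r|).prod :=
    by
    refine Multiset.prod_nonneg fun a ha => ?_
    obtain ⟨r, -, rfl⟩ := Multiset.mem_map.1 ha
    exact abs_nonneg _
  calc |p.coeff i| * ((q.roots.map f).map fun r => |t - r|).prod
      ≤ 2 ^ p.natDegree * q.mahlerMeasure * ((q.roots.map f).map fun r => |t - r|).prod :=
        mul_le_mul_of_nonneg_right h1 h7
    _ = 2 ^ p.natDegree * ‖q.leadingCoeff‖ * ((q.roots.map fun a => max 1 ‖a‖).prod
          * ((q.roots.map f).map fun r => |t - r|).prod) := by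
        rw [mahlerMeasure_eq_leadingCoeff_mul_prod_roots]; ring
    _ ≤ 2 ^ p.natDegree * ‖q.leadingCoeff‖ *
          (2 ^ p.natDegree * (q.roots.map fun z => ‖(t : ℂ) - z‖).prod) := by gcongr
    _ = 4 ^ p.natDegree * |p.eval t| := by
        rw [← h3, show (4 : ℝ) = 2 * 2 by norm_num, mul_pow]; ring

theorem lintegral_multiset_sum_abs_sub_rpow_neg_le {σ : ℝ} (h0 : 0 ≤ σ) (h1 : σ < 1)
    (m : Multiset ℝ) :
    ∫⁻ t in Set.Icc (-1 : ℝ) 1, (m.map fun r => ENNReal.ofReal |t - r| ^ (-σ)).sum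
      ≤ Multiset.card m * (2 + 2 * ENNReal.ofReal (1 / (1 - σ))) := by
  induction m using Multiset.induction_on with
  | empty => simp
  | cons a m ih =>
    simp only [Multiset.map_cons, Multiset.sum_cons, Multiset.card_cons]
    rw [lintegral_add_left (by fun_prop)]
    push_cast
    rw [add_mul, one_mul, add_comm]
    exact add_le_add ih (lintegral_abs_sub_rpow_neg_le h0 h1 a)

/-- On `[-1, 1]`, the integral of a small negative power of a polynomial is controlled by the same
power of any of its coefficients. -/
theorem Polynomial.exists_lintegral_abs_eval_rpow_neg_le {s : ℝ} (hs : 0 < s) (n : ℕ)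
    (hsn : s * n < 1) : ∃ C : ℝ≥0, ∀ (p : Polynomial ℝ), p.natDegree ≤ n → ∀ i : ℕ,
      ∫⁻ t in Set.Icc (-1 : ℝ) 1, ENNReal.ofReal |p.eval t| ^ (-s)
        ≤ C * ENNReal.ofReal |p.coeff i| ^ (-s) := by
  set K : ℝ≥0∞ := 2 + 2 * ENNReal.ofReal (1 / (1 - s * n)) with hK
  refine ⟨(ENNReal.ofReal (4 ^ n) ^ s * (2 + n * K)).toNNReal, fun p hp i => ?_⟩
  have hfin : ENNReal.ofReal (4 ^ n) ^ s * (2 + n * K) ≠ ⊤ := by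
    refine ENNReal.mul_ne_top (ENNReal.rpow_ne_top_of_nonneg hs.le ENNReal.ofReal_ne_top) ?_
    refine ENNReal.add_ne_top.2 ⟨by simp, ENNReal.mul_ne_top (by simp) ?_⟩
    exact ENNReal.add_ne_top.2 ⟨by simp, ENNReal.mul_ne_top (by simp) ENNReal.ofReal_ne_top⟩
  rw [ENNReal.coe_toNNReal hfin]
  -- In `ℝ≥0∞` a negative power of 0 is `⊤`, so a vanishing coefficient leaves nothing to prove.
  rcases eq_or_ne (p.coeff i) 0 with h0 | h0
  · rw [h0, abs_zero, ENNReal.ofReal_zero, ENNReal.zero_rpow_of_neg (by linarith),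
      ENNReal.mul_top]
    · exact le_top
    · refine mul_ne_zero ?_ ?_
      · exact (ENNReal.rpow_pos (ENNReal.ofReal_pos.2 (by positivity)) ENNReal.ofReal_ne_top).ne'
      · simp
  obtain ⟨ρ, hρ, hle⟩ := p.exists_prod_abs_sub_le i
  have hA : 0 < ENNReal.ofReal |p.coeff i| := by simpa using h0
  have hpt : ∀ t ∈ Set.Icc (-1 : ℝ) 1, ENNReal.ofReal |p.eval t| ^ (-s)
      ≤ ENNReal.ofReal (4 ^ n) ^ s * ENNReal.ofReal |p.coeff i| ^ (-s) *
        (1 + (ρ.map fun r => ENNReal.ofReal |t - r| ^ (-(s * n))).sum) := by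
    intro t ht
    have h1 := (hle t (abs_le.2 ht)).trans (mul_le_mul_of_nonneg_right
      (pow_le_pow_right₀ (by norm_num : (1 : ℝ) ≤ 4) hp) (abs_nonneg _))
    have h2 := ENNReal.ofReal_le_ofReal h1
    have hprod : ENNReal.ofReal (ρ.map fun r => |t - r|).prod
        = (ρ.map fun r => ENNReal.ofReal |t - r|).prod := by
      clear hle hρ h1 h2
      induction ρ using Multiset.induction_on with
      | empty => simp
      | cons a m ih => simp [ENNReal.ofReal_mul, ih]
    rw [ENNReal.ofReal_mul (abs_nonneg _), ENNReal.ofReal_mul (by positivity), hprod] at h2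
    set A := ENNReal.ofReal |p.coeff i|
    set E := ENNReal.ofReal |p.eval t|
    set F := ENNReal.ofReal ((4 : ℝ) ^ n)
    set Q := (ρ.map fun r => ENNReal.ofReal |t - r|).prod with hQ
    have hAt : A ≠ ⊤ := ENNReal.ofReal_ne_top
    have hFt : F ≠ ⊤ := ENNReal.ofReal_ne_top
    have hF0 : F ≠ 0 := by simp [F]
    have hEt : E ≠ ⊤ := ENNReal.ofReal_ne_top
    have hQt : Q ≠ ⊤ := by rw [← hprod]; exact ENNReal.ofReal_ne_top
    have h3 : (F * E) ^ (-s) ≤ (A * Q) ^ (-s) := by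
      rw [ENNReal.rpow_neg, ENNReal.rpow_neg]
      exact ENNReal.inv_le_inv.2 (ENNReal.rpow_le_rpow h2 hs.le)
    have h4 : Q ^ (-s) = (ρ.map fun r => ENNReal.ofReal |t - r| ^ (-s)).prod := by
      rw [hQ]
      clear h3 h2 hprod hQ hQt hle h1 hρ
      induction ρ using Multiset.induction_on with
      | empty => simp
      | cons a m ih =>
        have hm : (m.map fun r => ENNReal.ofReal |t - r|).prod ≠ ⊤ := by
          refine Multiset.prod_induction (· ≠ ⊤) _ (fun a b => ENNReal.mul_ne_top) (by simp) ?_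
          intro a ha
          obtain ⟨r, -, rfl⟩ := Multiset.mem_map.1 ha
          exact ENNReal.ofReal_ne_top
        simp only [Multiset.map_cons, Multiset.prod_cons]
        rw [ENNReal.mul_rpow_of_ne_top ENNReal.ofReal_ne_top hm, ih]
    -- At most `n` factors of exponent `-s` become single singularities of exponent `-(s * n)`,
    -- integrable because `s * n < 1`.
    have h5 : Q ^ (-s) ≤ 1 + (ρ.map fun r => ENNReal.ofReal |t - r| ^ (-(s * n))).sum := by
      rw [h4]
      refine (ENNReal.multiset_prod_le_one_add_sum_pow _ (by simpa using hρ.trans hp)).trans ?_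
      rw [Multiset.map_map]
      refine le_of_eq ?_
      congr 3
      ext r
      simp only [Function.comp]
      rw [← ENNReal.rpow_natCast, ← ENNReal.rpow_mul, neg_mul]
    rw [ENNReal.mul_rpow_of_ne_top hFt hEt, ENNReal.mul_rpow_of_ne_top hAt hQt] at h3
    have h6 : F ^ s * F ^ (-s) = 1 := by
      rw [← ENNReal.rpow_add _ _ hF0 hFt]; simp
    calc E ^ (-s) = F ^ s * (F ^ (-s) * E ^ (-s)) := by rw [← mul_assoc, h6, one_mul]
      _ ≤ F ^ s * (A ^ (-s) * Q ^ (-s)) := by gcongr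
      _ ≤ F ^ s * (A ^ (-s) *
          (1 + (ρ.map fun r => ENNReal.ofReal |t - r| ^ (-(s * n))).sum)) := by gcongr
      _ = _ := by rw [mul_assoc]
  calc ∫⁻ t in Set.Icc (-1 : ℝ) 1, ENNReal.ofReal |p.eval t| ^ (-s)
      ≤ ∫⁻ t in Set.Icc (-1 : ℝ) 1, ENNReal.ofReal (4 ^ n) ^ s *
          ENNReal.ofReal |p.coeff i| ^ (-s) *
        (1 + (ρ.map fun r => ENNReal.ofReal |t - r| ^ (-(s * n))).sum) :=
        setLIntegral_mono' measurableSet_Icc hpt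
    _ = ENNReal.ofReal (4 ^ n) ^ s * ENNReal.ofReal |p.coeff i| ^ (-s) *
        ∫⁻ t in Set.Icc (-1 : ℝ) 1,
          (1 + (ρ.map fun r => ENNReal.ofReal |t - r| ^ (-(s * n))).sum) := by
        rw [lintegral_const_mul']
        refine ENNReal.mul_ne_top (ENNReal.rpow_ne_top_of_nonneg hs.le ENNReal.ofReal_ne_top) ?_
        exact ENNReal.rpow_ne_top_of_ne_zero hA.ne' ENNReal.ofReal_ne_top
    _ ≤ ENNReal.ofReal (4 ^ n) ^ s * ENNReal.ofReal |p.coeff i| ^ (-s) * (2 + n * K) := by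
        gcongr
        rw [lintegral_add_left measurable_const]
        refine add_le_add (by norm_num) ?_
        refine (lintegral_multiset_sum_abs_sub_rpow_neg_le (by positivity) hsn ρ).trans ?_
        gcongr
        exact_mod_cast hρ.trans hp
    _ = _ := by ring

/-- On the cube `[-1, 1]^d`, the integral of a small negative power of a polynomial of degree at
most `l` in each variable is controlled by the same power of any of its coefficients. -/
theorem exists_lintegral_cube_abs_sum_monomials_rpow_neg_le {s : ℝ} (hs : 0 < s) (l : ℕ)
    (hsl : s * l < 1) (d : ℕ) : ∃ C : ℝ≥0, ∀ (c : (Fin d → Fin (l + 1)) → ℝ) (α),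
      ∫⁻ u, ENNReal.ofReal |∑ β, c β * ∏ i, u i ^ (β i : ℕ)| ^ (-s)
          ∂(Measure.pi fun _ : Fin d => (volume : Measure ℝ).restrict (Set.Icc (-1) 1))
        ≤ C * ENNReal.ofReal |c α| ^ (-s) := by
  obtain ⟨C₁, hC₁⟩ := Polynomial.exists_lintegral_abs_eval_rpow_neg_le hs l hsl
  set ν : Measure ℝ := (volume : Measure ℝ).restrict (Set.Icc (-1) 1) with hν
  induction d with
  | zero =>
    refine ⟨1, fun c α => ?_⟩
    rw [Measure.pi_of_empty]
    simp [Unique.eq_default α]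
  | succ d ih =>
    obtain ⟨C, hC⟩ := ih
    refine ⟨C₁ * C, fun c α => ?_⟩
    have hmp := (measurePreserving_piFinSuccAbove (fun _ : Fin (d + 1) => ν) 0).symm
    rw [← hmp.lintegral_comp_emb (MeasurableEquiv.measurableEmbedding _)]
    -- The polynomial is read as one in the first variable with coefficients `b u j`, polynomials in
    -- the remaining ones. Integrating out the first variable leaves the coefficient of index `α 0`,
    -- in which `c α` is again a coefficient.
    set b : (Fin d → ℝ) → Fin (l + 1) → ℝ := fun u j =>
      ∑ β : Fin d → Fin (l + 1), c (Fin.insertNthEquiv (fun _ => Fin (l + 1)) 0 (j, β)) *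
        ∏ i, u i ^ (β i : ℕ) with hb
    have hsum : ∀ q : ℝ × (Fin d → ℝ),
        ∑ β, c β * ∏ i, (MeasurableEquiv.piFinSuccAbove (fun _ : Fin (d + 1) => ℝ) 0).symm q i
            ^ (β i : ℕ)
          = (∑ j : Fin (l + 1), Polynomial.C (b q.2 j) * Polynomial.X ^ (j : ℕ)).eval q.1 := by
      intro q
      rw [← Equiv.sum_comp (Fin.insertNthEquiv (fun _ => Fin (l + 1)) 0), Fintype.sum_prod_type,
        Polynomial.eval_finsetSum]
      refine Finset.sum_congr rfl fun j _ => ?_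
      simp only [hb, Polynomial.eval_mul, Polynomial.eval_C, Polynomial.eval_pow, Polynomial.eval_X,
        Finset.sum_mul]
      refine Finset.sum_congr rfl fun β _ => ?_
      rw [Fin.prod_univ_succ]
      simp [MeasurableEquiv.piFinSuccAbove]
      ring
    simp_rw [hsum]
    have hmeas : Measurable fun q : ℝ × (Fin d → ℝ) => ENNReal.ofReal
        |(∑ j : Fin (l + 1), Polynomial.C (b q.2 j) * Polynomial.X ^ (j : ℕ)).eval q.1| ^ (-s) := by
      simp only [hb, Polynomial.eval_finsetSum, Polynomial.eval_mul, Polynomial.eval_C,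
        Polynomial.eval_pow, Polynomial.eval_X]
      fun_prop
    rw [lintegral_prod_symm _ hmeas.aemeasurable]
    have hcoeff : ∀ u, (∑ j : Fin (l + 1), Polynomial.C (b u j) *
        Polynomial.X ^ (j : ℕ)).coeff (α 0) = b u (α 0) := by
      intro u
      simp [Polynomial.coeff_C_mul, Polynomial.coeff_X_pow, Fin.val_inj]
    have hdeg : ∀ u, (∑ j : Fin (l + 1), Polynomial.C (b u j) *
        Polynomial.X ^ (j : ℕ)).natDegree ≤ l := by
      intro u
      refine Polynomial.natDegree_sum_le_of_forall_le _ _ fun j _ => ?_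
      exact (Polynomial.natDegree_C_mul_X_pow_le _ _).trans (Nat.lt_succ_iff.1 j.2)
    have hstep : ∀ u : Fin d → ℝ, ∫⁻ t, ENNReal.ofReal
        |(∑ j : Fin (l + 1), Polynomial.C (b u j) * Polynomial.X ^ (j : ℕ)).eval t| ^ (-s) ∂ν
        ≤ C₁ * ENNReal.ofReal |b u (α 0)| ^ (-s) := by
      intro u
      rw [← hcoeff u]
      exact hC₁ _ (hdeg u) _
    calc _ ≤ ∫⁻ u, C₁ * ENNReal.ofReal |b u (α 0)| ^ (-s) ∂(Measure.pi fun _ : Fin d => ν) :=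
          lintegral_mono fun u => hstep u
      _ = C₁ * ∫⁻ u, ENNReal.ofReal |b u (α 0)| ^ (-s) ∂(Measure.pi fun _ : Fin d => ν) :=
          lintegral_const_mul' _ _ ENNReal.coe_ne_top
      _ ≤ C₁ * (C * ENNReal.ofReal |c (Fin.insertNthEquiv (fun _ => Fin (l + 1)) 0
            (α 0, Fin.tail α))| ^ (-s)) := by
          gcongr
          exact hC (fun β => c (Fin.insertNthEquiv (fun _ => Fin (l + 1)) 0 (α 0, β))) (Fin.tail α)
      _ = _ := by
          push_cast
          rw [mul_assoc]
          congr 5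
          simp [Fin.insertNthEquiv]

/-! ### Negative moments of random determinants -/

/-- Expanded along its first row, the determinant is a linear combination of the features of the
first point, with minors of the other, independent points as coefficients. Integrating out the first
point leaves a negative power of one minor. The selection `e` of columns lets the induction delete
columns while `hQ` stays a statement about all of `I`. -/
theorem lintegral_abs_det_fin_rpow_neg_le {Ω₀ I : Type*} [MeasurableSpace Ω₀] {Q : Measure Ω₀}
    [SigmaFinite Q] [Fintype I] [DecidableEq I] {φ : Ω₀ → I → ℝ} (hφ : Measurable φ) {s : ℝ}
    {C₁ : ℝ≥0}
    (hQ : ∀ (c : I → ℝ) (i : I),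
      ∫⁻ ω, ENNReal.ofReal |∑ j, c j * φ ω j| ^ (-s) ∂Q ≤ C₁ * ENNReal.ofReal |c i| ^ (-s))
    (m : ℕ) (e : Fin m → I) (he : Function.Injective e) :
    ∫⁻ z, ENNReal.ofReal |(Matrix.of fun i j => φ (z i) (e j)).det| ^ (-s)
      ∂(Measure.pi fun _ : Fin m => Q) ≤ (C₁ : ℝ≥0∞) ^ m := by
  induction m with
  | zero => simp
  | succ m ih =>
    have hmp := (measurePreserving_piFinSuccAbove (fun _ : Fin (m + 1) => Q) 0).symm
    rw [← hmp.lintegral_comp_emb (MeasurableEquiv.measurableEmbedding _)]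
    set minor : (Fin m → Ω₀) → Fin (m + 1) → ℝ := fun z j =>
      (Matrix.of fun i k => φ (z i) (e (j.succAbove k))).det with hminor
    -- The cofactors, extended by zero to the columns outside the range of `e`.
    set c : (Fin m → Ω₀) → I → ℝ := fun z i =>
      ∑ j, if e j = i then (-1) ^ (j : ℕ) * minor z j else 0 with hc
    have hdet : ∀ q : Ω₀ × (Fin m → Ω₀), (Matrix.of fun i j => φ
        ((MeasurableEquiv.piFinSuccAbove (fun _ : Fin (m + 1) => Ω₀) 0).symm q i) (e j)).det
        = ∑ i, c q.2 i * φ q.1 i := by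
      intro q
      rw [Matrix.det_succ_row_zero]
      simp only [hc, Finset.sum_mul]
      rw [Finset.sum_comm]
      refine Finset.sum_congr rfl fun j _ => ?_
      simp only [ite_mul, zero_mul, Finset.sum_ite_eq, Finset.mem_univ, if_true]
      simp only [MeasurableEquiv.piFinSuccAbove, hminor]
      simp [Matrix.submatrix]
      ring
    simp_rw [hdet]
    have hφi : ∀ i, Measurable fun ω => φ ω i := fun i => (measurable_pi_apply i).comp hφ
    have hminor_meas : ∀ j, Measurable fun z => minor z j := by
      intro j
      simp only [hminor, Matrix.det_apply, Matrix.of_apply]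
      fun_prop
    have hcm : ∀ i, Measurable fun z => c z i := by
      intro i
      simp only [hc]
      refine Finset.measurable_sum _ fun j _ => ?_
      split_ifs <;> fun_prop
    have hmeas : Measurable fun q : Ω₀ × (Fin m → Ω₀) =>
        ENNReal.ofReal |∑ i, c q.2 i * φ q.1 i| ^ (-s) := by
      refine Measurable.pow_const ?_ _
      refine ENNReal.measurable_ofReal.comp (measurable_abs.comp ?_)
      refine Finset.measurable_sum _ fun i _ => ?_
      exact ((hcm i).comp measurable_snd).mul ((hφi i).comp measurable_fst)
    rw [lintegral_prod_symm _ hmeas.aemeasurable]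
    have hc0 : ∀ z, c z (e 0) = minor z 0 := by
      intro z
      simp [hc, he.eq_iff]
    calc _ ≤ ∫⁻ z, C₁ * ENNReal.ofReal |minor z 0| ^ (-s) ∂(Measure.pi fun _ : Fin m => Q) :=
          lintegral_mono fun z => by rw [← hc0]; exact hQ (c z) (e 0)
      _ = C₁ * ∫⁻ z, ENNReal.ofReal |minor z 0| ^ (-s) ∂(Measure.pi fun _ : Fin m => Q) :=
          lintegral_const_mul' _ _ ENNReal.coe_ne_top
      _ ≤ C₁ * (C₁ : ℝ≥0∞) ^ m := by
          gcongr
          exact ih (fun k => e (Fin.succAbove 0 k)) (he.comp Fin.succAbove_right_injective)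
      _ = _ := by rw [pow_succ, mul_comm]

theorem lintegral_abs_det_rpow_neg_le {Ω₀ I : Type*} [MeasurableSpace Ω₀] {Q : Measure Ω₀}
    [SigmaFinite Q] [Fintype I] [DecidableEq I] {φ : Ω₀ → I → ℝ} (hφ : Measurable φ) {s : ℝ}
    {C₁ : ℝ≥0}
    (hQ : ∀ (c : I → ℝ) (i : I),
      ∫⁻ ω, ENNReal.ofReal |∑ j, c j * φ ω j| ^ (-s) ∂Q ≤ C₁ * ENNReal.ofReal |c i| ^ (-s)) :
    ∫⁻ z, ENNReal.ofReal |(Matrix.of fun i j => φ (z i) j).det| ^ (-s)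
      ∂(Measure.pi fun _ : I => Q) ≤ (C₁ : ℝ≥0∞) ^ Fintype.card I := by
  set e := (Fintype.equivFin I).symm with he
  have hmp := measurePreserving_piCongrLeft (fun _ : I => Q) e
  rw [← hmp.lintegral_comp_emb (MeasurableEquiv.measurableEmbedding _)]
  refine le_of_eq_of_le (lintegral_congr fun z => ?_)
    (lintegral_abs_det_fin_rpow_neg_le hφ hQ (Fintype.card I) e e.injective)
  congr 3
  rw [← Matrix.det_submatrix_equiv_self e]
  congr 1
  ext i j
  simp [MeasurableEquiv.piCongrLeft]

theorem measurePreserving_pi_comp_of_injective {Ω₀ κ κ' : Type*} [MeasurableSpace Ω₀]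
    (Q : Measure Ω₀) [IsProbabilityMeasure Q] [Fintype κ] [Fintype κ'] {e : κ' → κ}
    (he : Function.Injective e) :
    MeasurePreserving (fun (z : κ → Ω₀) j => z (e j)) (Measure.pi fun _ : κ => Q)
      (Measure.pi fun _ : κ' => Q) := by
  refine ⟨by fun_prop, ?_⟩
  have h : iIndepFun (fun (i : κ) (z : κ → Ω₀) => z i) (Measure.pi fun _ : κ => Q) :=
    iIndepFun_pi (X := fun _ => id) fun _ => aemeasurable_id
  rw [(iIndepFun_iff_map_fun_eq_pi_map fun i => (measurable_pi_apply _).aemeasurable).1 (h.precomp he)]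
  congr 1
  ext1 i
  exact (measurePreserving_eval (fun _ : κ => Q) (e i)).map_eq

/-- The sum dominates each term; multiply the `n` resulting bounds, each raised to the power `-1/n`.
-/
theorem ENNReal.inv_sum_le_prod_rpow {n : ℕ} (hn : 0 < n) (t : Fin n → ℝ≥0∞) :
    (∑ b, t b)⁻¹ ≤ ∏ b, t b ^ (-(1 / n : ℝ)) := by
  have h1 : (∑ b, t b)⁻¹ = ∏ _b : Fin n, (∑ b, t b) ^ (-(1 / n : ℝ)) := by
    rw [Finset.prod_const, Finset.card_univ, Fintype.card_fin, ← ENNReal.rpow_natCast,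
      ← ENNReal.rpow_mul, neg_mul, one_div, inv_mul_cancel₀ (by positivity), ENNReal.rpow_neg_one]
  rw [h1]
  refine Finset.prod_le_prod' fun b _ => ?_
  rw [ENNReal.rpow_neg, ENNReal.rpow_neg]
  refine ENNReal.inv_le_inv.2 (ENNReal.rpow_le_rpow ?_ (by positivity))
  exact Finset.single_le_sum (f := t) (fun _ _ => zero_le) (Finset.mem_univ b)

/-- The harmonic–arithmetic mean inequality. Terms 0 or `⊤` make the bound trivial and are removed
first. -/
theorem ENNReal.inv_sum_le_sum_inv {G : ℕ} (hG : 0 < G) (t : Fin G → ℝ≥0∞) :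
    (∑ g, t g)⁻¹ ≤ ((G : ℝ≥0∞) ^ 2)⁻¹ * ∑ g, (t g)⁻¹ := by
  have hG2 : ((G : ℝ≥0∞) ^ 2)⁻¹ ≠ 0 := by simp
  by_cases h0 : ∃ g, t g = 0
  · obtain ⟨g, hg⟩ := h0
    have : ∑ g, (t g)⁻¹ = ⊤ := by
      rw [ENNReal.sum_eq_top]; exact ⟨g, Finset.mem_univ _, by simp [hg]⟩
    rw [this, ENNReal.mul_top hG2]
    exact le_top
  by_cases h1 : ∃ g, t g = ⊤
  · obtain ⟨g, hg⟩ := h1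
    have : ∑ g, t g = ⊤ := by
      rw [ENNReal.sum_eq_top]; exact ⟨g, Finset.mem_univ _, hg⟩
    simp [this]
  push Not at h0 h1
  lift t to Fin G → ℝ≥0 using h1
  have hpos : ∀ g, 0 < t g := fun g => pos_iff_ne_zero.2 fun h => h0 g (by simp [h])
  have key := Finset.sq_sum_div_le_sum_sq_div Finset.univ (fun _ : Fin G => (1 : ℝ≥0)) (g := t)
    (fun g _ => hpos g)
  simp only [Finset.sum_const, Finset.card_univ, Fintype.card_fin, nsmul_eq_mul, mul_one, one_pow,
    one_div] at key
  have hsum : 0 < ∑ g, t g := by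
    have : Nonempty (Fin G) := ⟨⟨0, hG⟩⟩
    exact Finset.sum_pos (fun g _ => hpos g) Finset.univ_nonempty
  have key2 : (∑ g, t g)⁻¹ ≤ ((G : ℝ≥0) ^ 2)⁻¹ * ∑ g, (t g)⁻¹ := by
    have hGp : (0 : ℝ≥0) < (G : ℝ≥0) ^ 2 := by positivity
    rw [← div_eq_inv_mul, le_div_iff₀ hGp, mul_comm, ← div_eq_mul_inv]
    exact key
  have : ∀ g, ((t g : ℝ≥0∞))⁻¹ = ((t g)⁻¹ : ℝ≥0) := fun g => (ENNReal.coe_inv (hpos g).ne').symm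
  simp_rw [this]
  rw [← ENNReal.ofNNReal_finsetSum, ← ENNReal.ofNNReal_finsetSum, ← ENNReal.coe_inv hsum.ne']
  have hG' : ((G : ℝ≥0∞) ^ 2)⁻¹ = (((G : ℝ≥0) ^ 2)⁻¹ : ℝ≥0) := by
    rw [ENNReal.coe_inv (by positivity)]; simp
  rw [hG']
  exact_mod_cast key2

/-- Within a group, the `n` blocks use disjoint coordinates and are independent, so the expectation
of the product of the powers `-2/n` factors and only that small negative moment is needed. Averaging
over the groups brings in `1/G`, which later cancels the number of neighbours. -/
theorem lintegral_inv_sum_det_sq_le {Ω₀ I κ : Type*} [MeasurableSpace Ω₀] {Q : Measure Ω₀}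
    [IsProbabilityMeasure Q] [Fintype I] [DecidableEq I] [Fintype κ] {φ : Ω₀ → I → ℝ}
    (hφ : Measurable φ) {n : ℕ} (hn : 0 < n) {C₁ : ℝ≥0}
    (hQ : ∀ (c : I → ℝ) (i : I), ∫⁻ ω, ENNReal.ofReal |∑ j, c j * φ ω j| ^ (-(2 / n : ℝ)) ∂Q
      ≤ C₁ * ENNReal.ofReal |c i| ^ (-(2 / n : ℝ)))
    {G : ℕ} (hG : 0 < G) {e : Fin G × Fin n × I → κ} (he : Function.Injective e) :
    ∫⁻ z, (∑ g : Fin G, ∑ b : Fin n, ENNReal.ofReal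
        ((Matrix.of fun i j => φ (z (e (g, b, i))) j).det ^ 2))⁻¹ ∂(Measure.pi fun _ : κ => Q)
      ≤ (G : ℝ≥0∞)⁻¹ * ((C₁ : ℝ≥0∞) ^ Fintype.card I) ^ n := by
  have hφi : ∀ i, Measurable fun ω => φ ω i := fun i => (measurable_pi_apply i).comp hφ
  set δ : (I → Ω₀) → ℝ≥0∞ := fun y =>
    ENNReal.ofReal |(Matrix.of fun i j => φ (y i) j).det| ^ (-(2 / n : ℝ)) with hδ
  have hδm : Measurable δ := by
    simp only [hδ, Matrix.det_apply, Matrix.of_apply]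
    fun_prop
  have hrow : ∀ (z : κ → Ω₀) g b, ENNReal.ofReal
      ((Matrix.of fun i j => φ (z (e (g, b, i))) j).det ^ 2) ^ (-(1 / n : ℝ))
      = δ fun i => z (e (g, b, i)) := by
    intro z g b
    simp only [hδ]
    rw [← sq_abs, ENNReal.ofReal_pow (abs_nonneg _), ← ENNReal.rpow_natCast, ← ENNReal.rpow_mul]
    congr 1
    push_cast
    ring
  have hpt : ∀ z : κ → Ω₀, (∑ g : Fin G, ∑ b : Fin n, ENNReal.ofReal
        ((Matrix.of fun i j => φ (z (e (g, b, i))) j).det ^ 2))⁻¹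
      ≤ ((G : ℝ≥0∞) ^ 2)⁻¹ * ∑ g : Fin G, ∏ b : Fin n, δ fun i => z (e (g, b, i)) := by
    intro z
    refine (ENNReal.inv_sum_le_sum_inv hG _).trans ?_
    gcongr with g _
    refine (ENNReal.inv_sum_le_prod_rpow hn _).trans (le_of_eq ?_)
    exact Finset.prod_congr rfl fun b _ => hrow z g b
  have hgroup : ∀ g : Fin G, ∫⁻ z : κ → Ω₀, ∏ b : Fin n, δ (fun i => z (e (g, b, i)))
      ∂(Measure.pi fun _ : κ => Q) ≤ ((C₁ : ℝ≥0∞) ^ Fintype.card I) ^ n := by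
    intro g
    have hinj : Function.Injective fun p : Fin n × I => e (g, p.1, p.2) := by
      intro p q hpq
      have := he hpq
      simp only [Prod.mk.injEq, true_and] at this
      exact Prod.ext this.1 this.2
    have hmp := measurePreserving_pi_comp_of_injective Q hinj
    have hcurry : MeasurePreserving (MeasurableEquiv.curry (Fin n) I Ω₀)
        (Measure.pi fun _ : Fin n × I => Q) (Measure.pi fun _ : Fin n => Measure.pi fun _ : I => Q) := by
      refine ⟨(MeasurableEquiv.curry (Fin n) I Ω₀).measurable, ?_⟩
      have := Measure.infinitePi_map_curry (ι := Fin n) (κ := I) (fun _ _ => Q)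
      simpa [Measure.infinitePi_eq_pi] using this
    have hcomp := hcurry.comp hmp
    have : ∫⁻ z : κ → Ω₀, ∏ b : Fin n, δ (fun i => z (e (g, b, i))) ∂(Measure.pi fun _ : κ => Q)
        = ∫⁻ y : Fin n → I → Ω₀, ∏ b, δ (y b)
          ∂(Measure.pi fun _ : Fin n => Measure.pi fun _ : I => Q) := by
      rw [← hcomp.lintegral_comp (by fun_prop)]
      rfl
    rw [this]
    have hind : iIndepFun (fun (b : Fin n) (y : Fin n → I → Ω₀) => δ (y b))
        (Measure.pi fun _ : Fin n => Measure.pi fun _ : I => Q) :=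
      iIndepFun_pi (X := fun _ => δ) fun _ => hδm.aemeasurable
    rw [lintegral_prod_eq_prod_lintegral_of_indepFun _ _ hind (by fun_prop)]
    have hb : ∀ b : Fin n, ∫⁻ y : Fin n → I → Ω₀, δ (y b)
        ∂(Measure.pi fun _ : Fin n => Measure.pi fun _ : I => Q)
        ≤ (C₁ : ℝ≥0∞) ^ Fintype.card I := by
      intro b
      rw [(measurePreserving_eval (fun _ : Fin n => Measure.pi fun _ : I => Q) b).lintegral_comp hδm]
      exact lintegral_abs_det_rpow_neg_le hφ hQ
    calc _ ≤ ∏ _b : Fin n, (C₁ : ℝ≥0∞) ^ Fintype.card I := Finset.prod_le_prod' fun b _ => hb b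
      _ = _ := by simp
  calc _ ≤ ∫⁻ z, ((G : ℝ≥0∞) ^ 2)⁻¹ * ∑ g : Fin G, ∏ b : Fin n, δ (fun i => z (e (g, b, i)))
        ∂(Measure.pi fun _ : κ => Q) := lintegral_mono hpt
    _ = ((G : ℝ≥0∞) ^ 2)⁻¹ * ∑ g : Fin G, ∫⁻ z : κ → Ω₀, ∏ b : Fin n, δ (fun i => z (e (g, b, i)))
        ∂(Measure.pi fun _ : κ => Q) := by
        rw [lintegral_const_mul _ (by fun_prop), lintegral_finsetSum _ (by fun_prop)]
    _ ≤ ((G : ℝ≥0∞) ^ 2)⁻¹ * ∑ _g : Fin G, ((C₁ : ℝ≥0∞) ^ Fintype.card I) ^ n := by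
        gcongr with g _; exact hgroup g
    _ = _ := by
        have h0 : (G : ℝ≥0∞) ≠ 0 := by exact_mod_cast hG.ne'
        rw [Finset.sum_const, Finset.card_univ, Fintype.card_fin, nsmul_eq_mul, ← mul_assoc, sq,
          ENNReal.mul_inv (Or.inl h0) (Or.inl (by simp)), mul_assoc (G : ℝ≥0∞)⁻¹,
          ENNReal.inv_mul_cancel h0 (by simp), mul_one]

/-! ### Stability of least squares in terms of block determinants -/

section WeightedLeastSquares

open Matrix

variable {ι I : Type*} [Fintype I]

/-- An adjugate entry is the determinant of `V` with one row replaced by a unit vector, again with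
entries bounded by 1; count the terms of the Leibniz formula. -/
theorem abs_adjugate_le_factorial [DecidableEq I] {V : Matrix I I ℝ} (hV : ∀ i j, |V i j| ≤ 1) (i j : I) :
    |V.adjugate i j| ≤ (Fintype.card I).factorial := by
  rw [Matrix.adjugate_apply]
  have := Matrix.det_le (A := V.updateRow j (Pi.single i 1)) (abv := AbsoluteValue.abs) (x := (1 : ℝ))
    (fun a b => by
      rcases eq_or_ne a j with rfl | h
      · rw [Matrix.updateRow_self]
        rcases eq_or_ne b i with rfl | h'
        · simp
        · simp [Pi.single_eq_of_ne h']
      · rw [Matrix.updateRow_ne h]; exact hV a b)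
  simpa using this

/-- Cramer's rule `adj(V) V v = det(V) v`, followed by Cauchy–Schwarz. -/
theorem sq_det_mul_le [DecidableEq I] {V : Matrix I I ℝ} (hV : ∀ i j, |V i j| ≤ 1) (v : I → ℝ) (i : I) :
    (V.det * v i) ^ 2
      ≤ (Fintype.card I * (Fintype.card I).factorial ^ 2 : ℕ) * ∑ j, (V *ᵥ v) j ^ 2 := by
  have h1 : V.det * v i = ∑ j, V.adjugate i j * (V *ᵥ v) j := by
    have : V.adjugate *ᵥ (V *ᵥ v) = V.det • v := by
      rw [Matrix.mulVec_mulVec, Matrix.adjugate_mul, Matrix.smul_mulVec, Matrix.one_mulVec]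
    have := congrFun this i
    simpa [Matrix.mulVec, dotProduct] using this.symm
  rw [h1]
  refine (Finset.sum_mul_sq_le_sq_mul_sq _ _ _).trans ?_
  refine mul_le_mul_of_nonneg_right ?_ (Finset.sum_nonneg fun _ _ => sq_nonneg _)
  calc ∑ j, V.adjugate i j ^ 2 ≤ ∑ _j : I, ((Fintype.card I).factorial : ℝ) ^ 2 := by
        refine Finset.sum_le_sum fun j _ => ?_
        rw [← sq_abs]
        exact pow_le_pow_left₀ (abs_nonneg _) (abs_adjugate_le_factorial hV i j) 2
    _ = _ := by simp

variable (J : Finset ι) (ζ : ι → I → ℝ)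

theorem sum_vecMulVec_mulVec (v : I → ℝ) :
    (∑ j ∈ J, vecMulVec (ζ j) (ζ j)) *ᵥ v = ∑ j ∈ J, (ζ j ⬝ᵥ v) • ζ j := by
  rw [Matrix.sum_mulVec]
  refine Finset.sum_congr rfl fun j _ => ?_
  ext i
  simp [Matrix.vecMulVec_mulVec, mul_comm]

theorem dotProduct_sum_vecMulVec_mulVec (v : I → ℝ) :
    v ⬝ᵥ ((∑ j ∈ J, vecMulVec (ζ j) (ζ j)) *ᵥ v) = ∑ j ∈ J, (ζ j ⬝ᵥ v) ^ 2 := by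
  rw [sum_vecMulVec_mulVec, dotProduct_sum]
  refine Finset.sum_congr rfl fun j _ => ?_
  rw [dotProduct_smul, dotProduct_comm v, smul_eq_mul, sq]

/-- Error bound for a least-squares fit in terms of the determinants of disjoint blocks of design
vectors, rescaled by `w`. -/
theorem sum_det_sq_mul_leastSquares_error_le [DecidableEq I] {B : Type*} [Fintype B] {e : B × I → ι}
    (he : Function.Injective e) (heJ : ∀ p, e p ∈ J) {w : I → ℝ} (hw : ∀ i, 0 < w i) {o : I}
    (hwo : w o = 1) (hζ : ∀ j ∈ J, ∀ i, |w i * ζ j i| ≤ 1) {y : ι → ℝ} {c : I → ℝ} {ε : ℝ}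
    (hy : ∀ j ∈ J, |y j - ∑ i, c i * ζ j i| ≤ ε) :
    (∑ b, (Matrix.of fun i j => w j * ζ (e (b, i)) j).det ^ 2) *
        (((∑ j ∈ J, vecMulVec (ζ j) (ζ j))⁻¹ *ᵥ ∑ j ∈ J, y j • ζ j) o - c o) ^ 2
      ≤ (Fintype.card I * (Fintype.card I).factorial ^ 2 : ℕ) * J.card * ε ^ 2 := by
  classical
  set M := ∑ j ∈ J, vecMulVec (ζ j) (ζ j) with hM
  set A : ℝ := ((Fintype.card I * (Fintype.card I).factorial ^ 2 : ℕ) : ℝ) with hA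
  have hA0 : 0 ≤ A := Nat.cast_nonneg _
  set V : B → Matrix I I ℝ := fun b => Matrix.of fun i j => w j * ζ (e (b, i)) j with hV
  -- Sum the Cramer bound over the blocks. Since `e` is injective, the rows of all blocks are
  -- distinct design vectors and their squares add up to at most the full quadratic form.
  have hblock : ∀ (v : I → ℝ) (i : I),
      (∑ b, (V b).det ^ 2) * (v i / w i) ^ 2 ≤ A * ∑ j ∈ J, (ζ j ⬝ᵥ v) ^ 2 := by
    intro v i
    have h1 : ∀ b k, (V b *ᵥ fun i => v i / w i) k = ζ (e (b, k)) ⬝ᵥ v := by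
      intro b k
      simp only [hV, Matrix.mulVec, dotProduct, Matrix.of_apply]
      refine Finset.sum_congr rfl fun i _ => ?_
      have := (hw i).ne'
      field_simp
    calc (∑ b, (V b).det ^ 2) * (v i / w i) ^ 2
        = ∑ b, ((V b).det * (v i / w i)) ^ 2 := by
          rw [Finset.sum_mul]; simp_rw [mul_pow]
      _ ≤ ∑ b, A * ∑ k, (ζ (e (b, k)) ⬝ᵥ v) ^ 2 := by
          refine Finset.sum_le_sum fun b _ => ?_
          have := sq_det_mul_le (V := V b) (fun k j => hζ _ (heJ _) j) (fun i => v i / w i) i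
          simp_rw [h1] at this
          exact this
      _ = A * ∑ p : B × I, (ζ (e p) ⬝ᵥ v) ^ 2 := by
          rw [← Finset.mul_sum, Fintype.sum_prod_type]
      _ ≤ A * ∑ j ∈ J, (ζ j ⬝ᵥ v) ^ 2 := by
          refine mul_le_mul_of_nonneg_left ?_ hA0
          rw [← Finset.sum_image (s := Finset.univ) (g := e) (f := fun j => (ζ j ⬝ᵥ v) ^ 2)
            he.injOn]
          refine Finset.sum_le_sum_of_subset_of_nonneg ?_ fun _ _ _ => sq_nonneg _
          intro j hj
          obtain ⟨p, -, rfl⟩ := Finset.mem_image.1 hj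
          exact heJ p
  rcases eq_or_ne (∑ b, (V b).det ^ 2) 0 with h0 | h0
  · rw [h0, zero_mul]; positivity
  have hpos : 0 < ∑ b, (V b).det ^ 2 :=
    lt_of_le_of_ne (Finset.sum_nonneg fun _ _ => sq_nonneg _) h0.symm
  -- A kernel vector of `M` makes the quadratic form vanish, and `hblock` then kills each of its
  -- entries.
  have hdet : M.det ≠ 0 := by
    intro hdet
    obtain ⟨v, hv, hMv⟩ := Matrix.exists_mulVec_eq_zero_iff.2 hdet
    have h1 := dotProduct_sum_vecMulVec_mulVec J ζ v
    rw [← hM, hMv, dotProduct_zero] at h1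
    refine hv (funext fun i => ?_)
    have h2 := hblock v i
    rw [← h1, mul_zero] at h2
    have h3 : (v i / w i) ^ 2 ≤ 0 := nonpos_of_mul_nonpos_right h2 hpos
    have h4 : v i / w i = 0 := pow_eq_zero_iff two_ne_zero |>.1 (le_antisymm h3 (sq_nonneg _))
    simpa [(hw i).ne'] using h4
  have hunit : IsUnit M.det := hdet.isUnit
  set v : I → ℝ := M⁻¹ *ᵥ Pi.single o 1 with hv
  have hMv : M *ᵥ v = Pi.single o 1 := by
    rw [hv, Matrix.mulVec_mulVec, Matrix.mul_nonsing_inv _ hunit, Matrix.one_mulVec]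
  have hvo : v o = ∑ j ∈ J, (ζ j ⬝ᵥ v) ^ 2 := by
    rw [← dotProduct_sum_vecMulVec_mulVec, ← hM, hMv]; simp
  have hsymm : Mᵀ = M := by
    rw [hM, Matrix.transpose_sum]
    exact Finset.sum_congr rfl fun j _ => by rw [Matrix.transpose_vecMulVec]
  have hMu : ∀ u : I → ℝ, (M⁻¹ *ᵥ u) o = v ⬝ᵥ u := by
    intro u
    have h1 : (M⁻¹ *ᵥ u) o = Pi.single o 1 ⬝ᵥ (M⁻¹ *ᵥ u) := by simp
    rw [h1, Matrix.dotProduct_mulVec, ← Matrix.mulVec_transpose, Matrix.transpose_nonsing_inv, hsymm]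
  -- The fit is exact on combinations of the design vectors, so only the residuals enter.
  have herr : (M⁻¹ *ᵥ ∑ j ∈ J, y j • ζ j) o - c o
      = ∑ j ∈ J, (y j - ∑ i, c i * ζ j i) * (ζ j ⬝ᵥ v) := by
    have h1 : c o = v ⬝ᵥ (M *ᵥ c) := by
      rw [← hMu, Matrix.mulVec_mulVec, Matrix.nonsing_inv_mul _ hunit, Matrix.one_mulVec]
    rw [h1, hMu, ← dotProduct_sub, hM, sum_vecMulVec_mulVec, ← Finset.sum_sub_distrib,
      dotProduct_sum]
    refine Finset.sum_congr rfl fun j _ => ?_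
    rw [← sub_smul, dotProduct_smul, dotProduct_comm v, smul_eq_mul]
    congr 2
    exact Finset.sum_congr rfl fun i _ => mul_comm _ _
  -- At `o`, where the weight is 1, `hblock` reads `(∑ det²) * v o ^ 2 ≤ A * v o`; divide by `v o`.
  have hbound : (∑ b, (V b).det ^ 2) * v o ≤ A := by
    have h1 := hblock v o
    rw [hwo, div_one, ← hvo] at h1
    have h2 : 0 ≤ v o := by rw [hvo]; exact Finset.sum_nonneg fun _ _ => sq_nonneg _
    rcases h2.eq_or_lt with h | h
    · rw [← h, mul_zero]; exact hA0
    · refine le_of_mul_le_mul_right ?_ h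
      rw [mul_assoc, ← sq]; exact h1
  rw [herr]
  calc _ ≤ (∑ b, (V b).det ^ 2) * ((∑ j ∈ J, (y j - ∑ i, c i * ζ j i) ^ 2) *
          ∑ j ∈ J, (ζ j ⬝ᵥ v) ^ 2) :=
        mul_le_mul_of_nonneg_left (Finset.sum_mul_sq_le_sq_mul_sq _ _ _) hpos.le
    _ = ((∑ b, (V b).det ^ 2) * v o) * ∑ j ∈ J, (y j - ∑ i, c i * ζ j i) ^ 2 := by
        rw [← hvo]; ring
    _ ≤ A * ∑ _j ∈ J, ε ^ 2 := by
        refine mul_le_mul hbound (Finset.sum_le_sum fun j hj => ?_)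
          (Finset.sum_nonneg fun _ _ => sq_nonneg _) hA0
        rw [← sq_abs]
        exact pow_le_pow_left₀ (abs_nonneg _) (hy j hj) 2
    _ = _ := by rw [Finset.sum_const, nsmul_eq_mul]; ring

end WeightedLeastSquares

/-! ### Taylor expansion with Hölder remainder -/

/-- The derivative of the remainder is the remainder of one order less for the shifted family, so
the induction is a mean value inequality on `[0, 1]`. Indexing the derivatives as a family `ψ` makes
that shift immediate. -/
theorem abs_sub_taylor_sum_le (l : ℕ) (ψ : ℕ → ℝ → ℝ) {ε : ℝ}
    (hψ : ∀ j < l, ∀ t ∈ Set.Icc (0 : ℝ) 1, HasDerivAt (ψ j) (ψ (j + 1) t) t)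
    (hε : ∀ t ∈ Set.Icc (0 : ℝ) 1, |ψ l t - ψ l 0| ≤ ε) :
    ∀ t ∈ Set.Icc (0 : ℝ) 1,
      |ψ 0 t - ∑ j ∈ Finset.range (l + 1), ψ j 0 * (t ^ j / j.factorial)| ≤ ε := by
  induction l generalizing ψ with
  | zero => simpa using hε
  | succ l ih =>
    have hε0 : 0 ≤ ε := (abs_nonneg _).trans (hε 0 (by simp))
    have h1 := ih (fun j => ψ (j + 1)) (fun j hj => hψ (j + 1) (by omega)) hε
    intro t ht
    set R : ℝ → ℝ := fun t =>
      ψ 0 t - ∑ j ∈ Finset.range (l + 1 + 1), ψ j 0 * (t ^ j / j.factorial) with hR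
    have hderiv : ∀ u ∈ Set.Icc (0 : ℝ) 1, HasDerivAt R
        (ψ 1 u - ∑ j ∈ Finset.range (l + 1), ψ (j + 1) 0 * (u ^ j / j.factorial)) u := by
      intro u hu
      have hR' : R = fun t => ψ 0 t - (∑ j ∈ Finset.range (l + 1),
          ψ (j + 1) 0 * (t ^ (j + 1) / (j + 1).factorial) + ψ 0 0 * (1 / (0).factorial)) := by
        funext t
        change ψ 0 t - ∑ j ∈ Finset.range (l + 1 + 1), ψ j 0 * (t ^ j / j.factorial) = _
        rw [Finset.sum_range_succ', pow_zero]
      rw [hR']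
      refine (hψ 0 (by omega) u hu).sub (HasDerivAt.add_const _ ?_)
      refine HasDerivAt.fun_sum fun j _ => ?_
      refine HasDerivAt.const_mul _ ?_
      have h2 := ((hasDerivAt_pow (j + 1) u).div_const ((j + 1).factorial : ℝ))
      convert h2 using 1
      rw [Nat.factorial_succ]
      push_cast
      field_simp
    have hR0 : R 0 = 0 := by
      simp [hR, Finset.sum_range_succ' _ (l + 1)]
    have h3 := Convex.norm_image_sub_le_of_norm_hasDerivWithin_le (f := R) (C := ε)
      (s := Set.Icc (0 : ℝ) 1) (x := 0) (y := t)
      (fun u hu => (hderiv u hu).hasDerivWithinAt) (fun u hu => h1 u hu) (convex_Icc 0 1)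
      (by simp) ht
    rw [hR0, sub_zero, sub_zero, Real.norm_eq_abs, Real.norm_eq_abs, abs_of_nonneg ht.1] at h3
    exact h3.trans (mul_le_of_le_one_right hε0 ht.2)

namespace LocalATE

theorem zeta_self_origin {d : ℕ} (L : ℕ) (x z : EuclideanSpace ℝ (Fin d)) :
    zeta L x z (MultiIdx.origin d L) = 1 := by
  simp [zeta, MultiIdx.origin]

theorem MultiIdx.exists_pos_of_ne_origin {d L : ℕ} {α : MultiIdx d L}
    (h : α ≠ MultiIdx.origin d L) : ∃ i, (α.1 i : ℕ) ≠ 0 := by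
  by_contra! h'
  exact h (Subtype.ext (funext fun i => Fin.ext (h' i)))

theorem zeta_self_of_ne {d L : ℕ} (x : EuclideanSpace ℝ (Fin d)) {α : MultiIdx d L}
    (h : α ≠ MultiIdx.origin d L) : zeta L x x α = 0 := by
  obtain ⟨i, hi⟩ := MultiIdx.exists_pos_of_ne_origin h
  exact Finset.prod_eq_zero (Finset.mem_univ i) (by simp [hi])

/-- Expand `h` in the standard basis. A choice `ρ` of basis vectors contributes the monomial whose
exponents count how often each coordinate is chosen; these sum to `j ≤ l`. -/
theorem exists_multilinear_diag_eq_sum {d j l : ℕ} (hj : j ≤ l)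
    (A : MultilinearMap ℝ (fun _ : Fin j => EuclideanSpace ℝ (Fin d)) ℝ) :
    ∃ c : MultiIdx d l → ℝ, ∀ h : EuclideanSpace ℝ (Fin d),
      A (fun _ => h) = ∑ α, c α * ∏ i, h i ^ (α.1 i : ℕ) := by
  classical
  have hcard : ∀ ρ : Fin j → Fin d, ∑ i, (Finset.univ.filter fun m => ρ m = i).card = j := by
    intro ρ
    rw [← Finset.card_eq_sum_card_fiberwise (fun _ _ => Finset.mem_univ _)]
    simp
  set idx : (Fin j → Fin d) → MultiIdx d l := fun ρ =>
    ⟨fun i => ⟨(Finset.univ.filter fun m => ρ m = i).card, by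
      refine Nat.lt_succ_of_le (le_trans ?_ hj)
      refine (Finset.card_le_univ _).trans (by simp)⟩, by
      simpa [hcard ρ] using hj⟩ with hidx
  set b := EuclideanSpace.basisFun (Fin d) ℝ with hb
  refine ⟨fun α => ∑ ρ, if idx ρ = α then A (fun m => b (ρ m)) else 0, fun h => ?_⟩
  have hh : h = ∑ i, h i • b i := by
    conv_lhs => rw [← b.sum_repr h]
    simp [hb]
  calc A (fun _ => h) = A (fun _ => ∑ i, h i • b i) := by rw [← hh]
    _ = ∑ ρ : Fin j → Fin d, A (fun m => h (ρ m) • b (ρ m)) := by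
        rw [MultilinearMap.map_sum]
    _ = ∑ ρ : Fin j → Fin d, A (fun m => b (ρ m)) * ∏ i, h i ^ ((idx ρ).1 i : ℕ) := by
        refine Finset.sum_congr rfl fun ρ _ => ?_
        rw [MultilinearMap.map_smul_univ, smul_eq_mul, mul_comm]
        congr 1
        simp only [hidx]
        rw [← Finset.prod_fiberwise Finset.univ ρ]
        refine Finset.prod_congr rfl fun i _ => ?_
        rw [Finset.prod_congr rfl fun m hm => by rw [(Finset.mem_filter.1 hm).2],
          Finset.prod_const]
    _ = ∑ α, (∑ ρ, if idx ρ = α then A (fun m => b (ρ m)) else 0) * ∏ i, h i ^ (α.1 i : ℕ) := by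
        simp only [Finset.sum_mul]
        rw [Finset.sum_comm]
        refine Finset.sum_congr rfl fun ρ _ => ?_
        simp

/-- Taylor's formula along the segment from `x` to `y`, which stays in the convex neighbourhood. The
coefficients depend on `x` only. The constant one is found by putting `y = x`, where the remainder
vanishes. -/
theorem exists_taylor_of_holderExtension {d l : ℕ} {β : ℝ≥0} (hβ : 0 < β)
    {S : Set (EuclideanSpace ℝ (Fin d))} {g : EuclideanSpace ℝ (Fin d) → ℝ}
    (hg : HolderExtension l β S g) :
    ∃ Λ : ℝ, 0 ≤ Λ ∧ ∀ x ∈ S, ∃ c : MultiIdx d l → ℝ, c (MultiIdx.origin d l) = g x ∧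
      ∀ y ∈ S, |g y - ∑ α, c α * zeta l x y α| ≤ Λ * ‖y - x‖ ^ ((l : ℝ) + β) := by
  obtain ⟨U, G, hU, hconv, hSU, hgG, hG, Λ, hΛ⟩ := hg
  refine ⟨Λ, Λ.2, fun x hx => ?_⟩
  have hxU := hSU hx
  choose c hc using fun j : Fin (l + 1) => exists_multilinear_diag_eq_sum
    (Nat.lt_succ_iff.1 j.2) (iteratedFDeriv ℝ j G x).toMultilinearMap
  set C : MultiIdx d l → ℝ := fun α => ∑ j : Fin (l + 1), c j α * (1 / (j : ℕ).factorial) with hC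
  have hbound : ∀ y ∈ S, |g y - ∑ α, C α * zeta l x y α| ≤ Λ * ‖y - x‖ ^ ((l : ℝ) + β) := by
    intro y hy
    have hseg : ∀ t ∈ Set.Icc (0 : ℝ) 1, x + t • (y - x) ∈ U := by
      intro t ht
      exact hconv.add_smul_sub_mem hxU (hSU hy) ht
    set ψ : ℕ → ℝ → ℝ := fun j t => iteratedFDeriv ℝ j G (x + t • (y - x)) fun _ => y - x with hψ
    have hder : ∀ j < l, ∀ t ∈ Set.Icc (0 : ℝ) 1, HasDerivAt (ψ j) (ψ (j + 1) t) t := by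
      intro j hj t ht
      have h1 : DifferentiableAt ℝ (iteratedFDeriv ℝ j G) (x + t • (y - x)) := by
        have h2 : ContDiffAt ℝ l G (x + t • (y - x)) := hG.contDiffAt (hU.mem_nhds (hseg t ht))
        exact h2.differentiableAt_iteratedFDeriv (by exact_mod_cast hj)
      have h3 : HasDerivAt (fun t : ℝ => x + t • (y - x)) (y - x) t := by
        simpa using ((hasDerivAt_id t).smul_const (y - x)).const_add x
      have h4 := h1.hasFDerivAt.comp_hasDerivAt t h3
      have h5 := (ContinuousMultilinearMap.apply ℝ (fun _ : Fin j => EuclideanSpace ℝ (Fin d)) ℝ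
        (fun _ => y - x)).hasFDerivAt.comp_hasDerivAt t h4
      simp only [hψ, iteratedFDeriv_succ_apply_left]
      exact h5
    have hε : ∀ t ∈ Set.Icc (0 : ℝ) 1, |ψ l t - ψ l 0| ≤ Λ * ‖y - x‖ ^ ((l : ℝ) + β) := by
      intro t ht
      have h0 : x + (0 : ℝ) • (y - x) ∈ U := hseg 0 (by simp)
      have h1 := hΛ.dist_le (hseg t ht) h0
      rw [dist_eq_norm, dist_eq_norm] at h1
      have h2 : ‖x + t • (y - x) - (x + (0 : ℝ) • (y - x))‖ ≤ ‖y - x‖ := by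
        rw [zero_smul, add_zero, add_sub_cancel_left, norm_smul, Real.norm_eq_abs,
          abs_of_nonneg ht.1]
        exact mul_le_of_le_one_left (norm_nonneg _) ht.2
      simp only [hψ]
      rw [← sub_apply, ← Real.norm_eq_abs]
      refine (ContinuousMultilinearMap.le_opNorm _ _).trans ?_
      rw [Finset.prod_const, Finset.card_univ, Fintype.card_fin]
      rw [Real.rpow_add_of_nonneg (norm_nonneg _) (Nat.cast_nonneg _) β.coe_nonneg, Real.rpow_natCast,
        mul_comm (‖y - x‖ ^ l), ← mul_assoc]
      refine mul_le_mul_of_nonneg_right (h1.trans ?_) (by positivity)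
      gcongr
    have h1 := abs_sub_taylor_sum_le l ψ hder hε 1 (by simp)
    have h2 : ψ 0 1 = g y := by
      simp [hψ, hgG hy]
    have h3 : ∑ j ∈ Finset.range (l + 1), ψ j 0 * ((1 : ℝ) ^ j / j.factorial)
        = ∑ α, C α * zeta l x y α := by
      rw [← Fin.sum_univ_eq_sum_range (fun j => ψ j 0 * ((1 : ℝ) ^ j / j.factorial))]
      simp only [hC, Finset.sum_mul]
      rw [Finset.sum_comm]
      refine Finset.sum_congr rfl fun j _ => ?_
      have h4 : ψ j 0 = ∑ α, c j α * zeta l x y α := by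
        have := hc j (y - x)
        simp only [hψ, zero_smul, add_zero]
        exact this
      rw [h4, Finset.sum_mul]
      refine Finset.sum_congr rfl fun α _ => ?_
      rw [one_pow]; ring
    rwa [h2, h3] at h1
  refine ⟨C, ?_, hbound⟩
  have h1 := hbound x hx
  have hpos : (0 : ℝ) < l + β := by
    have : (0 : ℝ) < β := hβ
    positivity
  rw [sub_self, norm_zero, Real.zero_rpow hpos.ne', mul_zero] at h1
  have h2 : ∑ α, C α * zeta l x x α = C (MultiIdx.origin d l) := by
    rw [Finset.sum_eq_single (MultiIdx.origin d l)]
    · rw [zeta_self_origin, mul_one]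
    · intro α _ hα
      rw [zeta_self_of_ne x hα, mul_zero]
    · simp
  rw [h2] at h1
  have := abs_eq_zero.1 (le_antisymm h1 (abs_nonneg _))
  linarith

end LocalATE

/-! ### Nearest neighbours: order statistics and measurability -/

namespace LocalATE

variable {d N : ℕ}

/-- The number of units with treatment `w` at distance less than `r` from `x`. -/
noncomputable def countLT (W : Fin N → Bool) (X : Fin N → EuclideanSpace ℝ (Fin d)) (w : Bool)
    (x : EuclideanSpace ℝ (Fin d)) (r : ℝ) : ℕ :=
  (Finset.univ.filter fun i => W i = w ∧ ‖X i - x‖ < r).card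

/-- Replaces the infimum by a finite count, with ties allowed: the infimum cannot exceed the largest
of `k` distances below `r`, and no radius below `r` can contain `k` units if fewer than `k` are
strictly closer than `r`. The group must have `k` units, as otherwise the infimum is over the empty
set. -/
theorem le_knnRadius_iff {k : ℕ} (hk : 1 ≤ k) {W : Fin N → Bool}
    {X : Fin N → EuclideanSpace ℝ (Fin d)} {w : Bool} {x : EuclideanSpace ℝ (Fin d)}
    (hkw : k ≤ groupSize W w) (r : ℝ) :
    r ≤ knnRadius k W X w x ↔ countLT W X w x r < k := by
  set T : Set ℝ := {r : ℝ | k ≤ (Finset.univ.filter fun i => W i = w ∧ ‖X i - x‖ ≤ r).card} with hT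
  have hbdd : BddBelow T := by
    refine ⟨0, fun r hr => ?_⟩
    by_contra! hneg
    have hr' : k ≤ (Finset.univ.filter fun i => W i = w ∧ ‖X i - x‖ ≤ r).card := hr
    have : (Finset.univ.filter fun i => W i = w ∧ ‖X i - x‖ ≤ r) = ∅ := by
      refine Finset.filter_eq_empty_iff.2 fun i _ h => ?_
      linarith [norm_nonneg (X i - x), h.2]
    rw [this, Finset.card_empty] at hr'
    omega
  have hne : T.Nonempty := by
    obtain ⟨R, hR⟩ := (Finset.univ.image fun i => ‖X i - x‖).bddAbove
    refine ⟨R, ?_⟩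
    have : (Finset.univ.filter fun i => W i = w ∧ ‖X i - x‖ ≤ R)
        = Finset.univ.filter fun i => W i = w := by
      refine Finset.filter_congr fun i _ => ⟨fun h => h.1, fun h => ⟨h, ?_⟩⟩
      exact hR (by simp)
    change k ≤ (Finset.univ.filter fun i => W i = w ∧ ‖X i - x‖ ≤ R).card
    rw [this]; exact hkw
  constructor
  · intro h
    by_contra! hcount
    have hnon : (Finset.univ.filter fun i => W i = w ∧ ‖X i - x‖ < r).Nonempty := by
      rw [← Finset.card_pos]
      exact lt_of_lt_of_le hk hcount
    obtain ⟨i₀, hi₀, hmax⟩ := Finset.exists_max_image _ (fun i => ‖X i - x‖) hnon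
    have hmem : ‖X i₀ - x‖ ∈ T := by
      refine hcount.trans (Finset.card_le_card fun i hi => ?_)
      have := hmax i hi
      simp only [Finset.mem_filter, Finset.mem_univ, true_and] at hi ⊢
      exact ⟨hi.1, this⟩
    have h1 : knnRadius k W X w x ≤ ‖X i₀ - x‖ := csInf_le hbdd hmem
    have h2 := (Finset.mem_filter.1 hi₀).2.2
    linarith
  · intro h
    refine le_csInf hne fun s hs => ?_
    by_contra! hlt
    have hs' : k ≤ (Finset.univ.filter fun i => W i = w ∧ ‖X i - x‖ ≤ s).card := hs
    have : (Finset.univ.filter fun i => W i = w ∧ ‖X i - x‖ ≤ s).card ≤ countLT W X w x r := by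
      refine Finset.card_le_card fun i hi => ?_
      simp only [Finset.mem_filter, Finset.mem_univ, true_and] at hi ⊢
      exact ⟨hi.1, hi.2.trans_lt hlt⟩
    omega

theorem mem_nbrs_iff {k : ℕ} (hk : 1 ≤ k) {W : Fin N → Bool}
    {X : Fin N → EuclideanSpace ℝ (Fin d)} {w : Bool} {x : EuclideanSpace ℝ (Fin d)}
    (hkw : k ≤ groupSize W w) (i : Fin N) :
    i ∈ nbrs k W X w x ↔ W i = w ∧ countLT W X w x ‖X i - x‖ < k := by
  rw [nbrs, Finset.mem_filter, le_knnRadius_iff hk hkw]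
  simp

theorem countLT_le_groupSize (W : Fin N → Bool) (X : Fin N → EuclideanSpace ℝ (Fin d)) (w : Bool)
    (x : EuclideanSpace ℝ (Fin d)) (r : ℝ) : countLT W X w x r ≤ groupSize W w :=
  Finset.card_le_card fun i hi => by
    simp only [Finset.mem_filter, Finset.mem_univ, true_and] at hi ⊢
    exact hi.1

/-- Without ties, the neighbours are `k` units, one of which lies at the `k`-nearest-neighbour
radius while the others are strictly closer. -/
theorem exists_nbrs_structure {k : ℕ} (hk : 1 ≤ k) {W : Fin N → Bool}
    {X : Fin N → EuclideanSpace ℝ (Fin d)} {w : Bool} {x : EuclideanSpace ℝ (Fin d)}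
    (hkw : k ≤ groupSize W w)
    (hinj : ∀ i j, W i = w → W j = w → ‖X i - x‖ = ‖X j - x‖ → i = j) :
    ∃ j₀ ∈ nbrs k W X w x, (nbrs k W X w x).card = k ∧ ‖X j₀ - x‖ = knnRadius k W X w x ∧
      ∀ j ∈ nbrs k W X w x, j ≠ j₀ → ‖X j - x‖ < ‖X j₀ - x‖ := by
  set t := knnRadius k W X w x with ht
  have hlt : countLT W X w x t < k := (le_knnRadius_iff hk hkw t).1 le_rfl
  -- If fewer than `k` units lay within `t`, the closest unit beyond `t` would still have fewer than
  -- `k` strictly nearer ones, which would force a larger radius.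
  have hge : k ≤ (nbrs k W X w x).card := by
    by_contra! hcon
    set F := Finset.univ.filter fun i => W i = w ∧ t < ‖X i - x‖ with hF
    have hFne : F.Nonempty := by
      rw [Finset.nonempty_iff_ne_empty]
      intro hemp
      have : groupSize W w ≤ (nbrs k W X w x).card := by
        refine Finset.card_le_card fun i hi => ?_
        simp only [nbrs, Finset.mem_filter, Finset.mem_univ, true_and] at hi ⊢
        refine ⟨hi, ?_⟩
        by_contra! h
        have : i ∈ F := Finset.mem_filter.2 ⟨Finset.mem_univ _, hi, h⟩
        simp [hemp] at this
      omega
    obtain ⟨i₀, hi₀, hmin⟩ := Finset.exists_min_image F (fun i => ‖X i - x‖) hFne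
    have hle : countLT W X w x ‖X i₀ - x‖ ≤ (nbrs k W X w x).card := by
      refine Finset.card_le_card fun i hi => ?_
      simp only [nbrs, Finset.mem_filter, Finset.mem_univ, true_and] at hi ⊢
      refine ⟨hi.1, ?_⟩
      by_contra! h
      have : i ∈ F := Finset.mem_filter.2 ⟨Finset.mem_univ _, hi.1, h⟩
      linarith [hmin i this, hi.2]
    have h1 := (le_knnRadius_iff hk hkw (X := X) (x := x) ‖X i₀ - x‖).2 (by omega)
    have h2 := (Finset.mem_filter.1 hi₀).2.2
    linarith
  obtain ⟨j₀, hj₀, hj₀t⟩ : ∃ j₀ ∈ nbrs k W X w x, ‖X j₀ - x‖ = t := by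
    by_contra! hcon
    have : (nbrs k W X w x).card ≤ countLT W X w x t := by
      refine Finset.card_le_card fun i hi => ?_
      have h1 := hcon i hi
      simp only [nbrs, Finset.mem_filter, Finset.mem_univ, true_and] at hi ⊢
      exact ⟨hi.1, lt_of_le_of_ne hi.2 h1⟩
    omega
  have hstrict : ∀ j ∈ nbrs k W X w x, j ≠ j₀ → ‖X j - x‖ < ‖X j₀ - x‖ := by
    intro j hj hne
    have hj' := (Finset.mem_filter.1 hj).2
    rw [hj₀t]
    refine lt_of_le_of_ne hj'.2 fun h => hne ?_
    exact hinj j j₀ hj'.1 (Finset.mem_filter.1 hj₀).2.1 (by rw [h, hj₀t])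
  refine ⟨j₀, hj₀, le_antisymm ?_ hge, hj₀t, hstrict⟩
  have : (nbrs k W X w x).erase j₀ ⊆ Finset.univ.filter fun i => W i = w ∧ ‖X i - x‖ < t := by
    intro i hi
    obtain ⟨h1, h2⟩ := Finset.mem_erase.1 hi
    have h3 := hstrict i h2 h1
    simp only [Finset.mem_filter, Finset.mem_univ, true_and]
    exact ⟨(Finset.mem_filter.1 h2).2.1, by rwa [hj₀t] at h3⟩
  have h4 := Finset.card_le_card this
  rw [Finset.card_erase_of_mem hj₀] at h4
  have h5 : (Finset.univ.filter fun i => W i = w ∧ ‖X i - x‖ < t).card < k := hlt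
  omega

theorem measurable_card_filter {Ω : Type*} [MeasurableSpace Ω] {p : Ω → Fin N → Prop}
    [∀ ω i, Decidable (p ω i)] (hp : ∀ i, MeasurableSet {ω | p ω i}) :
    Measurable fun ω => (Finset.univ.filter fun i => p ω i).card := by
  simp only [Finset.card_filter]
  exact Finset.measurable_sum _ fun i _ =>
    Measurable.ite (hp i) measurable_const measurable_const

section Measurability

variable {Ω : Type*} [MeasurableSpace Ω] {W : Ω → Fin N → Bool}
  {X : Ω → Fin N → EuclideanSpace ℝ (Fin d)} {w : Ω → Bool} {x : Ω → EuclideanSpace ℝ (Fin d)}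

theorem measurableSet_treat_eq (hW : ∀ i, Measurable fun ω => W ω i) (hw : Measurable w)
    (i : Fin N) : MeasurableSet {ω | W ω i = w ω} :=
  measurableSet_eq_fun (hW i) hw

theorem measurable_groupSize (hW : ∀ i, Measurable fun ω => W ω i) (hw : Measurable w) :
    Measurable fun ω => groupSize (W ω) (w ω) :=
  measurable_card_filter fun i => measurableSet_treat_eq hW hw i

theorem measurable_countLT (hW : ∀ i, Measurable fun ω => W ω i)
    (hX : ∀ i, Measurable fun ω => X ω i) (hw : Measurable w) (hx : Measurable x) {r : Ω → ℝ}
    (hr : Measurable r) : Measurable fun ω => countLT (W ω) (X ω) (w ω) (x ω) (r ω) :=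
  measurable_card_filter fun i => (measurableSet_treat_eq hW hw i).inter
    (measurableSet_lt ((hX i).sub hx).norm hr)

theorem measurable_zeta {L : ℕ} {y z : Ω → EuclideanSpace ℝ (Fin d)} (hy : Measurable y)
    (hz : Measurable z) (α : MultiIdx d L) : Measurable fun ω => zeta L (y ω) (z ω) α := by
  unfold zeta
  fun_prop

/-- Membership among the neighbours is rewritten through counts, which are measurable, and the
inverse matrix as adjugate over determinant; this also covers singular matrices, since `0⁻¹ = 0`. -/
theorem measurable_gbar {L k : ℕ} (hk : 1 ≤ k) {g : Bool → EuclideanSpace ℝ (Fin d) → ℝ}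
    (hg : ∀ w, Measurable (g w)) (hW : ∀ i, Measurable fun ω => W ω i)
    (hX : ∀ i, Measurable fun ω => X ω i) (hw : Measurable w) (hx : Measurable x) :
    Measurable fun ω => gbar L k g (W ω) (X ω) (w ω) (x ω) := by
  classical
  have hg2 : Measurable fun q : Bool × EuclideanSpace ℝ (Fin d) => g q.1 q.2 :=
    measurable_from_prod_countable_right hg
  have hset : ∀ i, MeasurableSet {ω | W ω i = w ω ∧
      countLT (W ω) (X ω) (w ω) (x ω) ‖X ω i - x ω‖ < k} := fun i =>
    (measurableSet_treat_eq hW hw i).inter (measurableSet_lt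
      (measurable_countLT hW hX hw hx ((hX i).sub hx).norm) measurable_const)
  set M : Ω → Matrix (MultiIdx d L) (MultiIdx d L) ℝ := fun ω =>
    ∑ i, if W ω i = w ω ∧ countLT (W ω) (X ω) (w ω) (x ω) ‖X ω i - x ω‖ < k then
      Matrix.vecMulVec (zeta L (x ω) (X ω i)) (zeta L (x ω) (X ω i)) else 0 with hM
  set u : Ω → MultiIdx d L → ℝ := fun ω =>
    ∑ i, if W ω i = w ω ∧ countLT (W ω) (X ω) (w ω) (x ω) ‖X ω i - x ω‖ < k then
      g (w ω) (X ω i) • zeta L (x ω) (X ω i) else 0 with hu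
  have hMm : ∀ α γ, Measurable fun ω => M ω α γ := by
    intro α γ
    simp only [hM, Matrix.sum_apply]
    refine Finset.measurable_sum _ fun i _ => ?_
    have : ∀ ω, (if W ω i = w ω ∧ countLT (W ω) (X ω) (w ω) (x ω) ‖X ω i - x ω‖ < k then
      Matrix.vecMulVec (zeta L (x ω) (X ω i)) (zeta L (x ω) (X ω i)) else 0) α γ
      = if W ω i = w ω ∧ countLT (W ω) (X ω) (w ω) (x ω) ‖X ω i - x ω‖ < k then
      zeta L (x ω) (X ω i) α * zeta L (x ω) (X ω i) γ else 0 := by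
      intro ω; split_ifs <;> simp [Matrix.vecMulVec_apply]
    simp_rw [this]
    exact Measurable.ite (hset i) ((measurable_zeta hx (hX i) α).mul (measurable_zeta hx (hX i) γ))
      measurable_const
  have hum : ∀ α, Measurable fun ω => u ω α := by
    intro α
    simp only [hu, Finset.sum_apply]
    refine Finset.measurable_sum _ fun i _ => ?_
    have : ∀ ω, (if W ω i = w ω ∧ countLT (W ω) (X ω) (w ω) (x ω) ‖X ω i - x ω‖ < k then
      g (w ω) (X ω i) • zeta L (x ω) (X ω i) else 0) α
      = if W ω i = w ω ∧ countLT (W ω) (X ω) (w ω) (x ω) ‖X ω i - x ω‖ < k then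
      g (w ω) (X ω i) * zeta L (x ω) (X ω i) α else 0 := by
      intro ω; split_ifs <;> simp
    simp_rw [this]
    exact Measurable.ite (hset i) ((hg2.comp (hw.prodMk (hX i))).mul
      (measurable_zeta hx (hX i) α)) measurable_const
  have hdet : Measurable fun ω => (M ω).det := by
    simp only [Matrix.det_apply]
    fun_prop
  have hadj : ∀ α γ, Measurable fun ω => (M ω).adjugate α γ := by
    intro α γ
    simp only [Matrix.adjugate_apply, Matrix.det_apply]
    refine Finset.measurable_sum _ fun σ _ => ?_
    refine Measurable.const_smul ?_ _
    refine Finset.measurable_prod _ fun a _ => ?_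
    rcases eq_or_ne (σ a) γ with h | h
    · simp only [h, Matrix.updateRow_self]; exact measurable_const
    · simp only [Matrix.updateRow_ne h]; exact hMm _ _
  have hmain : Measurable fun ω => ((M ω)⁻¹.mulVec (u ω)) (MultiIdx.origin d L) := by
    simp only [Matrix.mulVec, dotProduct, Matrix.inv_def, Matrix.smul_apply, Ring.inverse_eq_inv',
      smul_eq_mul]
    exact Finset.measurable_sum _ fun α _ => ((hdet.inv.mul (hadj _ _)).mul (hum α))
  have heq : (fun ω => gbar L k g (W ω) (X ω) (w ω) (x ω)) = fun ω =>
      if k ≤ groupSize (W ω) (w ω) then ((M ω)⁻¹.mulVec (u ω)) (MultiIdx.origin d L) else 0 := by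
    funext ω
    unfold gbar
    split_ifs with hkw
    · have hn : nbrs k (W ω) (X ω) (w ω) (x ω) = Finset.univ.filter fun i => W ω i = w ω ∧
          countLT (W ω) (X ω) (w ω) (x ω) ‖X ω i - x ω‖ < k := by
        ext i
        rw [mem_nbrs_iff hk hkw]; simp
      have h1 : gram L k (W ω) (X ω) (w ω) (x ω) = M ω := by
        rw [gram, hn, Finset.sum_filter]
      rw [h1, hn, Finset.sum_filter]
    · rfl
  rw [heq]
  exact Measurable.ite (measurableSet_le measurable_const (measurable_groupSize hW hw)) hmain
    measurable_const

end Measurability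

end LocalATE

/-! ### The law of one unit near a support point -/

namespace LocalATE

variable {d : ℕ}

theorem measurable_treat : Measurable (treat : Obs d → Bool) := measurable_fst

theorem isClosed_covarSupport (P : Measure (Obs d)) : IsClosed (covarSupport P) :=
  Measure.isClosed_support

theorem covarLaw_compl_covarSupport (P : Measure (Obs d)) : covarLaw P (covarSupport P)ᶜ = 0 :=
  Measure.measure_compl_support

theorem ae_covar_mem_covarSupport (P : Measure (Obs d)) : ∀ᵐ z ∂P, covar z ∈ covarSupport P := by
  have h : ∀ᵐ x ∂(covarLaw P), x ∈ covarSupport P := Measure.support_mem_ae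
  exact ae_of_ae_map measurable_covar.aemeasurable h

/-- The units with treatment `w` and covariates at distance less than `r` from `x`. -/
def groupBall (w : Bool) (x : EuclideanSpace ℝ (Fin d)) (r : ℝ) : Set (Obs d) :=
  {z | treat z = w ∧ ‖covar z - x‖ < r}

theorem measurableSet_groupBall (w : Bool) (x : EuclideanSpace ℝ (Fin d)) (r : ℝ) :
    MeasurableSet (groupBall w x r) :=
  (measurableSet_eq_fun measurable_treat measurable_const).inter
    (measurableSet_lt (measurable_covar.sub_const x).norm measurable_const)

theorem groupBall_eq (w : Bool) (x : EuclideanSpace ℝ (Fin d)) (r : ℝ) :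
    groupBall w x r = {z | treat z = w} ∩ covar ⁻¹' Metric.ball x r := by
  ext z; simp [groupBall, dist_eq_norm]

/-- The density is controlled only on the support, but the law charges nothing else. Hence the upper
comparison holds on every set, and the lower one sees only the part inside the support. -/
theorem DensityCondition.exists_bounds {P : Measure (Obs d)} (h : DensityCondition P) :
    ∃ lo hi : ℝ, 0 < lo ∧ 0 < hi ∧ covarLaw P ≤ ENNReal.ofReal hi • volume ∧
      ∀ B, MeasurableSet B →
        ENNReal.ofReal lo * volume (B ∩ covarSupport P) ≤ covarLaw P B := by
  obtain ⟨f, hf, hlaw, lo, hi, hlo, hhi, hbd⟩ := h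
  have hS : MeasurableSet (covarSupport P) := (isClosed_covarSupport P).measurableSet
  refine ⟨lo, hi, hlo, hhi, Measure.le_iff.2 fun B hB => ?_, fun B hB => ?_⟩
  · have h1 : covarLaw P B ≤ covarLaw P (B ∩ covarSupport P) := by
      calc covarLaw P B ≤ covarLaw P ((B ∩ covarSupport P) ∪ (covarSupport P)ᶜ) := by
            refine measure_mono fun x hx => ?_
            by_cases h : x ∈ covarSupport P
            · exact Or.inl ⟨hx, h⟩
            · exact Or.inr h
        _ ≤ _ := (measure_union_le _ _).trans (by rw [covarLaw_compl_covarSupport, add_zero])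
    refine h1.trans ?_
    rw [hlaw, withDensity_apply _ (hB.inter hS)]
    calc ∫⁻ x in B ∩ covarSupport P, ENNReal.ofReal (f x)
        ≤ ∫⁻ _x in B ∩ covarSupport P, ENNReal.ofReal hi := by
          refine lintegral_mono_ae ?_
          filter_upwards [ae_restrict_of_ae_restrict_of_subset Set.inter_subset_right hbd] with x hx
          exact ENNReal.ofReal_le_ofReal hx.2
      _ = ENNReal.ofReal hi * volume (B ∩ covarSupport P) := by simp
      _ ≤ (ENNReal.ofReal hi • volume) B := by
          rw [Measure.smul_apply, smul_eq_mul]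
          gcongr
          exact Set.inter_subset_left
  · calc ENNReal.ofReal lo * volume (B ∩ covarSupport P)
        = ∫⁻ _x in B ∩ covarSupport P, ENNReal.ofReal lo := by simp
      _ ≤ ∫⁻ x in B ∩ covarSupport P, ENNReal.ofReal (f x) := by
          refine lintegral_mono_ae ?_
          filter_upwards [ae_restrict_of_ae_restrict_of_subset Set.inter_subset_right hbd] with x hx
          exact ENNReal.ofReal_le_ofReal hx.1
      _ = covarLaw P (B ∩ covarSupport P) := by rw [hlaw, withDensity_apply _ (hB.inter hS)]
      _ ≤ covarLaw P B := measure_mono Set.inter_subset_left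

/-- Integrate the bounds on the propensity score over the `σ(X)`-measurable event `X ∈ B`; the
control group follows by taking complements. -/
theorem Overlap.exists_le {P : Measure (Obs d)} [IsProbabilityMeasure P] (h : Overlap P) :
    ∃ η : ℝ, 0 < η ∧ ∀ w B, MeasurableSet B →
      ENNReal.ofReal η * covarLaw P B ≤ P ({z | treat z = w} ∩ covar ⁻¹' B) := by
  obtain ⟨η, hη, hov⟩ := h
  refine ⟨η, hη, fun w B hB => ?_⟩
  have hT : ∀ w, MeasurableSet {z : Obs d | treat z = w} := fun w =>
    measurableSet_eq_fun measurable_treat measurable_const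
  have hBm : MeasurableSet (covar ⁻¹' B : Set (Obs d)) := measurable_covar hB
  have hBs : MeasurableSet[sigmaX d] (covar ⁻¹' B : Set (Obs d)) := ⟨B, hB, rfl⟩
  set p := P⟦{z : Obs d | treat z = true}|sigmaX d⟧ with hp
  have hpi : Integrable p P := integrable_condExp
  have hint : ∫ z in covar ⁻¹' B, p z ∂P
      = P.real ({z | treat z = true} ∩ covar ⁻¹' B) := by
    rw [hp, setIntegral_condExp (sigmaX_le d) ((integrable_const _).indicator (hT true)) hBs,
      setIntegral_indicator (hT true), Set.inter_comm]
    simp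
  have hlow : η * P.real (covar ⁻¹' B) ≤ ∫ z in covar ⁻¹' B, p z ∂P := by
    have : ∫ _z in covar ⁻¹' B, η ∂P = η * P.real (covar ⁻¹' B) := by simp [mul_comm]
    rw [← this]
    refine integral_mono_ae (integrable_const _) hpi.integrableOn (ae_restrict_of_ae ?_)
    filter_upwards [hov] with z hz using hz.1.le
  have hupp : ∫ z in covar ⁻¹' B, p z ∂P ≤ (1 - η) * P.real (covar ⁻¹' B) := by
    have : ∫ _z in covar ⁻¹' B, (1 - η) ∂P = (1 - η) * P.real (covar ⁻¹' B) := by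
      simp [mul_comm]
    rw [← this]
    refine integral_mono_ae hpi.integrableOn (integrable_const _) (ae_restrict_of_ae ?_)
    filter_upwards [hov] with z hz using hz.2.le
  have hreal : η * P.real (covar ⁻¹' B) ≤ P.real ({z | treat z = w} ∩ covar ⁻¹' B) := by
    cases w with
    | true => rw [← hint]; exact hlow
    | false =>
      have hsplit : P.real ({z | treat z = true} ∩ covar ⁻¹' B)
          + P.real ({z | treat z = false} ∩ covar ⁻¹' B) = P.real (covar ⁻¹' B) := by
        rw [← measureReal_union _ ((hT false).inter hBm), ← Set.union_inter_distrib_right]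
        · congr 1
          ext z
          rcases hz : treat z <;> simp [hz]
        · refine Set.disjoint_left.2 fun z hz hz' => ?_
          have h1 : treat z = true := hz.1
          have h2 : treat z = false := hz'.1
          simp [h1] at h2
      linarith
  have hlaw : covarLaw P B = P (covar ⁻¹' B) := Measure.map_apply measurable_covar hB
  rw [hlaw, ← ofReal_measureReal (measure_ne_top P (covar ⁻¹' B)),
    ← ofReal_measureReal (measure_ne_top P ({z | treat z = w} ∩ covar ⁻¹' B)),
    ← ENNReal.ofReal_mul hη.le]
  exact ENNReal.ofReal_le_ofReal hreal

theorem lintegral_ball_comp_affine {F : EuclideanSpace ℝ (Fin d) → ℝ≥0∞} (hF : Measurable F)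
    (x : EuclideanSpace ℝ (Fin d)) {r : ℝ} (hr : 0 < r) :
    ∫⁻ y in Metric.ball x r, F (r⁻¹ • (y - x))
      = ENNReal.ofReal (r ^ d) * ∫⁻ u in Metric.ball 0 1, F u := by
  have hball : ∀ y, (Metric.ball x r).indicator (fun y => F (r⁻¹ • (y - x))) y
      = (Metric.ball 0 1).indicator F (r⁻¹ • (y - x)) := by
    intro y
    have : y ∈ Metric.ball x r ↔ r⁻¹ • (y - x) ∈ Metric.ball (0 : EuclideanSpace ℝ (Fin d)) 1 := by
      rw [mem_ball_zero_iff, norm_smul, Real.norm_eq_abs, abs_of_pos (inv_pos.2 hr),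
        mem_ball_iff_norm, inv_mul_lt_iff₀ hr, mul_one]
    by_cases h : y ∈ Metric.ball x r
    · rw [Set.indicator_of_mem h, Set.indicator_of_mem (this.1 h)]
    · rw [Set.indicator_of_notMem h, Set.indicator_of_notMem (fun h' => h (this.2 h'))]
  have hFm : Measurable ((Metric.ball 0 1).indicator F) := hF.indicator measurableSet_ball
  rw [← lintegral_indicator measurableSet_ball, ← lintegral_indicator measurableSet_ball]
  simp_rw [hball]
  rw [lintegral_sub_right_eq_self (fun y => (Metric.ball 0 1).indicator F (r⁻¹ • y)) x,
    ← lintegral_map hFm (measurable_const_smul r⁻¹),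
    Measure.map_addHaar_smul _ (inv_ne_zero hr.ne'), lintegral_smul_measure, smul_eq_mul]
  congr 2
  rw [finrank_euclideanSpace_fin, inv_pow, inv_inv, abs_of_pos (by positivity)]

/-- The unit ball lies in the cube `[-1, 1]^d`, and coefficients indexed by total degree at most `l`
extend by zero to all exponents at most `l` in each variable. -/
theorem exists_lintegral_ball_abs_sum_zeta_rpow_neg_le {s : ℝ} (hs : 0 < s) (l : ℕ)
    (hsl : s * l < 1) : ∃ C : ℝ≥0, ∀ (c : MultiIdx d l → ℝ) (α),
      ∫⁻ u in Metric.ball (0 : EuclideanSpace ℝ (Fin d)) 1,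
          ENNReal.ofReal |∑ β, c β * zeta l 0 u β| ^ (-s)
        ≤ C * ENNReal.ofReal |c α| ^ (-s) := by
  classical
  obtain ⟨C, hC⟩ := exists_lintegral_cube_abs_sum_monomials_rpow_neg_le hs l hsl d
  refine ⟨C, fun c α => ?_⟩
  set c' : (Fin d → Fin (l + 1)) → ℝ := fun β =>
    if h : ∑ i, (β i : ℕ) ≤ l then c ⟨β, h⟩ else 0 with hc'
  have hsum : ∀ u : EuclideanSpace ℝ (Fin d), ∑ β, c β * zeta l 0 u β
      = ∑ β, c' β * ∏ i, (WithLp.ofLp u) i ^ (β i : ℕ) := by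
    intro u
    have h1 : ∀ β : MultiIdx d l, c β * zeta l 0 u β
        = (fun β => c' β * ∏ i, (WithLp.ofLp u) i ^ (β i : ℕ)) β.1 := by
      intro β
      simp [hc', zeta, β.2]
    rw [Finset.sum_congr rfl fun β _ => h1 β, ← Finset.sum_subtype (Finset.univ.filter
      fun β : Fin d → Fin (l + 1) => ∑ i, (β i : ℕ) ≤ l) (by simp)
      (fun β => c' β * ∏ i, (WithLp.ofLp u) i ^ (β i : ℕ)), Finset.sum_filter]
    refine Finset.sum_congr rfl fun β _ => ?_
    split_ifs with h
    · rfl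
    · simp [hc', h]
  have key := hC c' α.1
  have hcα : c' α.1 = c α := by simp [hc', α.2]
  rw [hcα] at key
  refine le_trans ?_ key
  rw [← Measure.restrict_pi_pi, ← volume_pi]
  have hmp := PiLp.volume_preserving_ofLp (Fin d)
  simp_rw [hsum]
  rw [← hmp.setLIntegral_comp_preimage (MeasurableSet.univ_pi fun _ => measurableSet_Icc) (by fun_prop)]
  refine lintegral_mono_set fun u hu => ?_
  simp only [Set.mem_preimage, Set.mem_pi, Set.mem_univ, forall_const]
  intro i
  rw [mem_ball_zero_iff] at hu
  exact abs_le.1 ((PiLp.norm_apply_le u i).trans hu.le)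

/-- Units whose covariates lie in a small ball around a support point have at least their fair share
of the probability, in each treatment group. -/
theorem exists_le_measure_groupBall (hd : 1 ≤ d) {P : Measure (Obs d)} [IsProbabilityMeasure P]
    (hT2 : BallCondition (covarSupport P)) (hT3 : DensityCondition P) (hT5 : Overlap P) :
    ∃ c : ℝ, 0 < c ∧ ∀ x ∈ covarSupport P, ∀ r : ℝ, 0 ≤ r → r ≤ Metric.diam (covarSupport P) →
      ∀ w, ENNReal.ofReal (c * r ^ d) ≤ P (groupBall w x r) := by
  obtain ⟨c₀, hc₀, hball⟩ := hT2
  obtain ⟨lo, hi, hlo, hhi, -, hlow⟩ := hT3.exists_bounds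
  obtain ⟨η, hη, hov⟩ := hT5.exists_le
  have : Nonempty (Fin d) := ⟨⟨0, hd⟩⟩
  set b : ℝ := volume.real (Metric.ball (0 : EuclideanSpace ℝ (Fin d)) 1) with hb
  have hb0 : 0 < b := by
    rw [hb, measureReal_def]
    exact ENNReal.toReal_pos (Metric.measure_ball_pos _ _ one_pos).ne' measure_ball_lt_top.ne
  refine ⟨η * (lo * (c₀ * b)), by positivity, fun x hx r hr hrd w => ?_⟩
  have hS : MeasurableSet (covarSupport P) := (isClosed_covarSupport P).measurableSet
  -- Group balls are open, because they will hold the strict neighbours; spheres are Lebesgue null,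
  -- so nothing is lost.
  have h1 : volume (Metric.closedBall x r ∩ covarSupport P)
      ≤ volume (Metric.ball x r ∩ covarSupport P) := by
    calc volume (Metric.closedBall x r ∩ covarSupport P)
        ≤ volume ((Metric.ball x r ∩ covarSupport P) ∪ Metric.sphere x r) := by
          refine measure_mono fun y hy => ?_
          rcases lt_or_eq_of_le (Metric.mem_closedBall.1 hy.1) with h | h
          · exact Or.inl ⟨h, hy.2⟩
          · exact Or.inr h
      _ ≤ _ := (measure_union_le _ _).trans (by rw [Measure.addHaar_sphere, add_zero])
  have h2 : volume (Metric.closedBall x r) = ENNReal.ofReal (r ^ d * b) := by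
    rw [Measure.addHaar_closedBall _ _ hr, finrank_euclideanSpace_fin,
      ENNReal.ofReal_mul (by positivity), hb, ofReal_measureReal measure_ball_lt_top.ne]
  rw [groupBall_eq]
  calc ENNReal.ofReal (η * (lo * (c₀ * b)) * r ^ d)
      = ENNReal.ofReal η * (ENNReal.ofReal lo * (ENNReal.ofReal c₀ *
          volume (Metric.closedBall x r))) := by
        rw [h2, ← ENNReal.ofReal_mul hc₀.le, ← ENNReal.ofReal_mul hlo.le,
          ← ENNReal.ofReal_mul hη.le]
        congr 1; ring
    _ ≤ ENNReal.ofReal η * (ENNReal.ofReal lo * volume (Metric.ball x r ∩ covarSupport P)) := by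
        gcongr
        exact (hball x hx r hr hrd).trans h1
    _ ≤ ENNReal.ofReal η * covarLaw P (Metric.ball x r) := by
        gcongr
        exact hlow _ measurableSet_ball
    _ ≤ _ := hov w _ measurableSet_ball

/-- A support of diameter 0 would be a null set carrying all the mass. Positivity is needed to
divide by the diameter when too few units are available. -/
theorem diam_covarSupport_pos (hd : 1 ≤ d) {P : Measure (Obs d)} [IsProbabilityMeasure P]
    (hT1 : IsCompact (covarSupport P)) (hT3 : DensityCondition P) :
    0 < Metric.diam (covarSupport P) := by
  obtain ⟨lo, hi, hlo, hhi, hup, -⟩ := hT3.exists_bounds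
  have : Nonempty (Fin d) := ⟨⟨0, hd⟩⟩
  by_contra! h
  have h0 : Metric.diam (covarSupport P) = 0 := le_antisymm h Metric.diam_nonneg
  have hsub : (covarSupport P).Subsingleton := by
    intro x hx y hy
    have := Metric.dist_le_diam_of_mem hT1.isBounded hx hy
    exact dist_le_zero.1 (this.trans h)
  have h1 : covarLaw P (covarSupport P) = 0 := by
    have := hup (covarSupport P)
    rw [Measure.smul_apply, hsub.measure_zero volume, smul_zero] at this
    exact le_antisymm this zero_le
  have : IsProbabilityMeasure (covarLaw P) := Measure.isProbabilityMeasure_map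
    measurable_covar.aemeasurable
  have h2 : covarLaw P Set.univ = 0 := by
    rw [← Set.union_compl_self (covarSupport P)]
    exact measure_union_null h1 (covarLaw_compl_covarSupport P)
  simp at h2

/-- The rescaled monomials of a unit drawn from a small ball around a support point have small
negative moments along every direction, uniformly in the ball. -/
theorem exists_lintegral_groupBall_abs_sum_zeta_rpow_neg_le (hd : 1 ≤ d) {P : Measure (Obs d)}
    [IsProbabilityMeasure P] (hT2 : BallCondition (covarSupport P)) (hT3 : DensityCondition P)
    (hT5 : Overlap P) {s : ℝ} (hs : 0 < s) (l : ℕ) (hsl : s * l < 1) :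
    ∃ C : ℝ≥0, ∀ x ∈ covarSupport P, ∀ r : ℝ, 0 < r → r ≤ Metric.diam (covarSupport P) →
      ∀ (w : Bool) (c : MultiIdx d l → ℝ) (α : MultiIdx d l),
      ∫⁻ z, ENNReal.ofReal |∑ β, c β * zeta l 0 (r⁻¹ • (covar z - x)) β| ^ (-s)
          ∂(P[|groupBall w x r])
        ≤ C * ENNReal.ofReal |c α| ^ (-s) := by
  obtain ⟨c₀, hc₀, hp⟩ := exists_le_measure_groupBall hd hT2 hT3 hT5
  obtain ⟨lo, hi, hlo, hhi, hup, -⟩ := hT3.exists_bounds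
  obtain ⟨C, hC⟩ := exists_lintegral_ball_abs_sum_zeta_rpow_neg_le (d := d) hs l hsl
  refine ⟨(hi / c₀).toNNReal * C, fun x hx r hr hrd w c α => ?_⟩
  set F : EuclideanSpace ℝ (Fin d) → ℝ≥0∞ := fun u =>
    ENNReal.ofReal |∑ β, c β * zeta l 0 u β| ^ (-s) with hF
  have hFm : Measurable F := by
    refine Measurable.pow_const (ENNReal.measurable_ofReal.comp (measurable_abs.comp ?_)) _
    exact Finset.measurable_sum _ fun β _ =>
      (measurable_zeta measurable_const measurable_id β).const_mul _
  set p := P (groupBall w x r) with hpdef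
  have hp0 : ENNReal.ofReal (c₀ * r ^ d) ≤ p := hp x hx r hr.le hrd w
  have hGm : Measurable fun y : EuclideanSpace ℝ (Fin d) => F (r⁻¹ • (y - x)) := by fun_prop
  calc ∫⁻ z, F (r⁻¹ • (covar z - x)) ∂(P[|groupBall w x r])
      = p⁻¹ * ∫⁻ z in groupBall w x r, F (r⁻¹ • (covar z - x)) ∂P := by
        rw [ProbabilityTheory.cond, lintegral_smul_measure, smul_eq_mul]
    _ ≤ p⁻¹ * ∫⁻ z in covar ⁻¹' Metric.ball x r, F (r⁻¹ • (covar z - x)) ∂P := by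
        gcongr
        rw [groupBall_eq]
        exact Set.inter_subset_right
    _ = p⁻¹ * ∫⁻ y in Metric.ball x r, F (r⁻¹ • (y - x)) ∂(covarLaw P) := by
        rw [covarLaw, setLIntegral_map measurableSet_ball hGm measurable_covar]
    _ ≤ p⁻¹ * ∫⁻ y in Metric.ball x r, F (r⁻¹ • (y - x)) ∂(ENNReal.ofReal hi • volume) := by
        gcongr
    _ = p⁻¹ * (ENNReal.ofReal hi * (ENNReal.ofReal (r ^ d) *
          ∫⁻ u in Metric.ball 0 1, F u)) := by
        rw [Measure.restrict_smul, lintegral_smul_measure, smul_eq_mul,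
          lintegral_ball_comp_affine hFm x hr]
    -- The volume factor `r ^ d` of the rescaling cancels against the lower bound for the mass of
    -- the ball, which makes the constant independent of `r`.
    _ ≤ (ENNReal.ofReal (c₀ * r ^ d))⁻¹ * (ENNReal.ofReal hi * (ENNReal.ofReal (r ^ d) *
          (C * ENNReal.ofReal |c α| ^ (-s)))) := by
        gcongr
        exact hC c α
    _ = _ := by
        rw [← ENNReal.ofReal_inv_of_pos (by positivity), ← mul_assoc, ← mul_assoc, ← mul_assoc,
          ← ENNReal.ofReal_mul (by positivity), ← ENNReal.ofReal_mul (by positivity)]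
        push_cast
        congr 2
        change _ = ENNReal.ofReal _
        congr 1
        have := (pow_pos hr d).ne'
        field_simp

end LocalATE

/-! ### The fit at one unit and the configuration of its neighbours -/

namespace LocalATE

variable {d N : ℕ}

theorem prod_pow_mul_zeta {L : ℕ} (x z : EuclideanSpace ℝ (Fin d)) (r : ℝ) (α : MultiIdx d L) :
    (∏ i, r⁻¹ ^ (α.1 i : ℕ)) * zeta L x z α = zeta L 0 (r⁻¹ • (z - x)) α := by
  simp only [zeta]
  rw [← Finset.prod_mul_distrib]
  refine Finset.prod_congr rfl fun i _ => ?_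
  simp [mul_pow]

theorem abs_zeta_zero_le_one {L : ℕ} {u : EuclideanSpace ℝ (Fin d)} (hu : ‖u‖ ≤ 1)
    (α : MultiIdx d L) : |zeta L 0 u α| ≤ 1 := by
  rw [zeta, Finset.abs_prod]
  refine Finset.prod_le_one (fun _ _ => abs_nonneg _) fun i _ => ?_
  rw [abs_pow]
  refine pow_le_one₀ (abs_nonneg _) ?_
  simpa using (PiLp.norm_apply_le u i).trans hu

/-- Determinants of blocks of rescaled design vectors control the error of the local polynomial
fit, whose neighbours lie within distance `r` of `x`. -/
theorem sum_det_sq_mul_gbar_error_le {L k : ℕ} {g : Bool → EuclideanSpace ℝ (Fin d) → ℝ}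
    {W : Fin N → Bool} {X : Fin N → EuclideanSpace ℝ (Fin d)} {w : Bool}
    {x : EuclideanSpace ℝ (Fin d)} (hkw : k ≤ groupSize W w) {r : ℝ} (hr : 0 < r)
    (hnr : ∀ j ∈ nbrs k W X w x, ‖X j - x‖ ≤ r) {B : Type*} [Fintype B]
    {e : B × MultiIdx d L → Fin N} (he : Function.Injective e) (heJ : ∀ p, e p ∈ nbrs k W X w x)
    {c : MultiIdx d L → ℝ} (hc : c (MultiIdx.origin d L) = g w x) {Λ γ : ℝ} (hΛ : 0 ≤ Λ)
    (hγ : 0 ≤ γ)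
    (hT : ∀ j ∈ nbrs k W X w x, |g w (X j) - ∑ α, c α * zeta L x (X j) α| ≤ Λ * ‖X j - x‖ ^ γ) :
    (∑ b, (Matrix.of fun i j => zeta L 0 (r⁻¹ • (X (e (b, i)) - x)) j).det ^ 2) *
        (g w x - gbar L k g W X w x) ^ 2
      ≤ ((Fintype.card (MultiIdx d L) * (Fintype.card (MultiIdx d L)).factorial ^ 2 : ℕ) : ℝ) *
        (nbrs k W X w x).card * (Λ ^ 2 * r ^ (2 * γ)) := by
  -- The weights `r ^ (-|α|)` move the neighbours into the unit ball, where monomials are at most 1.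
  -- The weight of the zero multi-index is 1, so the intercept is not rescaled.
  have hbound := sum_det_sq_mul_leastSquares_error_le (nbrs k W X w x) (fun j => zeta L x (X j))
    he heJ (w := fun α => ∏ i, r⁻¹ ^ (α.1 i : ℕ)) (fun α => by positivity)
    (o := MultiIdx.origin d L) (by simp [MultiIdx.origin]) (fun j hj α => by
      rw [prod_pow_mul_zeta]
      refine abs_zeta_zero_le_one ?_ α
      rw [norm_smul, Real.norm_eq_abs, abs_of_pos (inv_pos.2 hr), inv_mul_le_iff₀ hr, mul_one]
      exact hnr j hj) (y := fun j => g w (X j)) (c := c) (ε := Λ * r ^ γ) (fun j hj =>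
        (hT j hj).trans (mul_le_mul_of_nonneg_left
          (Real.rpow_le_rpow (norm_nonneg _) (hnr j hj) hγ) hΛ))
  simp only [prod_pow_mul_zeta] at hbound
  have h1 : gbar L k g W X w x = ((∑ j ∈ nbrs k W X w x, Matrix.vecMulVec (zeta L x (X j))
      (zeta L x (X j)))⁻¹.mulVec (∑ j ∈ nbrs k W X w x, g w (X j) • zeta L x (X j)))
      (MultiIdx.origin d L) := by
    rw [gbar, if_pos hkw, gram]
  rw [h1, ← hc, ← neg_sub, neg_sq]
  refine hbound.trans (le_of_eq ?_)
  rw [mul_pow, ← Real.rpow_natCast (r ^ γ) 2, ← Real.rpow_mul hr.le]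
  congr 3
  push_cast
  ring

/-- The sample `z` in which, as seen from unit `i`, the neighbours in the opposite treatment group
are the units in `J`, the farthest of them being `j₀`. -/
def nbrsEvent (S : Set (EuclideanSpace ℝ (Fin d))) (i : Fin N) (J : Finset (Fin N)) (j₀ : Fin N) :
    Set (Fin N → Obs d) :=
  {z | (covar (z i) ∈ S ∧ covar (z j₀) ∈ S ∧ treat (z j₀) = !treat (z i) ∧
      0 < ‖covar (z j₀) - covar (z i)‖ ∧ ∀ j ∉ J, treat (z j) = !treat (z i) →
        ‖covar (z j₀) - covar (z i)‖ < ‖covar (z j) - covar (z i)‖) ∧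
    ∀ j ∈ J.erase j₀, z j ∈ groupBall (!treat (z i)) (covar (z i)) ‖covar (z j₀) - covar (z i)‖}

theorem measurable_treat_eval (j : Fin N) : Measurable fun z : Fin N → Obs d => treat (z j) :=
  measurable_treat.comp (measurable_pi_apply j)

theorem measurable_covar_eval (j : Fin N) : Measurable fun z : Fin N → Obs d => covar (z j) :=
  measurable_covar.comp (measurable_pi_apply j)

theorem measurable_not_treat_eval (i : Fin N) :
    Measurable fun z : Fin N → Obs d => !treat (z i) :=
  (measurable_from_top (f := Bool.not)).comp (measurable_treat_eval i)

theorem measurable_dist_eval (i j : Fin N) :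
    Measurable fun z : Fin N → Obs d => ‖covar (z j) - covar (z i)‖ :=
  ((measurable_covar_eval j).sub (measurable_covar_eval i)).norm

theorem measurableSet_nbrsEvent {S : Set (EuclideanSpace ℝ (Fin d))} (hS : MeasurableSet S)
    (i : Fin N) (J : Finset (Fin N)) (j₀ : Fin N) : MeasurableSet (nbrsEvent S i J j₀) := by
  have hT : ∀ j, MeasurableSet {z : Fin N → Obs d | treat (z j) = !treat (z i)} := fun j =>
    measurableSet_eq_fun (measurable_treat_eval j) (measurable_not_treat_eval i)
  refine MeasurableSet.inter ?_ ?_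
  · refine (measurable_covar_eval i hS).inter ((measurable_covar_eval j₀ hS).inter
      ((hT j₀).inter ((measurableSet_lt measurable_const (measurable_dist_eval i j₀)).inter ?_)))
    have : {z : Fin N → Obs d | ∀ j ∉ J, treat (z j) = !treat (z i) →
        ‖covar (z j₀) - covar (z i)‖ < ‖covar (z j) - covar (z i)‖}
        = ⋂ j, ⋂ (_ : j ∉ J), ({z | treat (z j) = !treat (z i)}ᶜ ∪
          {z | ‖covar (z j₀) - covar (z i)‖ < ‖covar (z j) - covar (z i)‖}) := by
      ext z; simp [imp_iff_not_or]
    change MeasurableSet {z : Fin N → Obs d | ∀ j ∉ J, treat (z j) = !treat (z i) →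
        ‖covar (z j₀) - covar (z i)‖ < ‖covar (z j) - covar (z i)‖}
    rw [this]
    exact MeasurableSet.iInter fun j => MeasurableSet.iInter fun _ => (hT j).compl.union
      (measurableSet_lt (measurable_dist_eval i j₀) (measurable_dist_eval i j))
  · have : {z : Fin N → Obs d | ∀ j ∈ J.erase j₀, z j ∈
        groupBall (!treat (z i)) (covar (z i)) ‖covar (z j₀) - covar (z i)‖}
        = ⋂ j, ⋂ (_ : j ∈ J.erase j₀), ({z | treat (z j) = !treat (z i)} ∩
          {z | ‖covar (z j) - covar (z i)‖ < ‖covar (z j₀) - covar (z i)‖}) := by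
      ext z; simp only [groupBall, Set.mem_ofPred_eq, Set.mem_iInter, Set.mem_inter_iff]
    change MeasurableSet {z : Fin N → Obs d | ∀ j ∈ J.erase j₀, z j ∈
        groupBall (!treat (z i)) (covar (z i)) ‖covar (z j₀) - covar (z i)‖}
    rw [this]
    exact MeasurableSet.iInter fun j => MeasurableSet.iInter fun _ => (hT j).inter
      (measurableSet_lt (measurable_dist_eval i j) (measurable_dist_eval i j₀))

/-- The radius used at unit `i`, with the value `Δ` when the opposite group has fewer than `k`
units. -/
noncomputable def cappedRadius (Δ : ℝ) (k : ℕ) (i : Fin N) (z : Fin N → Obs d) : ℝ :=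
  if k ≤ groupSize (fun j => treat (z j)) (!treat (z i)) then
    knnRadius k (fun j => treat (z j)) (fun j => covar (z j)) (!treat (z i)) (covar (z i))
  else Δ

theorem nbrs_of_mem_nbrsEvent {S : Set (EuclideanSpace ℝ (Fin d))} {i j₀ : Fin N}
    {J : Finset (Fin N)} {k : ℕ} (hk : 1 ≤ k) (hJ : J.card = k) (hj₀ : j₀ ∈ J)
    {z : Fin N → Obs d} (hz : z ∈ nbrsEvent S i J j₀) :
    k ≤ groupSize (fun j => treat (z j)) (!treat (z i)) ∧
    knnRadius k (fun j => treat (z j)) (fun j => covar (z j)) (!treat (z i)) (covar (z i))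
      = ‖covar (z j₀) - covar (z i)‖ ∧
    nbrs k (fun j => treat (z j)) (fun j => covar (z j)) (!treat (z i)) (covar (z i)) = J := by
  obtain ⟨⟨-, -, ht₀, hpos, hout⟩, hin⟩ := hz
  have hJt : ∀ j ∈ J, treat (z j) = !treat (z i) ∧
      ‖covar (z j) - covar (z i)‖ ≤ ‖covar (z j₀) - covar (z i)‖ := by
    intro j hj
    rcases eq_or_ne j j₀ with rfl | h
    · exact ⟨ht₀, le_rfl⟩
    · have := hin j (Finset.mem_erase.2 ⟨h, hj⟩)
      exact ⟨this.1, this.2.le⟩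
  have hkw : k ≤ groupSize (fun j => treat (z j)) (!treat (z i)) := by
    rw [← hJ]
    exact Finset.card_le_card fun j hj => Finset.mem_filter.2 ⟨Finset.mem_univ _, (hJt j hj).1⟩
  have hr : knnRadius k (fun j => treat (z j)) (fun j => covar (z j)) (!treat (z i)) (covar (z i))
      = ‖covar (z j₀) - covar (z i)‖ := by
    refine le_antisymm ?_ ?_
    · by_contra! hlt
      have h1 := (le_knnRadius_iff hk hkw (X := fun j => covar (z j)) (x := covar (z i)) _).1 le_rfl
      have h2 : J.card ≤ countLT (fun j => treat (z j)) (fun j => covar (z j)) (!treat (z i))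
          (covar (z i)) (knnRadius k (fun j => treat (z j)) (fun j => covar (z j)) (!treat (z i))
            (covar (z i))) :=
        Finset.card_le_card fun j hj => Finset.mem_filter.2
          ⟨Finset.mem_univ _, (hJt j hj).1, (hJt j hj).2.trans_lt hlt⟩
      omega
    · refine (le_knnRadius_iff hk hkw _).2 ?_
      have h2 : countLT (fun j => treat (z j)) (fun j => covar (z j)) (!treat (z i))
          (covar (z i)) ‖covar (z j₀) - covar (z i)‖ ≤ (J.erase j₀).card := by
        refine Finset.card_le_card fun j hj => ?_
        obtain ⟨h3, h4⟩ := (Finset.mem_filter.1 hj).2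
        refine Finset.mem_erase.2 ⟨?_, ?_⟩
        · rintro rfl; exact lt_irrefl _ h4
        · by_contra hjJ
          exact lt_asymm h4 (hout j hjJ h3)
      rw [Finset.card_erase_of_mem hj₀] at h2
      omega
  refine ⟨hkw, hr, ?_⟩
  ext j
  rw [nbrs, Finset.mem_filter, hr]
  refine ⟨fun h => ?_, fun h => ⟨Finset.mem_univ _, hJt j h⟩⟩
  by_contra hjJ
  exact absurd h.2.2 (not_le.2 (hout j hjJ h.2.1))

/-- The events for different `(J, j₀)` are disjoint, so integrals over them add up without their
number entering the constant. -/
theorem nbrsEvent_unique {S : Set (EuclideanSpace ℝ (Fin d))} {i j₀ j₁ : Fin N}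
    {J J₁ : Finset (Fin N)} {k : ℕ} (hk : 1 ≤ k) (hJ : J.card = k) (hj₀ : j₀ ∈ J)
    (hJ₁ : J₁.card = k) (hj₁ : j₁ ∈ J₁) {z : Fin N → Obs d} (hz : z ∈ nbrsEvent S i J j₀)
    (hz₁ : z ∈ nbrsEvent S i J₁ j₁) : J = J₁ ∧ j₀ = j₁ := by
  obtain ⟨-, hr, hn⟩ := nbrs_of_mem_nbrsEvent hk hJ hj₀ hz
  obtain ⟨-, hr₁, hn₁⟩ := nbrs_of_mem_nbrsEvent hk hJ₁ hj₁ hz₁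
  have hJJ : J = J₁ := hn.symm.trans hn₁
  refine ⟨hJJ, ?_⟩
  by_contra hne
  have h1 := (hz.2 j₁ (Finset.mem_erase.2 ⟨Ne.symm hne, hJJ ▸ hj₁⟩)).2
  rw [← hr, hr₁] at h1
  exact lt_irrefl _ h1

/-- Without ties, the events describing the neighbours cover the samples with enough units in the
opposite group. -/
theorem exists_mem_nbrsEvent {S : Set (EuclideanSpace ℝ (Fin d))} {i : Fin N} {k : ℕ} (hk : 1 ≤ k)
    {z : Fin N → Obs d} (hS : ∀ j, covar (z j) ∈ S)
    (hties : ∀ a b, a ≠ b → ‖covar (z a) - covar (z i)‖ ≠ ‖covar (z b) - covar (z i)‖)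
    (hkw : k ≤ groupSize (fun j => treat (z j)) (!treat (z i))) :
    ∃ J : Finset (Fin N), ∃ j₀ ∈ J, J.card = k ∧ i ∉ J ∧ z ∈ nbrsEvent S i J j₀ := by
  obtain ⟨j₀, hj₀, hcard, hr, hstrict⟩ := exists_nbrs_structure hk hkw
    (X := fun j => covar (z j)) (x := covar (z i)) (fun a b _ _ hab => by
      by_contra hne; exact hties a b hne hab)
  have hne : ∀ j, treat (z j) = !treat (z i) → j ≠ i := by
    rintro j hj rfl
    simp at hj
  have hmem : ∀ j ∈ nbrs k (fun j => treat (z j)) (fun j => covar (z j)) (!treat (z i))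
      (covar (z i)), treat (z j) = !treat (z i) := fun j hj => (Finset.mem_filter.1 hj).2.1
  refine ⟨_, j₀, hj₀, hcard, fun hi => hne i (hmem i hi) rfl, ⟨hS i, hS j₀, hmem j₀ hj₀, ?_, ?_⟩, ?_⟩
  -- Unit `i` is itself at distance 0, so a zero radius would be a tie with `i`.
  · refine lt_of_le_of_ne (norm_nonneg _) fun h0 => ?_
    refine hties j₀ i (hne _ (hmem j₀ hj₀)) ?_
    rw [← h0]; simp
  · intro j hj htj
    by_contra! hle
    rw [hr] at hle
    exact hj (Finset.mem_filter.2 ⟨Finset.mem_univ _, htj, hle⟩)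
  · intro j hj
    obtain ⟨h1, h2⟩ := Finset.mem_erase.1 hj
    exact ⟨hmem j h2, hstrict j h2 h1⟩

end LocalATE

/-! ### Integrating over the strict neighbours -/

/-- Given that i.i.d. points all fall in `A`, they are i.i.d. with the conditioned law; the power of
`P A` is the probability of this. -/
theorem lintegral_indicator_univ_pi {Ω₀ κ : Type*} [MeasurableSpace Ω₀] [Fintype κ]
    (P : Measure Ω₀) [IsProbabilityMeasure P] {A : Set Ω₀} (hA : MeasurableSet A) (hA0 : P A ≠ 0)
    (H : (κ → Ω₀) → ℝ≥0∞) :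
    ∫⁻ y, (Set.univ.pi fun _ : κ => A).indicator H y ∂(Measure.pi fun _ : κ => P)
      = P A ^ Fintype.card κ * ∫⁻ y, H y ∂(Measure.pi fun _ : κ => P[|A]) := by
  have : IsProbabilityMeasure (P[|A]) := cond_isProbabilityMeasure hA0
  have h1 : P.restrict A = P A • P[|A] := by
    rw [ProbabilityTheory.cond, smul_smul, ENNReal.mul_inv_cancel hA0 (measure_ne_top P A), one_smul]
  have h2 : (Measure.pi fun _ : κ => P.restrict A)
      = P A ^ Fintype.card κ • Measure.pi fun _ : κ => P[|A] := by
    refine Measure.pi_eq fun s hs => ?_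
    rw [Measure.smul_apply, Measure.pi_pi, smul_eq_mul, h1]
    simp [Finset.prod_mul_distrib]
  rw [lintegral_indicator (MeasurableSet.univ_pi fun _ => hA), Measure.restrict_pi_pi, h2,
    lintegral_smul_measure, smul_eq_mul]

namespace LocalATE

variable {d N : ℕ}

/-- The sum of the squared determinants of the blocks, indexed by `e`, of design vectors rescaled
around unit `i` by its distance to unit `j₀`. -/
noncomputable def blockDetSum (L : ℕ) (i j₀ : Fin N) {G n : ℕ}
    (e : Fin G × Fin n × MultiIdx d L → Fin N) (z : Fin N → Obs d) : ℝ≥0∞ :=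
  ∑ g : Fin G, ∑ b : Fin n, ENNReal.ofReal ((Matrix.of fun α γ => zeta L 0
    (‖covar (z j₀) - covar (z i)‖⁻¹ • (covar (z (e (g, b, α))) - covar (z i))) γ).det ^ 2)

theorem measurable_zeta_rescale {L : ℕ} (γ : MultiIdx d L) (i j₀ j : Fin N) :
    Measurable fun z : Fin N → Obs d => zeta L 0
      (‖covar (z j₀) - covar (z i)‖⁻¹ • (covar (z j) - covar (z i))) γ :=
  measurable_zeta measurable_const ((measurable_dist_eval i j₀).inv.smul
    ((measurable_covar_eval j).sub (measurable_covar_eval i))) γ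

theorem measurable_blockDetSum (L : ℕ) (i j₀ : Fin N) {G n : ℕ}
    (e : Fin G × Fin n × MultiIdx d L → Fin N) :
    Measurable (blockDetSum L i j₀ e) := by
  unfold blockDetSum
  refine Finset.measurable_sum _ fun g _ => Finset.measurable_sum _ fun b _ =>
    ENNReal.measurable_ofReal.comp (Measurable.pow_const ?_ 2)
  simp only [Matrix.det_apply, Matrix.of_apply]
  refine Finset.measurable_sum _ fun σ _ => Measurable.const_smul ?_ _
  exact Finset.measurable_prod _ fun a _ => measurable_zeta_rescale _ _ _ _

/-- Conditionally on the units other than the strict neighbours of unit `i`, the inverse block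
determinants are integrable. -/
theorem lintegral_nbrsEvent_inv_blockDetSum_le {P : Measure (Obs d)} [IsProbabilityMeasure P]
    {S : Set (EuclideanSpace ℝ (Fin d))} (hS : MeasurableSet S) (hSb : Bornology.IsBounded S)
    {L n : ℕ} (hn : 0 < n) {C₁ : ℝ≥0}
    (hP : ∀ x ∈ S, ∀ r : ℝ, 0 < r → r ≤ Metric.diam S → ∀ w, P (groupBall w x r) ≠ 0)
    (hC₁ : ∀ x ∈ S, ∀ r : ℝ, 0 < r → r ≤ Metric.diam S →
      ∀ (w : Bool) (c : MultiIdx d L → ℝ) (α : MultiIdx d L),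
      ∫⁻ z, ENNReal.ofReal |∑ β, c β * zeta L 0 (r⁻¹ • (covar z - x)) β| ^ (-(2 / n : ℝ))
          ∂(P[|groupBall w x r]) ≤ C₁ * ENNReal.ofReal |c α| ^ (-(2 / n : ℝ)))
    {i j₀ : Fin N} {J : Finset (Fin N)} (hi : i ∉ J) {G : ℕ} (hG : 0 < G)
    {e : Fin G × Fin n × MultiIdx d L → Fin N} (he : Function.Injective e)
    (heJ : ∀ p, e p ∈ J.erase j₀) (a : ℝ) :
    ∫⁻ z in nbrsEvent S i J j₀, ENNReal.ofReal (‖covar (z j₀) - covar (z i)‖ ^ a) *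
        (blockDetSum L i j₀ e z)⁻¹ ∂(Measure.pi fun _ : Fin N => P)
      ≤ ((G : ℝ≥0∞)⁻¹ * ((C₁ : ℝ≥0∞) ^ Fintype.card (MultiIdx d L)) ^ n) *
        ∫⁻ z in nbrsEvent S i J j₀, ENNReal.ofReal (‖covar (z j₀) - covar (z i)‖ ^ a)
          ∂(Measure.pi fun _ : Fin N => P) := by
  classical
  set E := nbrsEvent S i J j₀ with hE
  set D : ℝ≥0∞ := (G : ℝ≥0∞)⁻¹ * ((C₁ : ℝ≥0∞) ^ Fintype.card (MultiIdx d L)) ^ n with hD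
  set ρ : (Fin N → Obs d) → ℝ≥0∞ := fun z => ENNReal.ofReal (‖covar (z j₀) - covar (z i)‖ ^ a)
    with hρ
  have hEm : MeasurableSet E := measurableSet_nbrsEvent hS i J j₀
  have hρm : Measurable ρ := ENNReal.measurable_ofReal.comp ((measurable_dist_eval i j₀).pow_const a)
  have hBm : Measurable fun z => (blockDetSum L i j₀ e z)⁻¹ := (measurable_blockDetSum L i j₀ e).inv
  rw [← lintegral_const_mul _ hρm, ← lintegral_indicator hEm, ← lintegral_indicator hEm]
  -- Freeze unit `i`, unit `j₀` and the units outside `J`, and compare the integrals over the strict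
  -- neighbours alone. Centre, radius and treatment are then fixed.
  refine lintegral_le_of_lmarginal_le (J.erase j₀) ((hρm.mul hBm).indicator hEm)
    ((hρm.const_mul D).indicator hEm) fun z => ?_
  rw [lmarginal, lmarginal]
  set J' := J.erase j₀ with hJ'
  set x := covar (z i) with hx
  set r := ‖covar (z j₀) - x‖ with hr
  set w := !treat (z i) with hw
  have hup_not : ∀ (y : ∀ _ : J', Obs d) (j : Fin N), j ∉ J' →
      Function.updateFinset z J' y j = z j := by
    intro y j hj
    simp [Function.updateFinset, hj]
  have hup_mem : ∀ (y : ∀ _ : J', Obs d) (j : Fin N) (hj : j ∈ J'),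
      Function.updateFinset z J' y j = y ⟨j, hj⟩ := by
    intro y j hj
    simp [Function.updateFinset, hj]
  have hi' : i ∉ J' := fun h => hi (Finset.mem_of_mem_erase h)
  have hj₀' : j₀ ∉ J' := Finset.notMem_erase _ _
  -- The frozen units decide this part of the event. If it fails, both sides are 0; if it holds,
  -- what remains is that every strict neighbour lies in the fixed group ball.
  by_cases hout : x ∈ S ∧ covar (z j₀) ∈ S ∧ treat (z j₀) = w ∧ 0 < r ∧
      ∀ j ∉ J, treat (z j) = w → r < ‖covar (z j) - x‖
  swap
  · have hnot : ∀ y : ∀ _ : J', Obs d, Function.updateFinset z J' y ∉ E := by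
      intro y hy
      refine hout ?_
      have h1 := hy.1
      rw [hup_not y i hi', hup_not y j₀ hj₀'] at h1
      refine ⟨h1.1, h1.2.1, h1.2.2.1, h1.2.2.2.1, fun j hj => ?_⟩
      have h2 := h1.2.2.2.2 j hj
      rwa [hup_not y j fun h => hj (Finset.mem_of_mem_erase h)] at h2
    simp only [Set.indicator_of_notMem (hnot _)]
    exact le_rfl
  obtain ⟨hxS, hjS, htj, hrpos, hfar⟩ := hout
  have hrd : r ≤ Metric.diam S := by
    rw [hr, ← dist_eq_norm]
    exact Metric.dist_le_diam_of_mem hSb hjS hxS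
  set A := groupBall w x r with hA
  have hA0 : P A ≠ 0 := hP x hxS r hrpos hrd w
  have hAm : MeasurableSet A := measurableSet_groupBall w x r
  have hmemE : ∀ y : ∀ _ : J', Obs d, Function.updateFinset z J' y ∈ E ↔
      y ∈ Set.univ.pi fun _ : J' => A := by
    intro y
    rw [hE, nbrsEvent]
    change (_ ∧ ∀ j ∈ J', _) ↔ _
    simp only [hup_not y i hi', hup_not y j₀ hj₀']
    constructor
    · rintro ⟨-, h⟩ ⟨j, hj⟩ -
      have := h j hj
      rwa [hup_mem y j hj] at this
    · intro h
      refine ⟨⟨hxS, hjS, htj, hrpos, fun j hj => ?_⟩, fun j hj => ?_⟩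
      · rw [hup_not y j fun h => hj (Finset.mem_of_mem_erase h)]
        exact hfar j hj
      · rw [hup_mem y j hj]
        exact h ⟨j, hj⟩ (Set.mem_univ _)
  set φ : Obs d → MultiIdx d L → ℝ := fun ω => zeta L 0 (r⁻¹ • (covar ω - x)) with hφ
  have hφm : Measurable φ := measurable_pi_lambda _ fun γ =>
    measurable_zeta measurable_const ((measurable_covar.sub_const x).const_smul r⁻¹) γ
  set e' : Fin G × Fin n × MultiIdx d L → J' := fun p => ⟨e p, heJ p⟩ with he'
  have he'i : Function.Injective e' := fun p q h => he (congrArg Subtype.val h)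
  set H : (J' → Obs d) → ℝ≥0∞ := fun y => (∑ g : Fin G, ∑ b : Fin n, ENNReal.ofReal
      ((Matrix.of fun α γ => φ (y (e' (g, b, α))) γ).det ^ 2))⁻¹ with hH
  have hblock : ∀ y : ∀ _ : J', Obs d,
      (blockDetSum L i j₀ e (Function.updateFinset z J' y))⁻¹ = H y := by
    intro y
    simp only [blockDetSum, hup_not y i hi', hup_not y j₀ hj₀', hH, hφ, he', hup_mem y _ (heJ _)]
    rfl
  have hρ' : ∀ y : ∀ _ : J', Obs d, ρ (Function.updateFinset z J' y) = ENNReal.ofReal (r ^ a) := by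
    intro y
    simp only [hρ, hup_not y i hi', hup_not y j₀ hj₀']
    rfl
  have hL : ∀ y : ∀ _ : J', Obs d,
      E.indicator (fun z => ρ z * (blockDetSum L i j₀ e z)⁻¹) (Function.updateFinset z J' y)
        = ENNReal.ofReal (r ^ a) * (Set.univ.pi fun _ : J' => A).indicator H y := by
    intro y
    by_cases hy : y ∈ Set.univ.pi fun _ : J' => A
    · rw [Set.indicator_of_mem hy, Set.indicator_of_mem ((hmemE y).2 hy), hρ', hblock]
    · rw [Set.indicator_of_notMem hy, Set.indicator_of_notMem fun h => hy ((hmemE y).1 h), mul_zero]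
  have hR : ∀ y : ∀ _ : J', Obs d,
      E.indicator (fun z => D * ρ z) (Function.updateFinset z J' y)
        = ENNReal.ofReal (r ^ a) * (Set.univ.pi fun _ : J' => A).indicator (fun _ => D) y := by
    intro y
    by_cases hy : y ∈ Set.univ.pi fun _ : J' => A
    · rw [Set.indicator_of_mem hy, Set.indicator_of_mem ((hmemE y).2 hy), hρ', mul_comm]
    · rw [Set.indicator_of_notMem hy, Set.indicator_of_notMem fun h => hy ((hmemE y).1 h), mul_zero]
  have : IsProbabilityMeasure (P[|A]) := cond_isProbabilityMeasure hA0
  refine (lintegral_congr hL).trans_le (le_trans ?_ (lintegral_congr hR).symm.le)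
  rw [lintegral_const_mul' _ _ ENNReal.ofReal_ne_top, lintegral_const_mul' _ _ ENNReal.ofReal_ne_top,
    lintegral_indicator_univ_pi P hAm hA0 H, lintegral_indicator_univ_pi P hAm hA0 fun _ => D]
  refine mul_le_mul' le_rfl (mul_le_mul' le_rfl ?_)
  rw [lintegral_const, measure_univ, mul_one]
  exact lintegral_inv_sum_det_sq_le hφm hn (hC₁ x hxS r hrpos hrd w) hG he'i

end LocalATE

/-! ### Moments of the nearest-neighbour radius -/

theorem lintegral_pi_prod_eq_pow {Ω₀ κ : Type*} [MeasurableSpace Ω₀] [Fintype κ]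
    (P : Measure Ω₀) [IsProbabilityMeasure P] {q : Ω₀ → ℝ≥0∞} (hq : Measurable q) :
    ∫⁻ y, ∏ j, q (y j) ∂(Measure.pi fun _ : κ => P) = (∫⁻ ω, q ω ∂P) ^ Fintype.card κ := by
  have hind : iIndepFun (fun (j : κ) (y : κ → Ω₀) => q (y j)) (Measure.pi fun _ : κ => P) :=
    iIndepFun_pi (X := fun _ => q) fun _ => hq.aemeasurable
  rw [lintegral_prod_eq_prod_lintegral_of_indepFun _ _ hind
    fun j => hq.comp (measurable_pi_apply j)]
  rw [Finset.prod_congr rfl fun j _ =>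
    (measurePreserving_eval (fun _ : κ => P) j).lintegral_comp hq]
  simp

theorem summable_add_one_rpow_mul_exp_neg (b : ℝ) :
    Summable fun m : ℕ => ((m : ℝ) + 1) ^ b * Real.exp (-m) := by
  have h1 := (summable_nat_add_iff 1).2
    (Real.summable_pow_mul_exp_neg_nat_mul ⌈b⌉₊ (r := 1) one_pos)
  refine Summable.of_nonneg_of_le (fun m => by positivity) (fun m => ?_)
    (h1.mul_left (Real.exp 1))
  have h2 : ((m : ℝ) + 1) ^ b ≤ ((m : ℝ) + 1) ^ ⌈b⌉₊ := by
    rw [← Real.rpow_natCast]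
    exact Real.rpow_le_rpow_of_exponent_le (by linarith [m.cast_nonneg (α := ℝ)]) (Nat.le_ceil b)
  calc ((m : ℝ) + 1) ^ b * Real.exp (-m) ≤ ((m : ℝ) + 1) ^ ⌈b⌉₊ * Real.exp (-m) := by gcongr
    _ = Real.exp 1 * (((m + 1 : ℕ) : ℝ) ^ ⌈b⌉₊ * Real.exp (-1 * (m + 1 : ℕ))) := by
        push_cast
        rw [mul_left_comm, ← Real.exp_add]
        congr 2
        ring

namespace LocalATE

variable {d N : ℕ}

/-- Chernoff bound: few units of the opposite group in a ball around unit `i` are unlikely. -/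
theorem measure_countLT_lt_le {P : Measure (Obs d)} [IsProbabilityMeasure P]
    {S : Set (EuclideanSpace ℝ (Fin d))} (hS : MeasurableSet S) {r p : ℝ}
    (hP : ∀ x ∈ S, ∀ w, ENNReal.ofReal p ≤ P (groupBall w x r)) (i : Fin N) (k : ℕ) :
    (Measure.pi fun _ : Fin N => P) {z | covar (z i) ∈ S ∧
        countLT (fun j => treat (z j)) (fun j => covar (z j)) (!treat (z i)) (covar (z i)) r < k}
      ≤ ENNReal.ofReal (2 * Real.exp (k - N * p / 2)) := by
  classical
  by_cases hne : S.Nonempty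
  swap
  · rw [Set.not_nonempty_iff_eq_empty.1 hne]; simp
  have hp1 : p ≤ 1 := by
    obtain ⟨x, hx⟩ := hne
    have := (hP x hx true).trans prob_le_one
    simpa using this
  -- The product of these weights is `2 ^ (-count)`; the tail bound is Markov's inequality for it,
  -- each factor having mean at most `1 - p/2 ≤ exp(-p/2)`.
  set q : Bool → EuclideanSpace ℝ (Fin d) → Obs d → ℝ≥0∞ := fun w x ω =>
    if ω ∈ groupBall w x r then 2⁻¹ else 1 with hq
  set E : Set (Fin N → Obs d) := {z | covar (z i) ∈ S ∧
    countLT (fun j => treat (z j)) (fun j => covar (z j)) (!treat (z i)) (covar (z i)) r < k} with hE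
  have hEm : MeasurableSet E :=
    (measurable_covar_eval i hS).inter (measurableSet_lt
      (measurable_countLT measurable_treat_eval measurable_covar_eval
        (measurable_not_treat_eval i) (measurable_covar_eval i) measurable_const) measurable_const)
  have hmarg : ∀ z : Fin N → Obs d, covar (z i) ∈ S →
      ∫⁻ ω, q (!treat (z i)) (covar (z i)) ω ∂P ≤ ENNReal.ofReal (Real.exp (-p / 2)) := by
    intro z hz
    set A := groupBall (!treat (z i)) (covar (z i)) r with hA
    have hAm : MeasurableSet A := measurableSet_groupBall _ _ _
    have h1 : ∀ ω, q (!treat (z i)) (covar (z i)) ω = A.indicator (fun _ => 2⁻¹) ω +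
        Aᶜ.indicator (fun _ => 1) ω := by
      intro ω
      by_cases h : ω ∈ A <;> simp [hq, h, ← hA]
    simp_rw [h1]
    rw [lintegral_add_left (measurable_const.indicator hAm), lintegral_indicator_const hAm,
      lintegral_indicator_const hAm.compl, one_mul, ← ofReal_measureReal (measure_ne_top P A),
      ← ofReal_measureReal (measure_ne_top P Aᶜ), probReal_compl_eq_one_sub hAm]
    have h2 : p ≤ P.real A := by
      have := hP _ hz (!treat (z i))
      rw [← hA, ← ofReal_measureReal (measure_ne_top P A)] at this
      exact (ENNReal.ofReal_le_ofReal_iff measureReal_nonneg).1 this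
    have h3 : (2⁻¹ : ℝ≥0∞) = ENNReal.ofReal 2⁻¹ := by
      rw [ENNReal.ofReal_inv_of_pos two_pos]; simp
    rw [h3, ← ENNReal.ofReal_mul (by norm_num), ← ENNReal.ofReal_add
      (mul_nonneg (by norm_num) measureReal_nonneg) (sub_nonneg.2 measureReal_le_one)]
    refine ENNReal.ofReal_le_ofReal ?_
    have := Real.add_one_le_exp (-p / 2)
    linarith
  have hpt : ∀ z ∈ E, (1 : ℝ≥0∞) ≤ 2 ^ k *
      ∏ j ∈ Finset.univ.erase i, q (!treat (z i)) (covar (z i)) (z j) := by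
    intro z hz
    have h1 : ∏ j ∈ Finset.univ.erase i, q (!treat (z i)) (covar (z i)) (z j)
        = 2⁻¹ ^ ((Finset.univ.erase i).filter fun j =>
          z j ∈ groupBall (!treat (z i)) (covar (z i)) r).card := by
      simp only [hq]
      rw [Finset.prod_ite, Finset.prod_const, Finset.prod_const_one, mul_one]
    have h2 : ((Finset.univ.erase i).filter fun j =>
          z j ∈ groupBall (!treat (z i)) (covar (z i)) r).card ≤ k := by
      refine le_trans (Finset.card_le_card fun j hj => ?_) hz.2.le
      exact Finset.mem_filter.2 ⟨Finset.mem_univ _, (Finset.mem_filter.1 hj).2⟩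
    rw [h1]
    calc (1 : ℝ≥0∞) = 2 ^ k * 2⁻¹ ^ k := by
          rw [← mul_pow, ENNReal.mul_inv_cancel (by simp) (by simp), one_pow]
      _ ≤ _ := by
          gcongr 2 ^ k * ?_
          exact pow_le_pow_right_of_le_one' (by simp) h2
  have hqm : Measurable fun u : (Bool × EuclideanSpace ℝ (Fin d)) × Obs d => q u.1.1 u.1.2 u.2 := by
    refine Measurable.ite ?_ measurable_const measurable_const
    exact (measurableSet_eq_fun (measurable_treat.comp measurable_snd)
      (measurable_fst.comp measurable_fst)).inter (measurableSet_lt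
        ((measurable_covar.comp measurable_snd).sub (measurable_snd.comp measurable_fst)).norm
        measurable_const)
  have hqz : ∀ j, Measurable fun z : Fin N → Obs d => q (!treat (z i)) (covar (z i)) (z j) :=
    fun j => hqm.comp (((measurable_not_treat_eval i).prodMk (measurable_covar_eval i)).prodMk
      (measurable_pi_apply j))
  have hNi : (Finset.univ.erase i : Finset (Fin N)).card = N - 1 := by
    rw [Finset.card_erase_of_mem (Finset.mem_univ i)]; simp
  have hN : 1 ≤ N := by have := i.2; omega
  set F : (Fin N → Obs d) → ℝ≥0∞ := {z | covar (z i) ∈ S}.indicator fun z =>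
    2 ^ k * ∏ j ∈ Finset.univ.erase i, q (!treat (z i)) (covar (z i)) (z j) with hF
  have hFm : Measurable F := by
    refine Measurable.indicator ?_ (measurable_covar_eval i hS)
    exact (Finset.measurable_prod _ fun j _ => hqz j).const_mul _
  have hint : ∫⁻ z, F z ∂(Measure.pi fun _ : Fin N => P)
      ≤ ∫⁻ _z, ENNReal.ofReal (2 * Real.exp (k - N * p / 2)) ∂(Measure.pi fun _ : Fin N => P) := by
    refine lintegral_le_of_lmarginal_le (Finset.univ.erase i) hFm measurable_const fun z => ?_
    rw [lmarginal, lmarginal, lintegral_const, measure_univ, mul_one]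
    have hupi : ∀ y : ∀ _ : (Finset.univ.erase i : Finset (Fin N)), Obs d,
        Function.updateFinset z (Finset.univ.erase i) y i = z i := fun y => by
      simp [Function.updateFinset]
    by_cases hz : covar (z i) ∈ S
    swap
    · have : ∀ y : ∀ _ : (Finset.univ.erase i : Finset (Fin N)), Obs d,
          F (Function.updateFinset z (Finset.univ.erase i) y) = 0 := by
        intro y
        refine Set.indicator_of_notMem ?_ _
        change covar (Function.updateFinset z (Finset.univ.erase i) y i) ∉ S
        rwa [hupi]
      simp [this]
    have hFy : ∀ y : ∀ _ : (Finset.univ.erase i : Finset (Fin N)), Obs d,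
        F (Function.updateFinset z (Finset.univ.erase i) y)
          = 2 ^ k * ∏ j, q (!treat (z i)) (covar (z i)) (y j) := by
      intro y
      rw [hF, Set.indicator_of_mem (by
        change covar (Function.updateFinset z (Finset.univ.erase i) y i) ∈ S
        rwa [hupi])]
      rw [hupi, ← Finset.prod_coe_sort]
      congr 1
      refine Finset.prod_congr rfl fun j _ => ?_
      have : Function.updateFinset z (Finset.univ.erase i) y j = y j := by
        simp only [Function.updateFinset, dif_pos j.2]
      rw [this]
    refine (lintegral_congr hFy).trans_le ?_
    have hq1 : Measurable fun ω => q (!treat (z i)) (covar (z i)) ω := hqm.comp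
      ((measurable_const (a := (!treat (z i), covar (z i)))).prodMk measurable_id)
    rw [lintegral_const_mul' _ _ (by simp), lintegral_pi_prod_eq_pow P hq1, Fintype.card_coe, hNi]
    calc 2 ^ k * (∫⁻ ω, q (!treat (z i)) (covar (z i)) ω ∂P) ^ (N - 1)
        ≤ ENNReal.ofReal (Real.exp k) * ENNReal.ofReal (Real.exp (-p / 2)) ^ (N - 1) := by
          gcongr
          · rw [← Real.exp_one_pow, ENNReal.ofReal_pow (Real.exp_nonneg _)]
            refine pow_le_pow_left' ?_ k
            rw [← ENNReal.ofReal_ofNat 2]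
            refine ENNReal.ofReal_le_ofReal ?_
            linarith [Real.add_one_le_exp 1]
          · exact hmarg z hz
      _ = ENNReal.ofReal (Real.exp (k + (N - 1 : ℕ) * (-p / 2))) := by
          rw [← ENNReal.ofReal_pow (Real.exp_nonneg _), ← ENNReal.ofReal_mul (Real.exp_nonneg _),
            ← Real.exp_nat_mul, ← Real.exp_add]
      -- Unit `i` is frozen, so only `N - 1` factors are integrated; the missing one costs `exp(p/2)
      -- ≤ exp(1/2) ≤ 2`, since `p ≤ 1`.
      _ ≤ ENNReal.ofReal (2 * Real.exp (k - N * p / 2)) := by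
          refine ENNReal.ofReal_le_ofReal ?_
          have h1 : (k : ℝ) + (N - 1 : ℕ) * (-p / 2) = p / 2 + (k - N * p / 2) := by
            rw [Nat.cast_sub hN]; push_cast; ring
          rw [h1, Real.exp_add]
          refine mul_le_mul_of_nonneg_right ?_ (Real.exp_nonneg _)
          have h2 : Real.exp (p / 2) ≤ Real.exp (1 / 2) := Real.exp_le_exp.2 (by linarith)
          have h3 : Real.exp (1 / 2) ^ 2 = Real.exp 1 := by
            rw [← Real.exp_nat_mul]; norm_num
          nlinarith [Real.exp_one_lt_d9, Real.exp_pos (1 / 2)]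
  calc (Measure.pi fun _ : Fin N => P) E = ∫⁻ z, E.indicator 1 z ∂(Measure.pi fun _ : Fin N => P) :=
        (lintegral_indicator_one hEm).symm
    _ ≤ ∫⁻ z, F z ∂(Measure.pi fun _ : Fin N => P) := by
        refine lintegral_mono fun z => ?_
        by_cases hz : z ∈ E
        · rw [Set.indicator_of_mem hz, hF, Set.indicator_of_mem (show z ∈ {z | covar (z i) ∈ S} from hz.1)]
          exact hpt z hz
        · rw [Set.indicator_of_notMem hz]; exact zero_le
    _ ≤ _ := hint.trans (by rw [lintegral_const, measure_univ, mul_one])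

/-- With too few units every count is below `k`, so the default value `diam S` satisfies the same
bounds as a true radius and both cases share one tail estimate. -/
theorem cappedRadius_properties {S : Set (EuclideanSpace ℝ (Fin d))} (hSb : Bornology.IsBounded S)
    {k : ℕ} (hk : 1 ≤ k) (i : Fin N) {z : Fin N → Obs d} (hz : ∀ j, covar (z j) ∈ S) :
    0 ≤ cappedRadius (Metric.diam S) k i z ∧ cappedRadius (Metric.diam S) k i z ≤ Metric.diam S ∧
      ∀ r ≤ cappedRadius (Metric.diam S) k i z, countLT (fun j => treat (z j))
        (fun j => covar (z j)) (!treat (z i)) (covar (z i)) r < k := by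
  unfold cappedRadius
  split_ifs with hkw
  · refine ⟨(le_knnRadius_iff hk hkw 0).2 ?_, ?_, fun r hr => (le_knnRadius_iff hk hkw r).1 hr⟩
    · have : countLT (fun j => treat (z j)) (fun j => covar (z j)) (!treat (z i)) (covar (z i)) 0
          = 0 := by
        refine Finset.card_eq_zero.2 (Finset.filter_eq_empty_iff.2 fun j _ h => ?_)
        exact absurd h.2 (not_lt.2 (norm_nonneg _))
      omega
    · by_contra! hlt
      have h1 := (le_knnRadius_iff hk hkw (X := fun j => covar (z j)) (x := covar (z i)) _).1 le_rfl
      refine absurd h1 (not_lt.2 (hkw.trans (Finset.card_le_card fun j hj => ?_)))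
      refine Finset.mem_filter.2 ⟨Finset.mem_univ _, (Finset.mem_filter.1 hj).2, ?_⟩
      refine lt_of_le_of_lt ?_ hlt
      rw [← dist_eq_norm]
      exact Metric.dist_le_diam_of_mem hSb (hz j) (hz i)
  · refine ⟨Metric.diam_nonneg, le_rfl, fun r _ => ?_⟩
    exact (countLT_le_groupSize _ _ _ _ _).trans_lt (not_le.1 hkw)

/-- The moments of the nearest-neighbour radius are of the order of the corresponding powers of
`(k / N)^(1/d)`. -/
theorem exists_lintegral_cappedRadius_rpow_le (hd : 1 ≤ d) {P : Measure (Obs d)}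
    [IsProbabilityMeasure P] {S : Set (EuclideanSpace ℝ (Fin d))} (hS : MeasurableSet S)
    (hSb : Bornology.IsBounded S) (hPS : ∀ᵐ z ∂P, covar z ∈ S) {c : ℝ} (hc : 0 < c)
    (hP : ∀ x ∈ S, ∀ r : ℝ, 0 ≤ r → r ≤ Metric.diam S →
      ∀ w, ENNReal.ofReal (c * r ^ d) ≤ P (groupBall w x r)) {a : ℝ} (ha : 0 ≤ a) :
    ∃ C : ℝ≥0, ∀ (N k : ℕ) (i : Fin N), 1 ≤ k →
      ∫⁻ z, ENNReal.ofReal (cappedRadius (Metric.diam S) k i z ^ a) ∂(Measure.pi fun _ : Fin N => P)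
        ≤ C * ENNReal.ofReal (((k : ℝ) / N) ^ (a / d)) := by
  have hsum := (summable_add_one_rpow_mul_exp_neg (a / d)).mul_left 2
  set T : ℝ := ∑' m : ℕ, 2 * (((m : ℝ) + 1) ^ (a / d) * Real.exp (-m)) with hT
  refine ⟨((4 / c) ^ (a / d) * T).toNNReal, fun N k i hk => ?_⟩
  have hN : 0 < N := i.pos
  have hNr : (0 : ℝ) < N := by exact_mod_cast hN
  have hkr : (1 : ℝ) ≤ k := by exact_mod_cast hk
  have hdr : (0 : ℝ) < d := by exact_mod_cast hd
  set Δ := Metric.diam S with hΔ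
  -- Chosen so that at `rad m`, where `rad m ^ d = q * m`, the Chernoff exponent is `k - 2 * k * m`,
  -- which is at most `-m` for `m ≥ 1`.
  set q : ℝ := 4 * k / (N * c) with hqdef
  have hq : 0 < q := by positivity
  set rad : ℕ → ℝ := fun m => (q * m) ^ (1 / d : ℝ) with hrad
  have hrad0 : ∀ m, 0 ≤ rad m := fun m => by positivity
  have hradd : ∀ m, rad m ^ d = q * m := by
    intro m
    simp only [hrad]
    rw [← Real.rpow_natCast, ← Real.rpow_mul (by positivity), one_div, inv_mul_cancel₀ hdr.ne',
      Real.rpow_one]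
  set E : ℕ → Set (Fin N → Obs d) := fun m => {z | covar (z i) ∈ S ∧
    countLT (fun j => treat (z j)) (fun j => covar (z j)) (!treat (z i)) (covar (z i)) (rad m) < k}
    with hE
  have hEm : ∀ m, MeasurableSet (E m) := fun m =>
    (measurable_covar_eval i hS).inter (measurableSet_lt
      (measurable_countLT measurable_treat_eval measurable_covar_eval
        (measurable_not_treat_eval i) (measurable_covar_eval i) measurable_const) measurable_const)
  -- Layer `m` covers radii between `rad m` and `rad (m + 1)`. Layers beyond the diameter are
  -- dropped: the capped radius never reaches them, and the mass bound for balls is not available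
  -- there.
  set F : ℕ → (Fin N → Obs d) → ℝ≥0∞ := fun m z =>
    if rad m ≤ Δ then ENNReal.ofReal (q ^ (a / d) * ((m : ℝ) + 1) ^ (a / d)) * (E m).indicator 1 z
    else 0 with hF
  have hFm : ∀ m, Measurable (F m) := by
    intro m
    simp only [hF]
    split_ifs
    · exact (measurable_one.indicator (hEm m)).const_mul _
    · exact measurable_const
  have hgood : ∀ᵐ z ∂(Measure.pi fun _ : Fin N => P), ∀ j, covar (z j) ∈ S := by
    rw [ae_all_iff]
    exact fun j => (Measure.quasiMeasurePreserving_eval (fun _ : Fin N => P) j).ae hPS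
  have hpt : ∀ᵐ z ∂(Measure.pi fun _ : Fin N => P),
      ENNReal.ofReal (cappedRadius Δ k i z ^ a) ≤ ∑' m, F m z := by
    filter_upwards [hgood] with z hz
    obtain ⟨h0, h1, h2⟩ := cappedRadius_properties hSb hk i hz
    set R := cappedRadius Δ k i z with hR
    set m := ⌊R ^ d / q⌋₊ with hm
    have hm1 : (m : ℝ) ≤ R ^ d / q := Nat.floor_le (by positivity)
    have hm2 : R ^ d / q < m + 1 := Nat.lt_floor_add_one _
    have hRpow : (R ^ d) ^ (1 / d : ℝ) = R := by
      rw [← Real.rpow_natCast, ← Real.rpow_mul h0, mul_one_div_cancel hdr.ne', Real.rpow_one]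
    have hle : rad m ≤ R := by
      rw [← hRpow]
      refine Real.rpow_le_rpow (by positivity) ?_ (by positivity)
      rwa [le_div_iff₀ hq, mul_comm] at hm1
    refine le_trans ?_ (ENNReal.le_tsum m)
    simp only [hF]
    rw [if_pos (hle.trans h1), Set.indicator_of_mem (show z ∈ E m from ⟨hz i, h2 _ hle⟩)]
    simp only [Pi.one_apply, mul_one]
    refine ENNReal.ofReal_le_ofReal ?_
    rw [← Real.mul_rpow hq.le (by positivity)]
    have h3 : R ^ a = (R ^ d) ^ (a / d) := by
      rw [← Real.rpow_natCast, ← Real.rpow_mul h0, mul_div_cancel₀ _ hdr.ne']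
    rw [h3]
    refine Real.rpow_le_rpow (by positivity) ?_ (by positivity)
    rw [div_lt_iff₀ hq, mul_comm] at hm2
    exact hm2.le
  have hFint : ∀ m, ∫⁻ z, F m z ∂(Measure.pi fun _ : Fin N => P)
      ≤ ENNReal.ofReal (q ^ (a / d) * (2 * (((m : ℝ) + 1) ^ (a / d) * Real.exp (-m)))) := by
    intro m
    simp only [hF]
    split_ifs with hmΔ
    swap
    · simp
    rw [lintegral_const_mul _ (measurable_one.indicator (hEm m)), lintegral_indicator_one (hEm m)]
    have hEle : (Measure.pi fun _ : Fin N => P) (E m) ≤ ENNReal.ofReal (2 * Real.exp (-m)) := by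
      -- At `m = 0` the exponential bound is useless, but the claimed bound is 2.
      rcases Nat.eq_zero_or_pos m with rfl | hm
      · refine prob_le_one.trans ?_
        simp
      refine (measure_countLT_lt_le hS (p := c * rad m ^ d)
        (fun x hx w => hP x hx _ (hrad0 m) hmΔ w) i k).trans (ENNReal.ofReal_le_ofReal ?_)
      have hmr : (1 : ℝ) ≤ m := by exact_mod_cast hm
      gcongr
      rw [hradd, hqdef]
      have : (N : ℝ) * (c * (4 * k / (N * c) * m)) / 2 = 2 * (k * m) := by
        field_simp; ring
      rw [this]
      nlinarith
    calc _ ≤ ENNReal.ofReal (q ^ (a / d) * ((m : ℝ) + 1) ^ (a / d)) *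
          ENNReal.ofReal (2 * Real.exp (-m)) := by gcongr
      _ = _ := by
          rw [← ENNReal.ofReal_mul (by positivity)]
          congr 1; ring
  calc ∫⁻ z, ENNReal.ofReal (cappedRadius Δ k i z ^ a) ∂(Measure.pi fun _ : Fin N => P)
      ≤ ∫⁻ z, ∑' m, F m z ∂(Measure.pi fun _ : Fin N => P) := lintegral_mono_ae hpt
    _ = ∑' m, ∫⁻ z, F m z ∂(Measure.pi fun _ : Fin N => P) :=
        lintegral_tsum fun m => (hFm m).aemeasurable
    _ ≤ ∑' m : ℕ, ENNReal.ofReal (q ^ (a / d) *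
          (2 * (((m : ℝ) + 1) ^ (a / d) * Real.exp (-m)))) := ENNReal.tsum_le_tsum hFint
    _ = ENNReal.ofReal (q ^ (a / d) * T) := by
        rw [← ENNReal.ofReal_tsum_of_nonneg (fun m => by positivity) (hsum.mul_left _),
          tsum_mul_left]
    _ = _ := by
        have hT0 : 0 ≤ T := tsum_nonneg fun m => by positivity
        change _ = ENNReal.ofReal _ * _
        rw [← ENNReal.ofReal_mul (by positivity)]
        congr 1
        have : q = 4 / c * (k / N) := by rw [hqdef]; field_simp
        rw [this, Real.mul_rpow (by positivity) (by positivity)]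
        ring

end LocalATE

/-! ### Second moment of the error at one unit -/

namespace LocalATE

variable {d N : ℕ}

theorem measure_covar_dist_eq (hd : 1 ≤ d) {P : Measure (Obs d)} [IsProbabilityMeasure P]
    (hT3 : DensityCondition P) (x : EuclideanSpace ℝ (Fin d)) (ρ : ℝ) :
    P {ω | ‖covar ω - x‖ = ρ} = 0 := by
  obtain ⟨lo, hi, -, -, hup, -⟩ := hT3.exists_bounds
  have : Nonempty (Fin d) := ⟨⟨0, hd⟩⟩
  have h1 : {ω : Obs d | ‖covar ω - x‖ = ρ} = covar ⁻¹' Metric.sphere x ρ := by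
    ext ω; simp
  rw [h1, ← Measure.map_apply measurable_covar Metric.isClosed_sphere.measurableSet]
  refine le_antisymm ((hup _).trans ?_) zero_le
  rw [Measure.smul_apply, Measure.addHaar_sphere, smul_zero]

/-- With all units but `a` frozen, a tie puts `X_a` on a fixed sphere, a null set. The unit
integrated out must not be the centre `i`; if `a = i`, the roles of `a` and `b` are exchanged. -/
theorem ae_dist_injective (hd : 1 ≤ d) {P : Measure (Obs d)} [IsProbabilityMeasure P]
    (hT3 : DensityCondition P) (i : Fin N) :
    ∀ᵐ z ∂(Measure.pi fun _ : Fin N => P), ∀ a b, a ≠ b →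
      ‖covar (z a) - covar (z i)‖ ≠ ‖covar (z b) - covar (z i)‖ := by
  have key : ∀ a b : Fin N, a ≠ b → a ≠ i → ∀ᵐ z ∂(Measure.pi fun _ : Fin N => P),
      ‖covar (z a) - covar (z i)‖ ≠ ‖covar (z b) - covar (z i)‖ := by
    intro a b hab hai
    set E : Set (Fin N → Obs d) :=
      {z | ‖covar (z a) - covar (z i)‖ = ‖covar (z b) - covar (z i)‖} with hE
    have hEm : MeasurableSet E :=
      measurableSet_eq_fun (measurable_dist_eval i a) (measurable_dist_eval i b)
    have h0 : ∫⁻ z, E.indicator 1 z ∂(Measure.pi fun _ : Fin N => P)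
        ≤ ∫⁻ _z, 0 ∂(Measure.pi fun _ : Fin N => P) := by
      refine lintegral_le_of_lmarginal_le {a} (measurable_one.indicator hEm) measurable_const
        fun z => ?_
      rw [lmarginal_singleton, lmarginal_singleton, lintegral_zero]
      have : ∀ y : Obs d, E.indicator (1 : (Fin N → Obs d) → ℝ≥0∞) (Function.update z a y)
          = {ω | ‖covar ω - covar (z i)‖ = ‖covar (z b) - covar (z i)‖}.indicator 1 y := by
        intro y
        refine Set.indicator_eq_indicator ?_ rfl
        simp [hE, Function.update_of_ne hai.symm, Function.update_of_ne hab.symm]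
      simp_rw [this]
      rw [lintegral_indicator_one (measurableSet_eq_fun
        (measurable_covar.sub_const _).norm measurable_const), measure_covar_dist_eq hd hT3]
    rw [lintegral_indicator_one hEm, lintegral_zero] at h0
    rw [ae_iff]
    simpa [hE] using h0
  rw [ae_all_iff]
  intro a
  rw [ae_all_iff]
  intro b
  rcases eq_or_ne a b with h | h
  · exact Filter.Eventually.of_forall fun z h' => absurd h h'
  rcases eq_or_ne a i with rfl | hai
  · filter_upwards [key b a h.symm h.symm] with z hz _ using hz.symm
  · filter_upwards [key a b h hai] with z hz _ using hz

/-- The term `i = l` of the sum is already at least `l`. This gives `2l < 2D + 1`, so that the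
exponent `2 / (2D + 1)` times `l` stays below 1. -/
theorem le_degreeSum {d : ℕ} (hd : 1 ≤ d) (l : ℕ) : l ≤ degreeSum d l := by
  rcases Nat.eq_zero_or_pos l with rfl | hl
  · exact Nat.zero_le _
  calc l = l * 1 := (mul_one l).symm
    _ ≤ l * (d + l - 1).choose l :=
        Nat.mul_le_mul_left l (Nat.choose_pos (by omega))
    _ ≤ degreeSum d l :=
        Finset.single_le_sum (f := fun i => i * (d + i - 1).choose i) (fun _ _ => Nat.zero_le _)
          (Finset.mem_Icc.2 ⟨hl, le_rfl⟩)

/-- The error of the local polynomial fit at unit `i` for the opposite treatment group. -/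
noncomputable def unitError (L k : ℕ) (g : Bool → EuclideanSpace ℝ (Fin d) → ℝ) (i : Fin N)
    (z : Fin N → Obs d) : ℝ :=
  g (!treat (z i)) (covar (z i)) -
    gbar L k g (fun j => treat (z j)) (fun j => covar (z j)) (!treat (z i)) (covar (z i))

theorem measurable_unitError {L k : ℕ} (hk : 1 ≤ k) {g : Bool → EuclideanSpace ℝ (Fin d) → ℝ}
    (hg : ∀ w, Measurable (g w)) (i : Fin N) : Measurable (unitError L k g i) := by
  have hg2 : Measurable fun q : Bool × EuclideanSpace ℝ (Fin d) => g q.1 q.2 :=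
    measurable_from_prod_countable_right hg
  exact (hg2.comp ((measurable_not_treat_eval i).prodMk (measurable_covar_eval i))).sub
    (measurable_gbar hk hg measurable_treat_eval measurable_covar_eval
      (measurable_not_treat_eval i) (measurable_covar_eval i))

/-- The determinant bound divided by the block sum in `ℝ≥0∞`. If all determinants vanish the right
side is `⊤`, because the other factors are nonzero; hence `0 < Λ` and the positive radius in the
event. -/
theorem ofReal_unitError_sq_le {S : Set (EuclideanSpace ℝ (Fin d))} {L k n G : ℕ} (hk : 1 ≤ k)
    {g : Bool → EuclideanSpace ℝ (Fin d) → ℝ} {Λ γ : ℝ} (hΛ : 0 < Λ) (hγ : 0 ≤ γ)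
    (hT : ∀ w, ∀ x ∈ S, ∃ c : MultiIdx d L → ℝ, c (MultiIdx.origin d L) = g w x ∧
      ∀ y ∈ S, |g w y - ∑ α, c α * zeta L x y α| ≤ Λ * ‖y - x‖ ^ γ)
    {i j₀ : Fin N} {J : Finset (Fin N)} (hJ : J.card = k) (hj₀ : j₀ ∈ J)
    {e : Fin G × Fin n × MultiIdx d L → Fin N} (he : Function.Injective e)
    (heJ : ∀ p, e p ∈ J.erase j₀) {z : Fin N → Obs d} (hzS : ∀ j, covar (z j) ∈ S)
    (hz : z ∈ nbrsEvent S i J j₀) :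
    ENNReal.ofReal (unitError L k g i z ^ 2)
      ≤ ((Fintype.card (MultiIdx d L) * (Fintype.card (MultiIdx d L)).factorial ^ 2 : ℕ) : ℝ≥0∞) *
        k * ENNReal.ofReal (Λ ^ 2) * (ENNReal.ofReal (‖covar (z j₀) - covar (z i)‖ ^ (2 * γ)) *
          (blockDetSum L i j₀ e z)⁻¹) := by
  obtain ⟨hkw, hr, hn⟩ := nbrs_of_mem_nbrsEvent hk hJ hj₀ hz
  obtain ⟨c, hc, hcT⟩ := hT (!treat (z i)) (covar (z i)) (hzS i)
  have hrpos : 0 < ‖covar (z j₀) - covar (z i)‖ := hz.1.2.2.2.1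
  set r := ‖covar (z j₀) - covar (z i)‖ with hrdef
  set A : ℕ := Fintype.card (MultiIdx d L) * (Fintype.card (MultiIdx d L)).factorial ^ 2 with hA
  have hA0 : 0 < A := by
    have : 0 < Fintype.card (MultiIdx d L) := Fintype.card_pos_iff.2 ⟨MultiIdx.origin d L⟩
    positivity
  have hbound := sum_det_sq_mul_gbar_error_le (g := g) (X := fun j => covar (z j))
    (x := covar (z i)) hkw hrpos
    (fun j hj => by have := (Finset.mem_filter.1 hj).2.2; rwa [hr] at this)
    (B := Fin G × Fin n) (e := fun p => e (p.1.1, p.1.2, p.2))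
    (fun p q hpq => by
      have := he hpq
      simp only [Prod.mk.injEq] at this
      exact Prod.ext (Prod.ext this.1 this.2.1) this.2.2)
    (fun p => by rw [hn]; exact Finset.mem_of_mem_erase (heJ _)) hc hΛ.le hγ
    (fun j _ => hcT _ (hzS j))
  rw [hn, hJ] at hbound
  have hsum : blockDetSum L i j₀ e z = ENNReal.ofReal (∑ b : Fin G × Fin n,
      (Matrix.of fun α γ => zeta L 0 (r⁻¹ • (covar (z (e (b.1, b.2, α))) - covar (z i))) γ).det ^ 2) := by
    rw [ENNReal.ofReal_sum_of_nonneg fun _ _ => sq_nonneg _, Fintype.sum_prod_type]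
    rfl
  have h1 : ENNReal.ofReal (unitError L k g i z ^ 2) * blockDetSum L i j₀ e z
      ≤ (A : ℝ≥0∞) * k * ENNReal.ofReal (Λ ^ 2) * ENNReal.ofReal (r ^ (2 * γ)) := by
    rw [hsum, mul_comm, ← ENNReal.ofReal_mul (Finset.sum_nonneg fun _ _ => sq_nonneg _),
      ← ENNReal.ofReal_natCast A, ← ENNReal.ofReal_natCast k, ← ENNReal.ofReal_mul (by positivity),
      ← ENNReal.ofReal_mul (by positivity), ← ENNReal.ofReal_mul (by positivity), mul_assoc _ (Λ ^ 2)]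
    exact ENNReal.ofReal_le_ofReal hbound
  rw [← mul_assoc, ← div_eq_mul_inv]
  refine (ENNReal.le_div_iff_mul_le (Or.inr ?_) (Or.inl ?_)).2 h1
  · refine mul_ne_zero (mul_ne_zero (mul_ne_zero ?_ ?_) ?_) ?_
    · exact_mod_cast hA0.ne'
    · exact_mod_cast (by omega : k ≠ 0)
    · exact (ENNReal.ofReal_pos.2 (by positivity)).ne'
    · exact (ENNReal.ofReal_pos.2 (by positivity)).ne'
  · rw [hsum]; exact ENNReal.ofReal_ne_top

/-- The second moment of the error of the local polynomial fit at a unit. -/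
theorem exists_lintegral_unitError_sq_le (hd : 1 ≤ d) {P : Measure (Obs d)} [IsProbabilityMeasure P]
    (hT1 : IsCompact (covarSupport P)) (hT2 : BallCondition (covarSupport P))
    (hT3 : DensityCondition P) (hT5 : Overlap P) {l : ℕ} {γ : ℝ} (hγ : 0 ≤ γ)
    {g : Bool → EuclideanSpace ℝ (Fin d) → ℝ} (hg : ∀ w, Measurable (g w)) {Λ M : ℝ} (hΛ : 0 < Λ)
    (hM : ∀ w, ∀ x ∈ covarSupport P, |g w x| ≤ M)
    (hT : ∀ w, ∀ x ∈ covarSupport P, ∃ c : MultiIdx d l → ℝ, c (MultiIdx.origin d l) = g w x ∧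
      ∀ y ∈ covarSupport P, |g w y - ∑ α, c α * zeta l x y α| ≤ Λ * ‖y - x‖ ^ γ) :
    ∃ C : ℝ≥0, ∀ (N k : ℕ) (i : Fin N), (2 * degreeSum d l + 1) * numMonomials d l + 1 ≤ k →
      ∫⁻ z, ENNReal.ofReal (unitError l k g i z ^ 2) ∂(Measure.pi fun _ : Fin N => P)
        ≤ C * ENNReal.ofReal (((k : ℝ) / N) ^ (2 * γ / d)) := by
  classical
  set S := covarSupport P with hSdef
  set Δ := Metric.diam S with hΔdef
  have hS : MeasurableSet S := (isClosed_covarSupport P).measurableSet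
  have hSb : Bornology.IsBounded S := hT1.isBounded
  have hΔ : 0 < Δ := diam_covarSupport_pos hd hT1 hT3
  obtain ⟨c, hc, hP⟩ := exists_le_measure_groupBall hd hT2 hT3 hT5
  obtain ⟨C₀, hC₀⟩ := exists_lintegral_cappedRadius_rpow_le hd hS hSb
    (ae_covar_mem_covarSupport P) hc hP (a := 2 * γ) (by positivity)
  set n := 2 * degreeSum d l + 1 with hn
  set K := Fintype.card (MultiIdx d l) with hK
  have hK0 : 0 < K := Fintype.card_pos_iff.2 ⟨MultiIdx.origin d l⟩
  have hn0 : 0 < n := by omega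
  have hsl : (2 / n : ℝ) * l < 1 := by
    have h1 : 2 * l < n := by have := le_degreeSum hd l; omega
    have h2 : (2 * l : ℝ) < n := by exact_mod_cast h1
    rw [div_mul_eq_mul_div, div_lt_one (by exact_mod_cast hn0)]
    exact h2
  obtain ⟨C₁, hC₁⟩ := exists_lintegral_groupBall_abs_sum_zeta_rpow_neg_le hd hT2 hT3 hT5
    (s := 2 / n) (by positivity) l hsl
  set A : ℕ := K * K.factorial ^ 2 with hA
  set C₂ : ℝ≥0 := A * (2 * (n * K)) * (Λ ^ 2).toNNReal * (C₁ ^ K) ^ n with hC₂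
  -- With too few units the fit is 0 and the squared error at most `M ^ 2`, while the capped radius
  -- equals `Δ`.
  set C₃ : ℝ≥0 := (M ^ 2 / Δ ^ (2 * γ)).toNNReal with hC₃
  refine ⟨(C₂ + C₃) * C₀, fun N k i hk => ?_⟩
  have hk' : n * K + 1 ≤ k := hk
  have hk1 : 1 ≤ k := by omega
  set π := Measure.pi fun _ : Fin N => P with hπ
  set R : (Fin N → Obs d) → ℝ≥0∞ := fun z =>
    ENNReal.ofReal (cappedRadius Δ k i z ^ (2 * γ)) with hR
  have hgood : ∀ᵐ z ∂π, ∀ j, covar (z j) ∈ S := by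
    rw [ae_all_iff]
    exact fun j => (Measure.quasiMeasurePreserving_eval (fun _ : Fin N => P) j).ae
      (ae_covar_mem_covarSupport P)
  -- The number of full groups of `n` blocks of `K` points among the `k - 1` strict neighbours; the
  -- lower bound on `k` makes it positive.
  set G := (k - 1) / (n * K) with hG
  have hnK : 0 < n * K := by positivity
  have hG0 : 0 < G := Nat.div_pos (by omega) hnK
  -- Makes `k / G` bounded: the `k` residuals in the error bound are paid for by the `1/G` from
  -- averaging over groups.
  have hGk : k ≤ 2 * (n * K) * G := by
    have h1 : k - 1 < n * K * (G + 1) := Nat.lt_mul_div_succ (k - 1) hnK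
    have h2 : n * K * 1 ≤ n * K * G := Nat.mul_le_mul_left _ hG0
    have h3 : n * K * (G + 1) = n * K * G + n * K := by ring
    have h4 : 2 * (n * K) * G = n * K * G + n * K * G := by ring
    omega
  set T : Finset (Finset (Fin N) × Fin N) :=
    Finset.univ.filter fun p => p.1.card = k ∧ p.2 ∈ p.1 ∧ i ∉ p.1 with hTdef
  set E : Finset (Fin N) × Fin N → Set (Fin N → Obs d) := fun p => nbrsEvent S i p.1 p.2 with hE
  have hEm : ∀ p, MeasurableSet (E p) := fun p => measurableSet_nbrsEvent hS i p.1 p.2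
  set err : (Fin N → Obs d) → ℝ≥0∞ := fun z => ENNReal.ofReal (unitError l k g i z ^ 2) with herr
  have herrm : Measurable err := ENNReal.measurable_ofReal.comp
    ((measurable_unitError hk1 hg i).pow_const 2)
  have hevent : ∀ p ∈ T, ∫⁻ z in E p, err z ∂π ≤ C₂ * ∫⁻ z in E p, R z ∂π := by
    rintro ⟨J, j₀⟩ hp
    obtain ⟨hJ, hj₀, hiJ⟩ := (Finset.mem_filter.1 hp).2
    simp only at hJ hj₀ hiJ
    have hcard : Fintype.card (Fin G × Fin n × MultiIdx d l)
        ≤ Fintype.card (J.erase j₀ : Finset (Fin N)) := by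
      rw [Fintype.card_coe, Finset.card_erase_of_mem hj₀, hJ, Fintype.card_prod, Fintype.card_prod,
        Fintype.card_fin, Fintype.card_fin]
      exact Nat.div_mul_le_self _ _
    obtain ⟨e'⟩ := Function.Embedding.nonempty_of_card_le hcard
    set e : Fin G × Fin n × MultiIdx d l → Fin N := fun p => (e' p).1 with he
    have hei : Function.Injective e := Subtype.val_injective.comp e'.injective
    have heJ : ∀ p, e p ∈ J.erase j₀ := fun p => (e' p).2
    have hRr : ∀ z ∈ E (J, j₀), ENNReal.ofReal (‖covar (z j₀) - covar (z i)‖ ^ (2 * γ)) = R z := by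
      intro z hz
      obtain ⟨h1, h2, -⟩ := nbrs_of_mem_nbrsEvent hk1 hJ hj₀ hz
      simp only [hR, cappedRadius]
      rw [if_pos h1, h2]
    have hmain := lintegral_nbrsEvent_inv_blockDetSum_le hS hSb hn0
      (fun x hx r hr hrd w => (lt_of_lt_of_le (ENNReal.ofReal_pos.2 (by positivity))
        (hP x hx r hr.le hrd w)).ne') hC₁ (i := i) (j₀ := j₀) hiJ hG0 hei heJ (2 * γ)
    set B : ℝ≥0∞ := (A : ℝ≥0∞) * k * ENNReal.ofReal (Λ ^ 2) with hB
    have hBtop : B ≠ ⊤ := by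
      refine ENNReal.mul_ne_top (ENNReal.mul_ne_top ?_ ?_) ENNReal.ofReal_ne_top <;> simp
    have hGG : (k : ℝ≥0∞) * (G : ℝ≥0∞)⁻¹ ≤ ((2 * (n * K) : ℕ) : ℝ≥0∞) := by
      rw [← div_eq_mul_inv]
      refine ENNReal.div_le_of_le_mul ?_
      exact_mod_cast hGk
    calc ∫⁻ z in E (J, j₀), err z ∂π
        ≤ ∫⁻ z in E (J, j₀), B * (ENNReal.ofReal (‖covar (z j₀) - covar (z i)‖ ^ (2 * γ)) *
            (blockDetSum l i j₀ e z)⁻¹) ∂π := by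
          refine lintegral_mono_ae ?_
          filter_upwards [ae_restrict_of_ae hgood, ae_restrict_mem (hEm (J, j₀))] with z hz hzE
          exact ofReal_unitError_sq_le hk1 hΛ hγ hT hJ hj₀ hei heJ hz hzE
      _ = B * ∫⁻ z in E (J, j₀), ENNReal.ofReal (‖covar (z j₀) - covar (z i)‖ ^ (2 * γ)) *
            (blockDetSum l i j₀ e z)⁻¹ ∂π := lintegral_const_mul' _ _ hBtop
      _ ≤ B * (((G : ℝ≥0∞)⁻¹ * ((C₁ : ℝ≥0∞) ^ K) ^ n) *
            ∫⁻ z in E (J, j₀), ENNReal.ofReal (‖covar (z j₀) - covar (z i)‖ ^ (2 * γ)) ∂π) := by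
          exact mul_le_mul' le_rfl hmain
      _ = (A * (k * (G : ℝ≥0∞)⁻¹) * ENNReal.ofReal (Λ ^ 2) * ((C₁ : ℝ≥0∞) ^ K) ^ n) *
            ∫⁻ z in E (J, j₀), R z ∂π := by
          rw [setLIntegral_congr_fun (hEm (J, j₀)) hRr, hB]
          ring
      _ ≤ (A * ((2 * (n * K) : ℕ) : ℝ≥0∞) * ENNReal.ofReal (Λ ^ 2) * ((C₁ : ℝ≥0∞) ^ K) ^ n) *
            ∫⁻ z in E (J, j₀), R z ∂π := by gcongr
      _ = C₂ * ∫⁻ z in E (J, j₀), R z ∂π := by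
          rw [hC₂]
          push_cast
          rfl
  -- Almost surely there are no ties, so either one of the events occurs or the opposite group is
  -- too small.
  have hcover : ∀ᵐ z ∂π, err z ≤ ∑ p ∈ T, (E p).indicator err z + C₃ * R z := by
    filter_upwards [hgood, ae_dist_injective hd hT3 i] with z hz hties
    by_cases hkw : k ≤ groupSize (fun j => treat (z j)) (!treat (z i))
    · obtain ⟨J, j₀, hj₀, hJ, hiJ, hzE⟩ := exists_mem_nbrsEvent hk1 hz hties hkw
      refine le_add_right ?_
      have hpT : (J, j₀) ∈ T := Finset.mem_filter.2 ⟨Finset.mem_univ _, hJ, hj₀, hiJ⟩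
      calc err z = (E (J, j₀)).indicator err z := (Set.indicator_of_mem hzE _).symm
        _ ≤ _ := Finset.single_le_sum (f := fun p => (E p).indicator err z)
          (fun _ _ => zero_le) hpT
    · refine le_add_left ?_
      simp only [herr, hR, unitError, cappedRadius, gbar, if_neg hkw, sub_zero]
      rw [hC₃]
      change _ ≤ ENNReal.ofReal _ * _
      rw [← ENNReal.ofReal_mul (by positivity), div_mul_cancel₀ _ (Real.rpow_pos_of_pos hΔ _).ne']
      refine ENNReal.ofReal_le_ofReal ?_
      rw [← sq_abs]
      exact pow_le_pow_left₀ (abs_nonneg _) (hM _ _ (hz i)) 2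
  have hdisj : Set.PairwiseDisjoint (↑T) E := by
    rintro ⟨J, j₀⟩ hp ⟨J₁, j₁⟩ hp₁ hne
    obtain ⟨hJ, hj₀, -⟩ := (Finset.mem_filter.1 hp).2
    obtain ⟨hJ₁, hj₁, -⟩ := (Finset.mem_filter.1 hp₁).2
    refine Set.disjoint_left.2 fun z hz hz₁ => hne ?_
    obtain ⟨h1, h2⟩ := nbrsEvent_unique hk1 hJ hj₀ hJ₁ hj₁ hz hz₁
    exact Prod.ext h1 h2
  calc ∫⁻ z, err z ∂π ≤ ∫⁻ z, (∑ p ∈ T, (E p).indicator err z + C₃ * R z) ∂π :=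
        lintegral_mono_ae hcover
    _ = ∑ p ∈ T, ∫⁻ z in E p, err z ∂π + C₃ * ∫⁻ z, R z ∂π := by
        rw [lintegral_add_left (Finset.measurable_sum _ fun p _ => herrm.indicator (hEm p)),
          lintegral_finsetSum _ fun p _ => herrm.indicator (hEm p),
          lintegral_const_mul' _ _ ENNReal.coe_ne_top]
        simp_rw [lintegral_indicator (hEm _)]
    _ ≤ ∑ p ∈ T, C₂ * ∫⁻ z in E p, R z ∂π + C₃ * ∫⁻ z, R z ∂π := by
        gcongr with p hp
        exact hevent p hp
    _ = C₂ * ∫⁻ z in ⋃ p ∈ T, E p, R z ∂π + C₃ * ∫⁻ z, R z ∂π := by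
        rw [lintegral_biUnion_finset hdisj fun p _ => hEm p, Finset.mul_sum]
    _ ≤ C₂ * ∫⁻ z, R z ∂π + C₃ * ∫⁻ z, R z ∂π := by
        gcongr
        exact Measure.restrict_le_self
    _ = (C₂ + C₃) * ∫⁻ z, R z ∂π := by rw [add_mul]
    _ ≤ (C₂ + C₃) * (C₀ * ENNReal.ofReal (((k : ℝ) / N) ^ (2 * γ / d))) := by
        gcongr
        exact hC₀ N k i hk1
    _ = _ := by push_cast; ring

end LocalATE

/-! ### From the unit errors to the conditional bias -/

namespace LocalATE

variable {d N : ℕ}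

theorem HolderExtension.continuousOn {l : ℕ} {β : ℝ≥0} {S : Set (EuclideanSpace ℝ (Fin d))}
    {g : EuclideanSpace ℝ (Fin d) → ℝ} (hg : HolderExtension l β S g) : ContinuousOn g S := by
  obtain ⟨U, G, -, -, hSU, hgG, hG, -⟩ := hg
  exact (hG.continuousOn.mono hSU).congr hgG

/-- Only values on the support matter, so `g` may be cut off there; unlike `g` itself, the cut-off
function is measurable on the whole space. -/
theorem HolderExtension.indicator {l : ℕ} {β : ℝ≥0} {S : Set (EuclideanSpace ℝ (Fin d))}
    {g : EuclideanSpace ℝ (Fin d) → ℝ} (hg : HolderExtension l β S g) :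
    HolderExtension l β S (S.indicator g) := by
  obtain ⟨U, G, hU, hconv, hSU, hgG, hG⟩ := hg
  exact ⟨U, G, hU, hconv, hSU, fun x hx => by rw [Set.indicator_of_mem hx, hgG hx], hG⟩

theorem measurable_indicator_of_continuousOn {S : Set (EuclideanSpace ℝ (Fin d))}
    (hS : MeasurableSet S) {g : EuclideanSpace ℝ (Fin d) → ℝ} (hg : ContinuousOn g S) :
    Measurable (S.indicator g) := by
  classical
  rw [← Set.piecewise_eq_indicator]
  exact hg.measurable_piecewise continuousOn_const hS

theorem condBias_congr {L k : ℕ} {g g' : Bool → EuclideanSpace ℝ (Fin d) → ℝ} {W : Fin N → Bool}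
    {X : Fin N → EuclideanSpace ℝ (Fin d)} (h : ∀ w i, g w (X i) = g' w (X i)) :
    condBias L k g W X = condBias L k g' W X := by
  simp only [condBias, gbar, h]

theorem condBias_sq_le (L k : ℕ) (g : Bool → EuclideanSpace ℝ (Fin d) → ℝ) (z : Fin N → Obs d) :
    condBias L k g (fun i => treat (z i)) (fun i => covar (z i)) ^ 2
      ≤ (N : ℝ)⁻¹ * ∑ i, unitError L k g i z ^ 2 := by
  have h1 : condBias L k g (fun i => treat (z i)) (fun i => covar (z i))
      = (N : ℝ)⁻¹ * ∑ i, (if treat (z i) = true then (1 : ℝ) else -1) * unitError L k g i z := rfl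
  have h2 := sq_sum_le_card_mul_sum_sq (s := Finset.univ)
    (f := fun i => (if treat (z i) = true then (1 : ℝ) else -1) * unitError L k g i z)
  have h3 : ∀ i, ((if treat (z i) = true then (1 : ℝ) else -1) * unitError L k g i z) ^ 2
      = unitError L k g i z ^ 2 := by
    intro i
    split_ifs <;> ring
  simp_rw [h3, Finset.card_univ, Fintype.card_fin] at h2
  rw [h1, mul_pow]
  rcases Nat.eq_zero_or_pos N with rfl | hN
  · simp
  have hN' : (0 : ℝ) < N := by exact_mod_cast hN
  calc ((N : ℝ)⁻¹) ^ 2 * (∑ i, (if treat (z i) = true then (1 : ℝ) else -1) *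
        unitError L k g i z) ^ 2
      ≤ ((N : ℝ)⁻¹) ^ 2 * (N * ∑ i, unitError L k g i z ^ 2) := by gcongr
    _ = _ := by field_simp

theorem measurable_condBias {L k : ℕ} (hk : 1 ≤ k) {g : Bool → EuclideanSpace ℝ (Fin d) → ℝ}
    (hg : ∀ w, Measurable (g w)) : Measurable fun z : Fin N → Obs d =>
      condBias L k g (fun i => treat (z i)) (fun i => covar (z i)) := by
  refine (Finset.measurable_sum _ fun i _ => Measurable.mul ?_ (measurable_unitError hk hg i)).const_mul _
  exact Measurable.ite (measurableSet_eq_fun (measurable_treat_eval i) measurable_const)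
    measurable_const measurable_const

theorem lintegral_condBias_sq_le {P : Measure (Obs d)} [IsProbabilityMeasure P] {L k : ℕ}
    (hN : 1 ≤ N) (hk : 1 ≤ k) {g : Bool → EuclideanSpace ℝ (Fin d) → ℝ}
    (hg : ∀ w, Measurable (g w)) {D : ℝ≥0∞}
    (hD : ∀ i : Fin N, ∫⁻ z, ENNReal.ofReal (unitError L k g i z ^ 2)
      ∂(Measure.pi fun _ : Fin N => P) ≤ D) :
    ∫⁻ z, ENNReal.ofReal (condBias L k g (fun i => treat (z i)) (fun i => covar (z i)) ^ 2)
      ∂(Measure.pi fun _ : Fin N => P) ≤ D := by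
  have hN' : (0 : ℝ) < N := by exact_mod_cast hN
  calc _ ≤ ∫⁻ z, ENNReal.ofReal (N : ℝ)⁻¹ * ∑ i, ENNReal.ofReal (unitError L k g i z ^ 2)
        ∂(Measure.pi fun _ : Fin N => P) := by
        refine lintegral_mono fun z => ?_
        rw [← ENNReal.ofReal_sum_of_nonneg fun _ _ => sq_nonneg _,
          ← ENNReal.ofReal_mul (by positivity)]
        exact ENNReal.ofReal_le_ofReal (condBias_sq_le L k g z)
    _ = ENNReal.ofReal (N : ℝ)⁻¹ * ∑ i, ∫⁻ z, ENNReal.ofReal (unitError L k g i z ^ 2)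
        ∂(Measure.pi fun _ : Fin N => P) := by
        rw [lintegral_const_mul' _ _ ENNReal.ofReal_ne_top, lintegral_finsetSum]
        exact fun i _ => ENNReal.measurable_ofReal.comp ((measurable_unitError hk hg i).pow_const 2)
    _ ≤ ENNReal.ofReal (N : ℝ)⁻¹ * ∑ _i : Fin N, D := by
        gcongr with i _; exact hD i
    _ = D := by
        rw [Finset.sum_const, Finset.card_univ, Fintype.card_fin, nsmul_eq_mul, ← mul_assoc,
          ENNReal.ofReal_inv_of_pos hN', ENNReal.ofReal_natCast,
          ENNReal.inv_mul_cancel (by exact_mod_cast hN'.ne') (by simp), one_mul]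

end LocalATE

theorem mainTheorem9 {d : ℕ} (hd : 1 ≤ d)
    -- the law of the generic vector `(W, X, (Y(0), Y(1)))`
    (P : Measure (LocalATE.Obs d)) [IsProbabilityMeasure P]
    (hY : ∀ w, Integrable (fun z : LocalATE.Obs d => LocalATE.outcome z w) P)
    (hT1 : IsCompact (LocalATE.covarSupport P))
    (hT2 : LocalATE.BallCondition (LocalATE.covarSupport P))
    (hT3 : LocalATE.DensityCondition P)
    (hT4 : LocalATE.Unconfounded P)
    (hT5 : LocalATE.Overlap P)
    (g : Bool → EuclideanSpace ℝ (Fin d) → ℝ) (hg : LocalATE.IsRegression P g)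
    (l : ℕ) (β : ℝ≥0) (hβ0 : 0 < β) (hβ1 : β ≤ 1)
    (hsmooth : ∀ w, LocalATE.HolderExtension l β (LocalATE.covarSupport P) (g w)) :
    ∃ C : ℝ, 0 < C ∧
      ∀ N k : ℕ, 1 ≤ N →
        (2 * LocalATE.degreeSum d l + 1) * LocalATE.numMonomials d l + 1 ≤ k →
        -- every i.i.d. sample of size `N` of the generic vector
        ∀ {Ω : Type*} [MeasurableSpace Ω] (μ : Measure Ω) [IsProbabilityMeasure μ]
          (Z : Fin N → Ω → LocalATE.Obs d), iIndepFun Z μ → (∀ i, HasLaw (Z i) P μ) →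
          let B : Ω → ℝ := fun ω =>
            LocalATE.condBias l k g (fun i => LocalATE.treat (Z i ω))
              (fun i => LocalATE.covar (Z i ω))
          MemLp B 2 μ ∧
            ∫ ω, B ω ^ 2 ∂μ ≤ C * ((k : ℝ) / (N : ℝ)) ^ (2 * ((l : ℝ) + (β : ℝ)) / (d : ℝ)) := by
  set S := LocalATE.covarSupport P with hSdef
  have hS : MeasurableSet S := (LocalATE.isClosed_covarSupport P).measurableSet
  -- All covariates lie in the support almost surely, so the measurable `g'` gives the same bias as
  -- `g`.
  set g' : Bool → EuclideanSpace ℝ (Fin d) → ℝ := fun w => S.indicator (g w) with hg'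
  have hg'm : ∀ w, Measurable (g' w) := fun w =>
    LocalATE.measurable_indicator_of_continuousOn hS (hsmooth w).continuousOn
  have hg'S : ∀ w, ∀ x ∈ S, g w x = g' w x := fun w x hx => (Set.indicator_of_mem hx _).symm
  have hbd : ∀ w, ∃ M, ∀ x ∈ S, |g' w x| ≤ M := by
    intro w
    obtain ⟨M, hM⟩ := hT1.exists_bound_of_continuousOn (hsmooth w).indicator.continuousOn
    exact ⟨M, hM⟩
  choose M hM using hbd
  choose Λ hΛ0 hΛ using fun w => LocalATE.exists_taylor_of_holderExtension hβ0 (hsmooth w).indicator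
  obtain ⟨C, hC⟩ := LocalATE.exists_lintegral_unitError_sq_le hd hT1 hT2 hT3 hT5 (l := l)
    (γ := (l : ℝ) + β) (by positivity) hg'm (Λ := max (Λ false) (Λ true) + 1)
    (M := max (M false) (M true))
    (by have := (hΛ0 false).trans (le_max_left (Λ false) (Λ true)); linarith)
    (fun w x hx => (hM w x hx).trans (by cases w; exacts [le_max_left _ _, le_max_right _ _]))
    (fun w x hx => by
      obtain ⟨c, hc, hcy⟩ := hΛ w x hx
      refine ⟨c, hc, fun y hy => (hcy y hy).trans ?_⟩
      refine mul_le_mul_of_nonneg_right ?_ (by positivity)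
      have : Λ w ≤ max (Λ false) (Λ true) := by cases w; exacts [le_max_left _ _, le_max_right _ _]
      linarith)
  refine ⟨C + 1, by positivity, fun N k hN hk Ω _ μ _ Z hind hlaw => ?_⟩
  intro B
  have hk1 : 1 ≤ k := by omega
  set ζ : Ω → Fin N → LocalATE.Obs d := fun ω i => Z i ω with hζ
  have hZm : ∀ i, AEMeasurable (Z i) μ := fun i => (hlaw i).aemeasurable
  have hζm : AEMeasurable ζ μ := aemeasurable_pi_lambda _ hZm
  -- The bias depends only on the joint law of the sample, so the estimate on the product space,
  -- whose constant is already fixed, transfers to any `Ω`.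
  have hmap : μ.map ζ = Measure.pi fun _ : Fin N => P := by
    rw [hζ, (iIndepFun_iff_map_fun_eq_pi_map hZm).1 hind]
    congr 1
    ext1 i
    exact (hlaw i).map_eq
  set b : (Fin N → LocalATE.Obs d) → ℝ := fun z =>
    LocalATE.condBias l k g' (fun i => LocalATE.treat (z i)) (fun i => LocalATE.covar (z i)) with hb
  have hbm : Measurable b := LocalATE.measurable_condBias hk1 hg'm
  have hBb : B =ᵐ[μ] fun ω => b (ζ ω) := by
    have hmem : ∀ᵐ ω ∂μ, ∀ i, LocalATE.covar (Z i ω) ∈ S := by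
      rw [ae_all_iff]
      intro i
      have h1 : ∀ᵐ z ∂P, LocalATE.covar z ∈ S := LocalATE.ae_covar_mem_covarSupport P
      have h2 : ∀ᵐ z ∂(μ.map (Z i)), LocalATE.covar z ∈ S := by rw [(hlaw i).map_eq]; exact h1
      exact ae_of_ae_map (hZm i) h2
    filter_upwards [hmem] with ω hω
    exact LocalATE.condBias_congr fun w i => hg'S w _ (hω i)
  have hBm : AEStronglyMeasurable B μ :=
    ((hbm.comp_aemeasurable hζm).congr hBb.symm).aestronglyMeasurable
  set E : ℝ := ((k : ℝ) / N) ^ (2 * ((l : ℝ) + β) / d) with hE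
  have hE0 : 0 ≤ E := by positivity
  have hlint : ∫⁻ ω, ENNReal.ofReal (B ω ^ 2) ∂μ ≤ ENNReal.ofReal (C * E) := by
    calc ∫⁻ ω, ENNReal.ofReal (B ω ^ 2) ∂μ = ∫⁻ ω, ENNReal.ofReal (b (ζ ω) ^ 2) ∂μ :=
          lintegral_congr_ae (hBb.mono fun ω hω => by simp only [hω])
      _ = ∫⁻ z, ENNReal.ofReal (b z ^ 2) ∂(Measure.pi fun _ : Fin N => P) := by
          rw [← hmap, lintegral_map' (f := fun z => ENNReal.ofReal (b z ^ 2))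
            (ENNReal.measurable_ofReal.comp (hbm.pow_const 2)).aemeasurable hζm]
      _ ≤ C * ENNReal.ofReal E :=
          LocalATE.lintegral_condBias_sq_le hN hk1 hg'm fun i => hC N k i hk
      _ = ENNReal.ofReal (C * E) := by
          rw [ENNReal.ofReal_mul C.coe_nonneg, ENNReal.ofReal_coe_nnreal]
  have hsq : 0 ≤ᵐ[μ] fun ω => B ω ^ 2 := Filter.Eventually.of_forall fun ω => sq_nonneg _
  have hBsq : AEStronglyMeasurable (fun ω => B ω ^ 2) μ := hBm.pow 2
  refine ⟨?_, ?_⟩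
  · rw [memLp_two_iff_integrable_sq hBm]
    exact (lintegral_ofReal_ne_top_iff_integrable hBsq hsq).1
      (hlint.trans_lt ENNReal.ofReal_lt_top).ne
  · rw [integral_eq_lintegral_of_nonneg_ae hsq hBsq]
    refine (ENNReal.toReal_le_of_le_ofReal (by positivity) hlint).trans ?_
    exact mul_le_mul_of_nonneg_right (by linarith) hE0
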